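/- **Arithmetic circuits.** An arithmetic circuit over $\mathbb{C}$ performs a finite list of operations $+,-,\times$ on input variables, complex constants and earlier results; its operation count is the total number of these operations (multiplications by constants included). Let $\omega$ be the exponent of matrix multiplication over $\mathbb{C}$: the infimum of all real $\tau$ such that $n\times n$ matrices can be multiplied by arithmetic circuits with $O(n^{\tau})$ operations. **DFT.** Let $G$ be a finite group and let $\mathrm{Irr}(G)$ be a complete set of pairwise inequivalent irreducible complex matrix representations of $G$ (one, in any chosen basis, from each isomorphism class). The generalized DFT over $G$ with respect to $\mathrm{Irr}(G)$ is the linear map $$\mathbb{C}^G\to\bigoplus_{\rho\in\mathrm{Irr}(G)}\mathbb{C}^{\dim\rho\times\dim\rho},\qquad c\mapsto \sum_{g\in G} c_g\bigoplus_{\rho\in \mathrm{Irr}(G)}\rho(g).$$ **Split $(B,N)$-pairs.** A $(B,N)$-pair in $G$ consists of subgroups $B,N$ that generate $G$, with $B\cap N$ normal in $N$, and a set $S$ of generators $s$, with $s^2=1$, of the Weyl group $W=N/(B\cap N)$, such that for every $\dot s\in N$ representing an element of $S$ and every $n\in N$ we have $\dot s B n\subseteq B\dot s nB\cup BnB$ and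 $\dot s B\dot s^{-1}\neq B$. It is split if, with $T=B\cap N$, there are a prime $p$ and a normal $p$-subgroup $U$ of $B$ with $B=UT$ and $U\cap T=\{1\}$, the group $T$ is abelian, and $\bigcap_{n\in N} nBn^{-1}=T$. **Theorem.** For every $\epsilon>0$ there is a constant $C_\epsilon$ such that for every finite group $G$ with a split $(B,N)$-pair, with Weyl group $W$, and every complete set $\mathrm{Irr}(G)$ of irreducible matrix representations as above, the generalized DFT over $G$ with respect to $\mathrm{Irr}(G)$ can be computed by an arithmetic circuit with at most $$C_\epsilon\,|G|^{\omega/2+\epsilon}\,|W|$$ operations. -/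

import Mathlib

/-! ### Arithmetic circuits -/

namespace Arith

/-- An operand of a gate over the coefficient ring `k`: an input variable, a constant of `k`, or the
result of the gate with number `j` (counted from `0`). -/
inductive Arg (k : Type*) (I : Type*) where
  | input (i : I) : Arg k I
  | const (a : k) : Arg k I
  | gate (j : ℕ) : Arg k I

/-- The arithmetic operations. -/
inductive Op where
  | add : Op
  | sub : Op
  | mul : Op

/-- A gate performs one operation on two operands. -/
structure Gate (k : Type*) (I : Type*) where
  op : Op
  left : Arg k I
  right : Arg k I

/-- An arithmetic circuit (straight-line program) with input variables `I` and outputs `O`: a list of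
gates, performed in order, and for each output the place where its value is found. -/
structure Circuit (k : Type*) (I : Type*) (O : Type*) where
  gates : List (Gate k I)
  output : O → Arg k I

variable {k I O : Type*} [Ring k]

/-- The value of an operand, where `v` lists the results of the gates performed so far. A reference
to a gate which has not yet been performed reads the constant `0`. -/
def Arg.val (x : I → k) (v : List k) : Arg k I → k
  | .input i => x i
  | .const a => a
  | .gate j => v.getD j 0

def Op.apply : Op → k → k → k
  | .add, a, b => a + b
  | .sub, a, b => a - b
  | .mul, a, b => a * b

def Gate.val (x : I → k) (v : List k) (γ : Gate k I) : k :=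
  γ.op.apply (γ.left.val x v) (γ.right.val x v)

/-- The list of the results of all gates of the circuit on the input `x`. -/
def Circuit.results (Γ : Circuit k I O) (x : I → k) : List k :=
  Γ.gates.foldl (fun v γ => v ++ [γ.val x v]) []

def Circuit.eval (Γ : Circuit k I O) (x : I → k) (o : O) : k :=
  (Γ.output o).val x (Γ.results x)

/-- The number of operations: every gate counts, those with a constant operand included. -/
def Circuit.size (Γ : Circuit k I O) : ℕ := Γ.gates.length

def Circuit.Computes (Γ : Circuit k I O) (F : (I → k) → O → k) : Prop :=
  ∀ x, Γ.eval x = F x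

end Arith

/-! ### The exponent of matrix multiplication -/

/-- The product of two `n × n` matrices as a function of their `2 n ^ 2` entries. -/
def matMul (n : ℕ) (x : (Fin n × Fin n) ⊕ (Fin n × Fin n) → ℂ) (o : Fin n × Fin n) : ℂ :=
  ((Matrix.of fun i j => x (Sum.inl (i, j))) * (Matrix.of fun i j => x (Sum.inr (i, j))) :
    Matrix (Fin n) (Fin n) ℂ) o.1 o.2

/-- The exponent `ω` of matrix multiplication over `ℂ`: the infimum of the `τ` such that `n × n`
matrices can be multiplied by arithmetic circuits with `O(n ^ τ)` operations. -/
noncomputable def matMulExponent : ℝ :=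
  sInf {τ : ℝ | ∃ C : ℝ, ∀ n : ℕ, ∃ Γ : Arith.Circuit ℂ ((Fin n × Fin n) ⊕ (Fin n × Fin n)) (Fin n × Fin n),
    Γ.Computes (matMul n) ∧ (Γ.size : ℝ) ≤ C * (n : ℝ) ^ τ}

/-! ### The generalized discrete Fourier transform -/

/-- A complete set of irreducible complex representations of `G`, each in coordinates: every
irreducible complex representation is isomorphic to exactly one member. -/
structure CompleteIrreps (G : Type*) [Group G] where
  ι : Type
  dim : ι → ℕ
  ρ : (i : ι) → Representation ℂ G (Fin (dim i) → ℂ)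
  irreducible : ∀ i, (ρ i).IsIrreducible
  eq_of_equiv : ∀ i j, Nonempty ((ρ i).Equiv (ρ j)) → i = j
  complete : ∀ (n : ℕ) (σ : Representation ℂ G (Fin n → ℂ)), σ.IsIrreducible →
    ∃ i, Nonempty ((ρ i).Equiv σ)

namespace CompleteIrreps

variable {G : Type*} [Group G]

/-- The positions of the matrix entries of the direct sum of the representations. -/
abbrev Entry (R : CompleteIrreps G) : Type :=
  Σ i : R.ι, Fin (R.dim i) × Fin (R.dim i)

/-- The DFT: the map that takes `c` to the matrix entries of `∑ g, c g • ⨁ i, ρ i g`. -/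
noncomputable def dft [Fintype G] (R : CompleteIrreps G) (c : G → ℂ) (e : R.Entry) : ℂ :=
  (∑ g : G, c g • LinearMap.toMatrix' (R.ρ e.1 g)) e.2.1 e.2.2

end CompleteIrreps

/-! ### Split `(B, N)`-pairs -/

/-- A `(B, N)`-pair (Tits system) in `G`. -/
structure BNPair (G : Type*) [Group G] where
  B : Subgroup G
  N : Subgroup G
  sup_eq_top : B ⊔ N = ⊤
  [normal : ((B ⊓ N).subgroupOf N).Normal]
  /-- The distinguished generators of the Weyl group. -/
  S : Set (N ⧸ (B ⊓ N).subgroupOf N)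
  closure_S : Subgroup.closure S = ⊤
  mul_self : ∀ s ∈ S, s * s = 1
  mul_mem : ∀ s n : N, (QuotientGroup.mk s : N ⧸ (B ⊓ N).subgroupOf N) ∈ S → ∀ b ∈ B,
    (s : G) * b * n ∈
      DoubleCoset.doubleCoset ((s : G) * n) B B ∪ DoubleCoset.doubleCoset (n : G) B B
  /-- `s` does not normalize `B`. -/
  conj_notMem : ∀ s : N, (QuotientGroup.mk s : N ⧸ (B ⊓ N).subgroupOf N) ∈ S →
    ∃ b ∈ B, (s : G) * b * (s : G)⁻¹ ∉ B

/-- The Weyl group `N / (B ∩ N)`. -/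
abbrev BNPair.W {G : Type*} [Group G] (P : BNPair G) : Type _ :=
  P.N ⧸ (P.B ⊓ P.N).subgroupOf P.N

/-- A split `(B, N)`-pair (of characteristic `p`): `B` is the semidirect product of a normal
`p`-subgroup `U` and the abelian group `T = B ∩ N`, and `T` is the intersection of the
`N`-conjugates of `B`. It is often required in addition that `p` does not divide the order of `T`;
this is not assumed here. -/
structure SplitBNPair (G : Type*) [Group G] extends BNPair G where
  p : ℕ
  prime : p.Prime
  U : Subgroup G
  U_le : U ≤ B
  U_normal : (U.subgroupOf B).Normal
  isPGroup : IsPGroup p U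
  comm : ∀ x ∈ B ⊓ N, ∀ y ∈ B ⊓ N, x * y = y * x
  inf_eq_bot : U ⊓ (B ⊓ N) = ⊥
  sup_eq : U ⊔ (B ⊓ N) = B
  saturated : ∀ g : G, (∀ n ∈ N, n * g * n⁻¹ ∈ B) → g ∈ B ⊓ N

/-!
# Fast Fourier transforms over groups with a split `(B, N)`-pair

Write `ω` for the exponent of matrix multiplication. The group is the union of `|W|` double cosets
`U n B`, one for each element of the Weyl group (`SplitBNPair.exists_eq_mul`), and it suffices to
transform a function supported on one of them, that is, to compute `∑ β(u, b) ρ(u) ρ(n) ρ(b)` for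
all irreducible `ρ` simultaneously, with about `|G| ^ (ω / 2)` operations.

For subgroups `H` and `K` with `|H| |K| ≤ |G|` this is `Arith.hasCircuit_two_subgroups`. In bases
adapted to `H` on the left and to `K` on the right, `ρ(h)` and `ρ(k)` are block diagonal, with
irreducible blocks. For fixed irreducible representations `σ` of `H` and `θ` of `K`, the blocks of
type `(σ, θ)` of all the matrices `ρ(n)` are vectors of length `dim σ * dim θ`, and all of them
are multiplied by the same square matrix, `∑ β(h, k) σ(h) ⊗ θ(k)ᵀ`. The entries of these square
matrices are the Fourier transform of `β` over `H × K`, obtained by transforming in one variable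
after the other. The application of each of them to its vectors is a multiplication by a wide
rectangular matrix. The vectors have `∑ (dim ρ) ^ 2 = |G|` entries in all, and the square matrices
have `∑ (dim σ * dim θ) ^ 2 = |H| |K|` entries, so that the cost is `O(|G| ^ (τ / 2))` for
each `τ > ω`.

The hypotheses on `H` and `K` are met by `U` and `B`:

* Both are solvable, and the Fourier transform of a solvable group takes `O(|G| ^ (ω / 2 + ε))`
  operations (`Arith.exists_hasCircuit_dft_of_isSolvable'`). The proof is a recursion along a normal
  subgroup `N` of prime index `p` (`Arith.hasCircuit_dft_of_prime_index`): the irreducible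
  representations of `G` either come in classes of `p` different twists by the characters of
  `G / N`, for which the last step is a cyclic Fourier transform of length `p`, or they are equivalent
  to their twists. The eigenspaces of an intertwining operator between such a representation and
  its twist are permuted cyclically by `G` and stable under `N`, so that the representation
  consists of blocks of size `dim ρ / p`. The cyclic transforms are done by Bluestein's method
  (`Arith.exists_hasCircuit_powerDFT`).
* `|U| |B| ≤ |G|` (`SplitBNPair.card_U_mul_card_B_le`): for the longest element `n` of the Weyl
  group `B ∩ n B n⁻¹` is the intersection of all the conjugates of `B` by elements of `N`, which
  is `T`. As `U ∩ T = 1`, the map `(u, b) ↦ u n b` is injective. The longest element is found as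
  one for which the double coset `B n B` is as large as possible, and the exchange property, in
  the form `BNPair.IsDescent.exists_exchange`, shows that every reduced word can be continued to
  one for `n`.

The sizes of the intermediate matrices matter only through `∑ (dim ρ) ^ τ ≤ |G| ^ (τ / 2)`, which
needs `τ ≥ 2`. That `ω ≥ 2` (`Arith.two_le_matMulExponent`) follows by counting: a
circuit that depends on all of its inputs has to read them.
-/

/-! ### Circuits and their costs -/

namespace Arith

universe uI uJ uO uP

/-- The function `F` is computed by a circuit with at most `n` operations. The bound is a real
number, so that bounds such as `C * d ^ τ` can be used directly. -/
def HasCircuit {I : Type*} {O : Type*} (F : (I → ℂ) → O → ℂ) (n : ℝ) : Prop :=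
  ∃ Γ : Circuit ℂ I O, Γ.Computes F ∧ (Γ.size : ℝ) ≤ n

variable {I : Type uI} {J : Type uJ} {O : Type uO} {P : Type uP}

theorem HasCircuit.mono {F : (I → ℂ) → O → ℂ} {m n : ℝ} (h : HasCircuit F m) (hmn : m ≤ n) :
    HasCircuit F n := by
  obtain ⟨Γ, h₁, h₂⟩ := h
  exact ⟨Γ, h₁, h₂.trans hmn⟩

theorem HasCircuit.congr {F F' : (I → ℂ) → O → ℂ} {m : ℝ} (h : HasCircuit F m)
    (hF : ∀ x o, F x o = F' x o) : HasCircuit F' m := by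
  have : F = F' := by funext x o; exact hF x o
  exact this ▸ h

/-- Selecting inputs and constants is free. -/
theorem hasCircuit_wire (F : (I → ℂ) → O → ℂ)
    (h : ∀ o, (∃ i, ∀ x, F x o = x i) ∨ (∃ c, ∀ x, F x o = c)) : HasCircuit F 0 := by
  classical
  have h' : ∀ o, ∃ a : Arg ℂ I, ∀ x, a.val x [] = F x o := by
    intro o
    rcases h o with ⟨i, hi⟩ | ⟨c, hc⟩
    · exact ⟨.input i, fun x => (hi x).symm⟩
    · exact ⟨.const c, fun x => (hc x).symm⟩
  choose a ha using h'
  refine ⟨⟨[], a⟩, ?_, ?_⟩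
  · intro x
    funext o
    exact ha o x
  · simp [Circuit.size]

theorem hasCircuit_reindex (f : O → I) : HasCircuit (fun (x : I → ℂ) o => x (f o)) 0 :=
  hasCircuit_wire _ fun o => Or.inl ⟨f o, fun _ => rfl⟩

theorem hasCircuit_const (c : O → ℂ) : HasCircuit (fun (_ : I → ℂ) o => c o) 0 :=
  hasCircuit_wire _ fun o => Or.inr ⟨c o, fun _ => rfl⟩

/-- The substitution of an operand of a circuit with `t` gates preceding it, whose results the
inputs `J` are taken from. An output that refers to a gate that is never performed is replaced by
the constant `0` which it reads. -/
def Arg.subst (t : ℕ) (f : J → Arg ℂ I) : Arg ℂ J → Arg ℂ I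
  | .input j => match f j with
    | .input i => .input i
    | .const a => .const a
    | .gate m => if m < t then .gate m else .const 0
  | .const a => .const a
  | .gate m => .gate (t + m)

theorem Arg.val_subst (x : I → ℂ) (v w : List ℂ) (f : J → Arg ℂ I) (a : Arg ℂ J) :
    (a.subst v.length f).val x (v ++ w) = a.val (fun j => (f j).val x v) w := by
  cases a with
  | input j =>
    simp only [Arg.subst, Arg.val]
    cases hf : f j with
    | input i => simp
    | const a => simp
    | gate m =>
      by_cases hm : m < v.length
      · simp [hm, List.getD_eq_getElem?_getD, List.getElem?_append_left hm]
      · simp [hm, List.getD_eq_getElem?_getD]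
  | const a => rfl
  | gate m =>
    simp [Arg.subst, Arg.val, List.getD_eq_getElem?_getD, List.getElem?_append_right]

/-- The gates of a circuit performed after the `t` gates of another one. -/
def Gate.subst (t : ℕ) (f : J → Arg ℂ I) (γ : Gate ℂ J) : Gate ℂ I :=
  ⟨γ.op, γ.left.subst t f, γ.right.subst t f⟩

theorem foldl_subst (x : I → ℂ) (v : List ℂ) (f : J → Arg ℂ I) (l : List (Gate ℂ J))
    (w : List ℂ) :
    (l.map (Gate.subst v.length f)).foldl (fun v γ => v ++ [γ.val x v]) (v ++ w) =
      v ++ l.foldl (fun w γ => w ++ [γ.val (fun j => (f j).val x v) w]) w := by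
  induction l generalizing w with
  | nil => rfl
  | cons γ l ih =>
    have hγ : (γ.subst v.length f).val x (v ++ w) = γ.val (fun j => (f j).val x v) w := by
      simp only [Gate.val, Gate.subst, Arg.val_subst]
    simp only [List.map_cons, List.foldl_cons, hγ]
    rw [List.append_assoc, ih]

theorem length_results (Γ : Circuit ℂ I O) (x : I → ℂ) : (Γ.results x).length = Γ.size := by
  have : ∀ (l : List (Gate ℂ I)) (w : List ℂ),
      (l.foldl (fun v γ => v ++ [γ.val x v]) w).length = w.length + l.length := by
    intro l
    induction l with
    | nil => intro w; simp
    | cons γ l ih =>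
      intro w
      rw [List.foldl_cons, ih]
      simp only [List.length_append, List.length_cons, List.length_nil]
      omega
  simpa [Circuit.results, Circuit.size] using this Γ.gates []

theorem results_append_subst (Γ : Circuit ℂ I J) (Δ : Circuit ℂ J O) (x : I → ℂ)
    (o : P → Arg ℂ I) :
    (⟨Γ.gates ++ Δ.gates.map (Gate.subst Γ.size Γ.output), o⟩ : Circuit ℂ I P).results x =
      Γ.results x ++ Δ.results (Γ.eval x) := by
  have h := foldl_subst x (Γ.results x) Γ.output Δ.gates []
  rw [length_results, List.append_nil] at h
  simp only [Circuit.results, List.foldl_append]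
  exact h

theorem HasCircuit.comp {F : (I → ℂ) → J → ℂ} {G : (J → ℂ) → O → ℂ} {m n : ℝ}
    (hG : HasCircuit G n) (hF : HasCircuit F m) :
    HasCircuit (fun x => G (F x)) (m + n) := by
  obtain ⟨Γ, hΓ, hm⟩ := hF
  obtain ⟨Δ, hΔ, hn⟩ := hG
  refine ⟨⟨Γ.gates ++ Δ.gates.map (Gate.subst Γ.size Γ.output),
    fun o => (Δ.output o).subst Γ.size Γ.output⟩, ?_, ?_⟩
  · intro x
    funext o
    rw [Circuit.eval, results_append_subst]
    have := Arg.val_subst x (Γ.results x) (Δ.results (Γ.eval x)) Γ.output (Δ.output o)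
    rw [length_results] at this
    rw [this]
    change _ = G (F x) o
    rw [← hΓ x, ← hΔ (Γ.eval x)]
    rfl
  · simp only [Circuit.size, List.length_append, List.length_map, Nat.cast_add] at *
    linarith

/-- The inputs of a circuit can be kept along with its outputs. -/
theorem HasCircuit.keep {F : (I → ℂ) → J → ℂ} {m : ℝ} (hF : HasCircuit F m) :
    HasCircuit (fun x => Sum.elim x (F x) : (I → ℂ) → I ⊕ J → ℂ) m := by
  obtain ⟨Γ, hΓ, hm⟩ := hF
  refine ⟨⟨Γ.gates, Sum.elim .input Γ.output⟩, ?_, hm⟩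
  intro x
  change _ = Sum.elim x (F x)
  rw [← hΓ x]
  funext o
  cases o <;> rfl

/-- Two circuits on the same inputs. -/
theorem HasCircuit.pair {F : (I → ℂ) → O → ℂ} {G : (I → ℂ) → P → ℂ} {m n : ℝ}
    (hF : HasCircuit F m) (hG : HasCircuit G n) :
    HasCircuit (fun x => Sum.elim (F x) (G x) : (I → ℂ) → O ⊕ P → ℂ) (m + n) := by
  have h₁ : HasCircuit (fun y : I ⊕ O → ℂ => G fun i => y (.inl i)) n :=
    ((hG.comp (hasCircuit_reindex (Sum.inl : I → I ⊕ O)))).mono (by simp)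
  have h₂ := h₁.keep.comp hF.keep
  have h₃ := (hasCircuit_reindex
    (Sum.elim (fun o => .inl (.inr o)) .inr : O ⊕ P → (I ⊕ O) ⊕ P)).comp h₂
  refine (h₃.congr ?_).mono (by simp)
  intro x o
  cases o <;> rfl

theorem HasCircuit.reindex {F : (I → ℂ) → O → ℂ} {m : ℝ} (hF : HasCircuit F m) (f : P → O) :
    HasCircuit (fun x p => F x (f p)) m :=
  ((hasCircuit_reindex f).comp hF).mono (by simp)

theorem HasCircuit.precomp {F : (I → ℂ) → O → ℂ} {m : ℝ} (hF : HasCircuit F m) (f : I → J) :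
    HasCircuit (fun x => F fun i => x (f i)) m :=
  (hF.comp (hasCircuit_reindex f)).mono (by simp)

theorem hasCircuit_of_isEmpty [IsEmpty O] (F : (I → ℂ) → O → ℂ) : HasCircuit F 0 :=
  hasCircuit_wire _ fun o => isEmptyElim o

/-- Finitely many circuits on the same inputs. -/
theorem hasCircuit_sigma {ι : Type*} {O : ι → Type*} [Fintype ι]
    {F : ∀ i, (I → ℂ) → O i → ℂ} {n : ι → ℝ} (h : ∀ i, HasCircuit (F i) (n i)) :
    HasCircuit (fun x (o : Σ i, O i) => F o.1 x o.2) (∑ i, n i) := by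
  classical
  have key : ∀ s : Finset ι,
      HasCircuit (fun x (o : Σ i : s, O i.1) => F o.1.1 x o.2) (∑ i ∈ s, n i) := by
    intro s
    induction s using Finset.induction_on with
    | empty => exact (hasCircuit_of_isEmpty _).mono (by simp)
    | insert a s ha ih =>
      rw [Finset.sum_insert ha]
      have h₁ := (h a).pair ih
      have h₂ := h₁.reindex (fun o : Σ i : (insert a s : Finset ι), O i.1 =>
        if hi : o.1.1 = a then Sum.inl (hi ▸ o.2)
        else Sum.inr ⟨⟨o.1.1, (Finset.mem_insert.1 o.1.2).resolve_left hi⟩, o.2⟩)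
      refine h₂.congr ?_
      rintro x ⟨⟨i, hi⟩, o⟩
      by_cases hia : i = a
      · subst hia
        simp
      · simp [hia]
  exact (key Finset.univ).reindex fun o : Σ i, O i =>
    (⟨⟨o.1, Finset.mem_univ _⟩, o.2⟩ : Σ i : (Finset.univ : Finset ι), O i.1)

/-- A circuit put together from circuits for the outputs of each index. -/
theorem hasCircuit_of_fibers {ι : Type*} {O' : ι → Type*} [Fintype ι]
    {F : (I → ℂ) → O → ℂ} {F' : ∀ i, (I → ℂ) → O' i → ℂ} {n : ι → ℝ}
    (h : ∀ i, HasCircuit (F' i) (n i)) (k : O → ι) (e : ∀ o, O' (k o))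
    (hF : ∀ x o, F x o = F' (k o) x (e o)) : HasCircuit F (∑ i, n i) :=
  ((hasCircuit_sigma h).reindex fun o => ⟨k o, e o⟩).congr fun x o => (hF x o).symm

theorem hasCircuit_op (op : Op) :
    HasCircuit (fun (x : Unit ⊕ Unit → ℂ) (_ : Unit) =>
      op.apply (x (.inl ())) (x (.inr ()))) 1 := by
  refine ⟨⟨[⟨op, .input (.inl ()), .input (.inr ())⟩], fun _ => .gate 0⟩, ?_, ?_⟩
  · intro x
    funext o
    rfl
  · simp [Circuit.size]

theorem HasCircuit.binop [Fintype O] (op : Op) {F G : (I → ℂ) → O → ℂ} {m n : ℝ}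
    (hF : HasCircuit F m) (hG : HasCircuit G n) :
    HasCircuit (fun x o => op.apply (F x o) (G x o)) (m + n + Fintype.card O) := by
  have h₁ : ∀ o : O, HasCircuit
      (fun (x : O ⊕ O → ℂ) (_ : Unit) => op.apply (x (.inl o)) (x (.inr o))) 1 := fun o =>
    (hasCircuit_op op).precomp (Sum.map (fun _ => o) (fun _ => o))
  have h₂ := (hasCircuit_sigma h₁).reindex fun o : O => (⟨o, ()⟩ : Σ _ : O, Unit)
  refine ((h₂.comp (hF.pair hG)).congr ?_).mono (by simp)
  intro x o
  rfl

theorem HasCircuit.add [Fintype O] {F G : (I → ℂ) → O → ℂ} {m n : ℝ}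
    (hF : HasCircuit F m) (hG : HasCircuit G n) :
    HasCircuit (fun x o => F x o + G x o) (m + n + Fintype.card O) :=
  hF.binop .add hG

theorem HasCircuit.mul [Fintype O] {F G : (I → ℂ) → O → ℂ} {m n : ℝ}
    (hF : HasCircuit F m) (hG : HasCircuit G n) :
    HasCircuit (fun x o => F x o * G x o) (m + n + Fintype.card O) :=
  hF.binop .mul hG

theorem HasCircuit.const_mul [Fintype O] {F : (I → ℂ) → O → ℂ} {m : ℝ}
    (hF : HasCircuit F m) (c : O → ℂ) :
    HasCircuit (fun x o => c o * F x o) (m + Fintype.card O) :=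
  ((hasCircuit_const c).mul hF).mono (by simp)

theorem hasCircuit_sum {ι : Type*} [Fintype ι] [Fintype O] {F : ι → (I → ℂ) → O → ℂ} {n : ι → ℝ}
    (h : ∀ i, HasCircuit (F i) (n i)) :
    HasCircuit (fun x o => ∑ i, F i x o) (∑ i, n i + Fintype.card ι * Fintype.card O) := by
  classical
  have key : ∀ s : Finset ι,
      HasCircuit (fun x o => ∑ i ∈ s, F i x o) (∑ i ∈ s, n i + s.card * Fintype.card O) := by
    intro s
    induction s using Finset.induction_on with
    | empty =>
      simp only [Finset.sum_empty, Finset.card_empty, Nat.cast_zero, zero_mul, add_zero]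
      exact hasCircuit_const _
    | insert a s ha ih =>
      simp only [Finset.sum_insert ha, Finset.card_insert_of_notMem ha]
      refine ((h a).add ih).mono (le_of_eq ?_)
      push_cast
      ring
  simpa using key Finset.univ

/-- Every linear map can be computed entry by entry. -/
theorem hasCircuit_linear [Fintype I] [Fintype O] (A : O → I → ℂ) :
    HasCircuit (fun (x : I → ℂ) o => ∑ i, A o i * x i)
      (2 * (Fintype.card I * Fintype.card O)) := by
  have h : ∀ i : I, HasCircuit (fun (x : I → ℂ) (o : O) => A o i * x i) (Fintype.card O) :=
    fun i => ((hasCircuit_reindex (fun _ : O => i)).const_mul fun o => A o i).mono (by simp)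
  refine (hasCircuit_sum h).mono (le_of_eq ?_)
  simp
  ring

end Arith

/-! ### Matrix multiplication -/

namespace Arith

/-- `n × n` matrices can be multiplied with at most `C * n ^ τ` operations. -/
structure MulBound (C τ : ℝ) : Prop where
  nonneg : 0 ≤ C
  hasCircuit : ∀ n : ℕ, HasCircuit (matMul n) (C * (n : ℝ) ^ τ)

/-- The inputs an operand refers to. -/
def Arg.refs {I : Type*} : Arg ℂ I → Set I
  | .input i => {i}
  | .const _ => ∅
  | .gate _ => ∅

theorem Arg.val_congr {I : Type*} {x y : I → ℂ} (v : List ℂ) (a : Arg ℂ I)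
    (h : ∀ i ∈ a.refs, x i = y i) : a.val x v = a.val y v := by
  cases a with
  | input i => exact h i rfl
  | const a => rfl
  | gate m => rfl

theorem Arg.ncard_refs_le {I : Type*} (a : Arg ℂ I) : a.refs.ncard ≤ 1 := by
  cases a <;> simp [Arg.refs]

theorem Arg.finite_refs {I : Type*} (a : Arg ℂ I) : a.refs.Finite := by
  cases a <;> simp [Arg.refs]

theorem foldl_val_congr {I : Type*} {x y : I → ℂ} (l : List (Gate ℂ I))
    (h : ∀ γ ∈ l, ∀ i ∈ γ.left.refs ∪ γ.right.refs, x i = y i) (w : List ℂ) :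
    l.foldl (fun v γ => v ++ [γ.val x v]) w = l.foldl (fun v γ => v ++ [γ.val y v]) w := by
  induction l generalizing w with
  | nil => rfl
  | cons γ l ih =>
    have hγ : γ.val x w = γ.val y w := by
      have := h γ List.mem_cons_self
      simp only [Gate.val]
      rw [Arg.val_congr w γ.left fun i hi => this i (Or.inl hi),
        Arg.val_congr w γ.right fun i hi => this i (Or.inr hi)]
    rw [List.foldl_cons, List.foldl_cons, hγ]
    exact ih (fun γ' hγ' => h γ' (List.mem_cons_of_mem _ hγ')) _

/-- The inputs the gates of a list refer to. -/
def gateRefs {I : Type*} (l : List (Gate ℂ I)) : Set I :=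
  {i | ∃ γ ∈ l, i ∈ γ.left.refs ∪ γ.right.refs}

theorem gateRefs_cons {I : Type*} (γ : Gate ℂ I) (l : List (Gate ℂ I)) :
    gateRefs (γ :: l) = (γ.left.refs ∪ γ.right.refs) ∪ gateRefs l := by
  ext i
  simp [gateRefs]

theorem ncard_gateRefs_le {I : Type*} (l : List (Gate ℂ I)) :
    (gateRefs l).Finite ∧ (gateRefs l).ncard ≤ 2 * l.length := by
  induction l with
  | nil => simp [gateRefs]
  | cons γ l ih =>
    rw [gateRefs_cons]
    refine ⟨(γ.left.finite_refs.union γ.right.finite_refs).union ih.1, ?_⟩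
    have h₁ := Set.ncard_union_le (γ.left.refs ∪ γ.right.refs) (gateRefs l)
    have h₂ := Set.ncard_union_le γ.left.refs γ.right.refs
    have h₃ := γ.left.ncard_refs_le
    have h₄ := γ.right.ncard_refs_le
    simp only [List.length_cons]
    omega

/-- A circuit that depends on all of its inputs has at least half as many gates as it has inputs
in excess of outputs. -/
theorem card_le_of_computes {I O : Type*} [Fintype I] [Fintype O] (Γ : Circuit ℂ I O)
    {F : (I → ℂ) → O → ℂ} (hΓ : Γ.Computes F)
    (hF : ∀ i, ∃ x y : I → ℂ, (∀ j, j ≠ i → x j = y j) ∧ F x ≠ F y) :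
    Fintype.card I ≤ 2 * Γ.size + Fintype.card O := by
  classical
  have hall : ∀ i, i ∈ gateRefs Γ.gates ∪ ⋃ o, (Γ.output o).refs := by
    intro i
    by_contra hi
    obtain ⟨x, y, hxy, hne⟩ := hF i
    apply hne
    rw [← hΓ x, ← hΓ y]
    have hr : Γ.results x = Γ.results y := by
      refine foldl_val_congr _ (fun γ hγ j hj => hxy j ?_) _
      rintro rfl
      exact hi (Or.inl ⟨γ, hγ, hj⟩)
    funext o
    rw [Circuit.eval, Circuit.eval, hr]
    refine Arg.val_congr _ _ fun j hj => hxy j ?_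
    rintro rfl
    exact hi (Or.inr (Set.mem_iUnion.2 ⟨o, hj⟩))
  have h₁ : (Set.univ : Set I).ncard ≤
      (gateRefs Γ.gates).ncard + (⋃ o, (Γ.output o).refs).ncard :=
    (Set.ncard_le_ncard (fun i _ => hall i) (Set.toFinite _)).trans (Set.ncard_union_le _ _)
  have h₂ : (⋃ o, (Γ.output o).refs).ncard ≤ ∑ _o : O, 1 :=
    (Set.ncard_iUnion_le_of_fintype _).trans
      (Finset.sum_le_sum fun o _ => (Γ.output o).ncard_refs_le)
  have h₃ := (ncard_gateRefs_le Γ.gates).2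
  rw [Set.ncard_univ, Nat.card_eq_fintype_card] at h₁
  simp only [Finset.sum_const, Finset.card_univ, smul_eq_mul, mul_one] at h₂
  simp only [Circuit.size]
  omega

theorem matMul_apply (n : ℕ) (x : (Fin n × Fin n) ⊕ (Fin n × Fin n) → ℂ) (o : Fin n × Fin n) :
    matMul n x o = ∑ k, x (.inl (o.1, k)) * x (.inr (k, o.2)) := by
  simp [matMul, Matrix.mul_apply]

theorem sq_le_of_computes_matMul {n : ℕ}
    (Γ : Circuit ℂ ((Fin n × Fin n) ⊕ (Fin n × Fin n)) (Fin n × Fin n))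
    (hΓ : Γ.Computes (matMul n)) : n ^ 2 ≤ 2 * Γ.size := by
  have := card_le_of_computes Γ hΓ ?_
  · simp only [Fintype.card_sum, Fintype.card_prod, Fintype.card_fin] at this
    nlinarith
  rintro (⟨i, j⟩ | ⟨i, j⟩)
  · refine ⟨Sum.elim (fun _ => 0) (fun _ => 1), Sum.elim (Pi.single (i, j) 1) (fun _ => 1), ?_, ?_⟩
    · rintro (p | p) hp
      · have : p ≠ (i, j) := fun h => hp (by rw [h])
        simp [this]
      · simp
    · intro h
      have := congrFun h (i, j)
      simp [matMul_apply, Pi.single_apply] at this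
  · refine ⟨Sum.elim (fun _ => 1) (fun _ => 0), Sum.elim (fun _ => 1) (Pi.single (i, j) 1), ?_, ?_⟩
    · rintro (p | p) hp
      · simp
      · have : p ≠ (i, j) := fun h => hp (by rw [h])
        simp [this]
    · intro h
      have := congrFun h (i, j)
      simp [matMul_apply, Pi.single_apply] at this

theorem hasCircuit_matMul_cubic (n : ℕ) : HasCircuit (matMul n) (2 * (n : ℝ) ^ (3 : ℝ)) := by
  have h : ∀ k : Fin n, HasCircuit (fun (x : (Fin n × Fin n) ⊕ (Fin n × Fin n) → ℂ)
      (o : Fin n × Fin n) => x (.inl (o.1, k)) * x (.inr (k, o.2)))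
      (0 + 0 + Fintype.card (Fin n × Fin n)) := fun k =>
    (hasCircuit_reindex (fun o : Fin n × Fin n => Sum.inl (o.1, k))).mul
      (hasCircuit_reindex (fun o : Fin n × Fin n => Sum.inr (k, o.2)))
  refine ((hasCircuit_sum h).congr fun x o => (matMul_apply n x o).symm).mono (le_of_eq ?_)
  simp
  norm_cast
  ring

theorem two_le_of_forall_computes {C τ : ℝ} (h : ∀ n : ℕ,
    ∃ Γ : Circuit ℂ ((Fin n × Fin n) ⊕ (Fin n × Fin n)) (Fin n × Fin n),
      Γ.Computes (matMul n) ∧ (Γ.size : ℝ) ≤ C * (n : ℝ) ^ τ) : 2 ≤ τ := by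
  by_contra! hτ
  have hlim := (tendsto_rpow_atTop (show 0 < 2 - τ by linarith)).comp
    (tendsto_natCast_atTop_atTop (R := ℝ))
  obtain ⟨n, hn, hn'⟩ := ((hlim.eventually_gt_atTop (2 * C)).and
    (Filter.eventually_ge_atTop 1)).exists
  obtain ⟨Γ, hΓ, hs⟩ := h n
  have h₁ : (n : ℝ) ^ 2 ≤ 2 * Γ.size := by exact_mod_cast sq_le_of_computes_matMul Γ hΓ
  have hpos : (0 : ℝ) < n := by exact_mod_cast hn'
  have h₂ : (n : ℝ) ^ (2 - τ) * (n : ℝ) ^ τ = (n : ℝ) ^ 2 := by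
    rw [← Real.rpow_add hpos]
    norm_num
  have h₃ : 0 < (n : ℝ) ^ τ := Real.rpow_pos_of_pos hpos _
  simp only [Function.comp_apply] at hn
  nlinarith

theorem nonempty_exponents : {τ : ℝ | ∃ C : ℝ, ∀ n : ℕ,
    ∃ Γ : Circuit ℂ ((Fin n × Fin n) ⊕ (Fin n × Fin n)) (Fin n × Fin n),
      Γ.Computes (matMul n) ∧ (Γ.size : ℝ) ≤ C * (n : ℝ) ^ τ}.Nonempty :=
  ⟨3, 2, hasCircuit_matMul_cubic⟩

/-- Already reading the `2 n ^ 2` inputs takes of the order of `n ^ 2` operations. -/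
theorem two_le_matMulExponent : 2 ≤ matMulExponent :=
  le_csInf nonempty_exponents fun _ ⟨_, h⟩ => two_le_of_forall_computes h

theorem exists_mulBound {τ : ℝ} (hτ : matMulExponent < τ) : ∃ C, MulBound C τ := by
  obtain ⟨σ, ⟨C, hC⟩, hσ⟩ := exists_lt_of_csInf_lt nonempty_exponents hτ
  refine ⟨max C 0, le_max_right _ _, fun n => ?_⟩
  rcases Nat.eq_zero_or_pos n with rfl | hn
  · exact (hasCircuit_of_isEmpty _).mono
      (mul_nonneg (le_max_right _ _) (Real.rpow_nonneg (Nat.cast_nonneg _) _))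
  · refine HasCircuit.mono (hC n) ?_
    have h1 : (1 : ℝ) ≤ n := by exact_mod_cast hn
    calc C * (n : ℝ) ^ σ ≤ max C 0 * (n : ℝ) ^ σ :=
          mul_le_mul_of_nonneg_right (le_max_left _ _) (Real.rpow_nonneg (by linarith) _)
      _ ≤ _ := mul_le_mul_of_nonneg_left (Real.rpow_le_rpow_of_exponent_le h1 hσ.le)
          (le_max_right _ _)

universe u₁ u₂ u₃

variable {I : Type*} {n₁ : Type u₁} {n₂ : Type u₂} {n₃ : Type u₃} {C τ : ℝ}

/-- A matrix that depends on the inputs is computed with at most `a` operations. -/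
def HasMatCircuit {I : Type*} {m : Type*} {n : Type*} (A : (I → ℂ) → Matrix m n ℂ) (a : ℝ) :
    Prop :=
  HasCircuit (fun x (o : m × n) => A x o.1 o.2) a

theorem hasMatCircuit_const (A : Matrix n₁ n₂ ℂ) : HasMatCircuit (fun _ : I → ℂ => A) 0 :=
  hasCircuit_const _

theorem HasMatCircuit.mono {A : (I → ℂ) → Matrix n₁ n₂ ℂ} {a b : ℝ} (h : HasMatCircuit A a)
    (hab : a ≤ b) : HasMatCircuit A b :=
  HasCircuit.mono h hab

/-- Padding a matrix by zeros. -/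
theorem extend_prodMap_mul [Fintype n₂] {m : ℕ} (e₁ : n₁ ↪ Fin m) (e₂ : n₂ ↪ Fin m)
    (e₃ : n₃ ↪ Fin m)
    (A : Matrix n₁ n₂ ℂ) (B : Matrix n₂ n₃ ℂ) (i : n₁) (j : n₃) :
    ∑ k, Function.extend (Prod.map e₁ e₂) (fun o => A o.1 o.2) 0 (e₁ i, k) *
      Function.extend (Prod.map e₂ e₃) (fun o => B o.1 o.2) 0 (k, e₃ j) = (A * B) i j := by
  rw [Matrix.mul_apply]
  refine (Fintype.sum_of_injective e₂ e₂.injective _ _ ?_ ?_).symm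
  · intro k hk
    rw [Function.extend_apply', Pi.zero_apply, zero_mul]
    rintro ⟨⟨a, b⟩, hab⟩
    exact hk ⟨b, (Prod.ext_iff.1 hab).2⟩
  · intro k
    have h₁ := (e₁.injective.prodMap e₂.injective).extend_apply (fun o => A o.1 o.2) 0 (i, k)
    have h₂ := (e₂.injective.prodMap e₃.injective).extend_apply (fun o => B o.1 o.2) 0 (k, j)
    simp only [Prod.map_apply] at h₁ h₂
    rw [h₁, h₂]

theorem HasMatCircuit.extend {m : ℕ} (e₁ : n₁ ↪ Fin m) (e₂ : n₂ ↪ Fin m)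
    {A : (I → ℂ) → Matrix n₁ n₂ ℂ} {a : ℝ} (h : HasMatCircuit A a) :
    HasCircuit (fun x => Function.extend (Prod.map e₁ e₂) (fun o => A x o.1 o.2) 0) a := by
  classical
  have hw : HasCircuit (fun y : n₁ × n₂ → ℂ => Function.extend (Prod.map e₁ e₂) y 0) 0 := by
    refine hasCircuit_wire _ fun o => ?_
    by_cases ho : ∃ p, Prod.map e₁ e₂ p = o
    · obtain ⟨p, rfl⟩ := ho
      exact Or.inl ⟨p, fun y => (e₁.injective.prodMap e₂.injective).extend_apply y 0 p⟩
    · exact Or.inr ⟨0, fun y => by rw [Function.extend_apply' _ _ _ ho, Pi.zero_apply]⟩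
  exact (hw.comp h).mono (by simp)

theorem HasMatCircuit.mul [Fintype n₁] [Fintype n₂] [Fintype n₃] (hM : MulBound C τ)
    {A : (I → ℂ) → Matrix n₁ n₂ ℂ}
    {B : (I → ℂ) → Matrix n₂ n₃ ℂ} {a b : ℝ} (hA : HasMatCircuit A a) (hB : HasMatCircuit B b)
    (m : ℕ) (h₁ : Fintype.card n₁ ≤ m) (h₂ : Fintype.card n₂ ≤ m) (h₃ : Fintype.card n₃ ≤ m) :
    HasMatCircuit (fun x => A x * B x) (a + b + C * (m : ℝ) ^ τ) := by
  obtain ⟨e₁⟩ := Function.Embedding.nonempty_of_card_le (h₁.trans_eq (Fintype.card_fin m).symm)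
  obtain ⟨e₂⟩ := Function.Embedding.nonempty_of_card_le (h₂.trans_eq (Fintype.card_fin m).symm)
  obtain ⟨e₃⟩ := Function.Embedding.nonempty_of_card_le (h₃.trans_eq (Fintype.card_fin m).symm)
  have h := ((hM.hasCircuit m).comp ((hA.extend e₁ e₂).pair (hB.extend e₂ e₃))).reindex
    (Prod.map e₁ e₃)
  refine h.congr fun x o => ?_
  exact (matMul_apply _ _ _).trans (extend_prodMap_mul e₁ e₂ e₃ (A x) (B x) o.1 o.2)

/-- Multiplication by constant matrices on both sides. -/
theorem HasMatCircuit.const_mul_mul_const [Fintype n₁] [Fintype n₂] [Fintype n₃]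
    (hM : MulBound C τ) {A : (I → ℂ) → Matrix n₁ n₁ ℂ} {a : ℝ} (hA : HasMatCircuit A a)
    (P : Matrix n₂ n₁ ℂ) (Q : Matrix n₁ n₃ ℂ)
    (m : ℕ) (h₁ : Fintype.card n₁ ≤ m) (h₂ : Fintype.card n₂ ≤ m) (h₃ : Fintype.card n₃ ≤ m) :
    HasMatCircuit (fun x => P * A x * Q) (a + 2 * C * (m : ℝ) ^ τ) := by
  refine (((hasMatCircuit_const P).mul hM hA m h₂ h₁ h₁).mul hM (hasMatCircuit_const Q) m
    h₂ h₁ h₃).mono (le_of_eq ?_)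
  ring

/-- The product of a `D × D` matrix and a wide constant matrix with `N` columns, as `N / D + 1`
square products. -/
theorem HasMatCircuit.mul_wide [Fintype n₁] [Fintype n₂] (hM : MulBound C τ) [Nonempty n₁]
    {A : (I → ℂ) → Matrix n₁ n₁ ℂ} {a : ℝ} (hA : HasMatCircuit A a) (B : Matrix n₁ n₂ ℂ) :
    HasMatCircuit (fun x => A x * B)
      (a + ((Fintype.card n₂ : ℝ) / Fintype.card n₁ + 1) * (C * (Fintype.card n₁ : ℝ) ^ τ)) := by
  classical
  set D := Fintype.card n₁ with hD
  set N := Fintype.card n₂ with hN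
  have hDpos : 0 < D := Fintype.card_pos
  -- the columns in chunks of size `D`
  let e : n₂ ≃ Fin N := Fintype.equivFin n₂
  have hchunk : ∀ i : Fin (N / D + 1), Fintype.card {j : n₂ // (e j : ℕ) / D = i} ≤ D := by
    intro i
    have : Function.Injective (fun j : {j : n₂ // (e j : ℕ) / D = i} =>
        (⟨(e j.1 : ℕ) % D, Nat.mod_lt _ hDpos⟩ : Fin D)) := by
      intro j j' h
      simp only [Fin.mk.injEq] at h
      apply Subtype.ext
      apply e.injective
      apply Fin.ext
      rw [← Nat.div_add_mod (e j.1) D, ← Nat.div_add_mod (e j'.1) D, j.2, j'.2, h]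
    simpa using Fintype.card_le_of_injective _ this
  have hpiece : ∀ i : Fin (N / D + 1), HasMatCircuit
      (fun y : n₁ × n₁ → ℂ => (Matrix.of fun p q => y (p, q)) *
        (B.submatrix id (fun j : {j : n₂ // (e j : ℕ) / D = i} => j.1)))
      (C * (D : ℝ) ^ τ) := by
    intro i
    refine (HasMatCircuit.mul hM (a := 0) ?_ (hasMatCircuit_const _) D le_rfl le_rfl
      (hchunk i)).mono (by simp)
    exact hasCircuit_reindex fun o : n₁ × n₁ => (o.1, o.2)
  have hall : HasCircuit (fun (y : n₁ × n₁ → ℂ) (o : n₁ × n₂) =>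
      ((Matrix.of fun p q => y (p, q)) * B) o.1 o.2)
      (∑ _i : Fin (N / D + 1), C * (D : ℝ) ^ τ) := by
    refine hasCircuit_of_fibers hpiece
      (fun o => ⟨(e o.2 : ℕ) / D, Nat.lt_succ_of_le (Nat.div_le_div_right (e o.2).2.le)⟩)
      (fun o => (o.1, ⟨o.2, rfl⟩)) ?_
    intro y o
    simp [Matrix.mul_apply]
  refine ((hall.comp hA).congr fun x o => rfl).mono ?_
  simp only [Finset.sum_const, Finset.card_univ, Fintype.card_fin, nsmul_eq_mul]
  have h₁ : ((N / D + 1 : ℕ) : ℝ) ≤ (N : ℝ) / D + 1 := by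
    push_cast
    gcongr
    exact Nat.cast_div_le
  have h₂ : 0 ≤ C * (D : ℝ) ^ τ := mul_nonneg hM.nonneg (Real.rpow_nonneg (by positivity) _)
  nlinarith

end Arith

/-! ### Cyclic Fourier transforms -/

namespace Arith

/-- The Fourier transform of length `n` at the powers of `ζ`. -/
noncomputable def powerDFT (n : ℕ) (ζ : ℂ) (x : Fin n → ℂ) (j : Fin n) : ℂ :=
  ∑ k : Fin n, ζ ^ ((j : ℕ) * k) * x k

/-- The halving step of the fast Fourier transform. -/
theorem powerDFT_two_mul {n : ℕ} {ξ : ℂ} (hξ : ξ ^ (n * 2) = 1) (hn : 0 < n)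
    (x : Fin (n * 2) → ℂ) (j : Fin (n * 2)) :
    powerDFT (n * 2) ξ x j =
      powerDFT n (ξ ^ 2) (fun k => x (finProdFinEquiv (k, 0))) ⟨j % n, Nat.mod_lt _ hn⟩ +
      ξ ^ (j : ℕ) *
        powerDFT n (ξ ^ 2) (fun k => x (finProdFinEquiv (k, 1))) ⟨j % n, Nat.mod_lt _ hn⟩ := by
  have hred : ∀ k : ℕ, (ξ ^ 2) ^ ((j : ℕ) * k) = (ξ ^ 2) ^ ((j : ℕ) % n * k) := by
    intro k
    conv_lhs => rw [← Nat.div_add_mod (j : ℕ) n]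
    rw [add_mul, pow_add, mul_assoc n, pow_mul (ξ ^ 2) n, ← pow_mul ξ 2 n, mul_comm 2 n, hξ,
      one_pow, one_mul]
  simp only [powerDFT]
  rw [← finProdFinEquiv.sum_comp, Fintype.sum_prod_type]
  simp only [Fin.sum_univ_two]
  rw [Finset.sum_add_distrib, Finset.mul_sum]
  congr 1
  · refine Finset.sum_congr rfl fun k _ => ?_
    rw [← hred, ← pow_mul]
    simp only [finProdFinEquiv_apply_val]
    congr 2
    simp
    ring
  · refine Finset.sum_congr rfl fun k _ => ?_
    rw [← hred, ← pow_mul, ← mul_assoc, ← pow_add]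
    simp only [finProdFinEquiv_apply_val]
    congr 2
    simp
    ring

theorem hasCircuit_powerDFT_two_pow (K : ℕ) (ξ : ℂ) (hξ : ξ ^ 2 ^ K = 1) :
    HasCircuit (powerDFT (2 ^ K) ξ) (2 * K * 2 ^ K) := by
  induction K generalizing ξ with
  | zero =>
    refine (hasCircuit_reindex id).congr (fun x j => ?_) |>.mono (by simp)
    have hs : Subsingleton (Fin (2 ^ 0)) := Fin.subsingleton_one
    rw [powerDFT, Fintype.sum_subsingleton _ j]
    simp
  | succ K ih =>
    rw [pow_succ] at hξ ⊢
    have hpos : 0 < 2 ^ K := by positivity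
    have ih' := ih (ξ ^ 2) (by rw [← pow_mul, mul_comm, hξ])
    have h : ∀ b : Fin 2, HasCircuit (fun (x : Fin (2 ^ K * 2) → ℂ) (j : Fin (2 ^ K * 2)) =>
        powerDFT (2 ^ K) (ξ ^ 2) (fun k => x (finProdFinEquiv (k, b)))
          ⟨j % 2 ^ K, Nat.mod_lt _ hpos⟩) (2 * K * 2 ^ K) := fun b =>
      (ih'.precomp fun k => finProdFinEquiv (k, b)).reindex
        fun j : Fin (2 ^ K * 2) => ⟨j % 2 ^ K, Nat.mod_lt _ hpos⟩
    refine (((h 0).add ((h 1).const_mul fun j => ξ ^ (j : ℕ))).congr fun x j =>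
      (powerDFT_two_mul hξ hpos x j).symm).mono (le_of_eq ?_)
    simp only [Fintype.card_fin]
    push_cast
    ring

theorem choose_two_add (j k : ℕ) : (j + k).choose 2 = j.choose 2 + k.choose 2 + j * k := by
  induction k with
  | zero => simp
  | succ k ih =>
    rw [← add_assoc, Nat.choose_succ_succ' (j + k) 1, Nat.choose_succ_succ' k 1, ih]
    simp
    ring

/-- Bluestein's method: because of `jk = C(j+k,2) - C(j,2) - C(k,2)` a Fourier transform of
arbitrary length is a multiplication by a Hankel matrix, up to scaling. The Hankel matrix is
diagonalized by Fourier transforms whose length is a power of two. -/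
theorem hasCircuit_powerDFT_chirp (n K : ℕ) (hK : 2 * n ≤ 2 ^ K) {ζ : ℂ} (hζ : ζ ≠ 0) :
    HasCircuit (powerDFT n ζ) (4 * K * 2 ^ K + 2 ^ K + 2 * n) := by
  classical
  obtain ⟨M, hM⟩ : ∃ M, M = 2 ^ K := ⟨_, rfl⟩
  have hMpos : M ≠ 0 := hM ▸ by positivity
  have hnM : n ≤ M := by omega
  obtain ⟨ξ, hξ⟩ : ∃ ξ : ℂ, IsPrimitiveRoot ξ M := ⟨_, Complex.isPrimitiveRoot_exp M hMpos⟩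
  have hF : HasCircuit (powerDFT M ξ) (2 * K * 2 ^ K) := by
    have := hasCircuit_powerDFT_two_pow K ξ (hM ▸ hξ.pow_eq_one)
    rwa [hM]
  -- the coefficients that express the Hankel matrix by Fourier transforms
  obtain ⟨g, hg⟩ : ∃ g : Fin M → ℂ, ∀ m : Fin M,
      ∑ s : Fin M, ξ ^ ((m : ℕ) * s) * g s = ζ ^ (m : ℕ).choose 2 := by
    have hdet : IsUnit (Matrix.vandermonde fun m : Fin M => ξ ^ (m : ℕ)) := by
      rw [Matrix.isUnit_iff_isUnit_det, isUnit_iff_ne_zero, Matrix.det_vandermonde_ne_zero_iff]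
      intro a b hab
      exact Fin.ext (hξ.pow_inj a.2 b.2 hab)
    obtain ⟨g, hg⟩ := Matrix.mulVec_surjective_iff_isUnit.2 hdet
      fun m : Fin M => ζ ^ (m : ℕ).choose 2
    refine ⟨g, fun m => ?_⟩
    rw [← congrFun hg m]
    simp [Matrix.mulVec, dotProduct, Matrix.vandermonde_apply, pow_mul]
  have h₁ : HasCircuit (fun (x : Fin n → ℂ) (k : Fin M) =>
      if h : (k : ℕ) < n then (ζ ^ (k : ℕ).choose 2)⁻¹ * x ⟨k, h⟩ else 0) n := by
    have h := (hasCircuit_reindex (id : Fin n → Fin n)).const_mul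
      (fun k : Fin n => (ζ ^ (k : ℕ).choose 2)⁻¹)
    have hw : HasCircuit (fun (z : Fin n → ℂ) (k : Fin M) =>
        if h : (k : ℕ) < n then z ⟨k, h⟩ else 0) 0 := by
      refine hasCircuit_wire _ fun k => ?_
      by_cases hk : (k : ℕ) < n
      · exact Or.inl ⟨⟨k, hk⟩, fun z => by simp [hk]⟩
      · exact Or.inr ⟨0, fun z => by simp [hk]⟩
    refine ((hw.comp h).congr fun x k => ?_).mono (by simp)
    simp
  have h₂ := (hF.comp ((hF.comp h₁).const_mul g)).reindex (Fin.castLE hnM)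
  have h₃ := h₂.const_mul (fun j : Fin n => (ζ ^ (j : ℕ).choose 2)⁻¹)
  refine (h₃.congr fun x j => ?_).mono (le_of_eq ?_)
  · have hj : ζ ^ (j : ℕ).choose 2 ≠ 0 := pow_ne_zero _ hζ
    rw [inv_mul_eq_iff_eq_mul₀ hj]
    simp only [powerDFT, Fin.val_castLE]
    have hsum : ∀ f : ℕ → ℂ, (∑ k : Fin M, f k *
        (if h : (k : ℕ) < n then (ζ ^ (k : ℕ).choose 2)⁻¹ * x ⟨k, h⟩ else 0)) =
        ∑ k : Fin n, f k * ((ζ ^ (k : ℕ).choose 2)⁻¹ * x k) := by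
      intro f
      refine (Fintype.sum_of_injective (Fin.castLE hnM) (Fin.castLE_injective hnM) _ _ ?_ ?_).symm
      · intro k hk
        have : ¬ (k : ℕ) < n := fun h => hk ⟨⟨k, h⟩, rfl⟩
        simp [this]
      · intro k
        simp
    simp only [fun a : ℕ => hsum fun k => ξ ^ (a * k)]
    simp only [Finset.mul_sum]
    rw [Finset.sum_comm]
    refine Finset.sum_congr rfl fun k _ => ?_
    have hlt : (j : ℕ) + k < M := by omega
    have hk : ζ ^ (k : ℕ).choose 2 ≠ 0 := pow_ne_zero _ hζ
    have key := hg ⟨j + k, hlt⟩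
    simp only [choose_two_add, pow_add] at key
    calc ∑ s : Fin M, ξ ^ ((j : ℕ) * s) * (g s * (ξ ^ ((s : ℕ) * k) *
          ((ζ ^ (k : ℕ).choose 2)⁻¹ * x k)))
        = (∑ s : Fin M, ξ ^ (((j : ℕ) + k) * s) * g s) * ((ζ ^ (k : ℕ).choose 2)⁻¹ * x k) := by
          rw [Finset.sum_mul]
          refine Finset.sum_congr rfl fun s _ => ?_
          rw [add_mul, pow_add, mul_comm (k : ℕ) s]
          ring
      _ = _ := by
          rw [key]
          field_simp
  · simp only [Fintype.card_fin]
    rw [hM]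
    push_cast
    ring

theorem natCast_le_two_pow_rpow (K : ℕ) {δ : ℝ} (hδ : 0 < δ) :
    (K : ℝ) ≤ 2 / δ * ((2 : ℝ) ^ K) ^ δ := by
  have h := Real.log_le_rpow_div (x := (2 : ℝ) ^ K) (by positivity) hδ
  rw [Real.log_pow] at h
  have h2 : (1 / 2 : ℝ) ≤ Real.log 2 := by linarith [Real.log_two_gt_d9]
  have hK : (0 : ℝ) ≤ K := Nat.cast_nonneg K
  have : (K : ℝ) * (1 / 2) ≤ ((2 : ℝ) ^ K) ^ δ / δ := (mul_le_mul_of_nonneg_left h2 hK).trans h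
  calc (K : ℝ) = 2 * (K * (1 / 2)) := by ring
    _ ≤ 2 * (((2 : ℝ) ^ K) ^ δ / δ) := by linarith
    _ = _ := by ring

/-- Fourier transforms of length `n` take almost linearly many operations. -/
theorem exists_hasCircuit_powerDFT {δ : ℝ} (hδ : 0 < δ) :
    ∃ C : ℝ, 0 ≤ C ∧ ∀ (n : ℕ) (ζ : ℂ), ζ ≠ 0 →
      HasCircuit (powerDFT n ζ) (C * (n : ℝ) ^ (1 + δ)) := by
  refine ⟨(4 * (2 / δ) + 2) * 4 ^ (1 + δ), by positivity, fun n ζ hζ => ?_⟩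
  rcases Nat.eq_zero_or_pos n with rfl | hn
  · exact (hasCircuit_of_isEmpty _).mono (by positivity)
  obtain ⟨K, hK, hK'⟩ : ∃ K, 2 * n ≤ 2 ^ K ∧ 2 ^ K ≤ 4 * n := by
    refine ⟨Nat.clog 2 (2 * n), Nat.le_pow_clog one_lt_two _, ?_⟩
    have h := Nat.pow_pred_clog_lt_self one_lt_two (show 1 < 2 * n by omega)
    have hpos : 0 < Nat.clog 2 (2 * n) := Nat.clog_pos one_lt_two (by omega)
    obtain ⟨k, hk⟩ := Nat.exists_eq_succ_of_ne_zero hpos.ne'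
    rw [hk] at h ⊢
    rw [Nat.pred_succ] at h
    rw [pow_succ]
    omega
  refine (hasCircuit_powerDFT_chirp n K hK hζ).mono ?_
  have h₁ : (2 : ℝ) ^ K ≤ 4 * n := by exact_mod_cast hK'
  have h₀ : (2 : ℝ) * n ≤ 2 ^ K := by exact_mod_cast hK
  have h1 : (1 : ℝ) ≤ 2 ^ K := one_le_pow₀ (by norm_num)
  have hM : (0 : ℝ) < 2 ^ K := by positivity
  have h₂ : (2 : ℝ) ^ K * ((2 : ℝ) ^ K) ^ δ = ((2 : ℝ) ^ K) ^ (1 + δ) := by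
    rw [Real.rpow_add hM, Real.rpow_one]
  have h₃ : ((2 : ℝ) ^ K) ^ (1 + δ) ≤ 4 ^ (1 + δ) * (n : ℝ) ^ (1 + δ) := by
    rw [← Real.mul_rpow (by norm_num) (Nat.cast_nonneg n)]
    exact Real.rpow_le_rpow hM.le h₁ (by linarith)
  have h₄ : (2 : ℝ) ^ K ≤ ((2 : ℝ) ^ K) ^ (1 + δ) := by
    rw [← h₂]
    exact le_mul_of_one_le_right hM.le (Real.one_le_rpow h1 hδ.le)
  have h₅ := mul_le_mul_of_nonneg_left (natCast_le_two_pow_rpow K hδ) hM.le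
  calc 4 * (K : ℝ) * 2 ^ K + 2 ^ K + 2 * n ≤ 4 * (2 ^ K * K) + 2 * 2 ^ K := by linarith
    _ ≤ 4 * (2 / δ * (2 ^ K * (2 ^ K) ^ δ)) + 2 * (2 ^ K) ^ (1 + δ) := by linarith
    _ = (4 * (2 / δ) + 2) * (2 ^ K) ^ (1 + δ) := by rw [h₂]; ring
    _ ≤ (4 * (2 / δ) + 2) * (4 ^ (1 + δ) * (n : ℝ) ^ (1 + δ)) :=
        mul_le_mul_of_nonneg_left h₃ (by positivity)
    _ = _ := by ring

end Arith

/-! ### Irreducible representations in coordinates -/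

namespace Representation

variable {G V W : Type*} [Group G] [AddCommGroup V] [Module ℂ V] [AddCommGroup W] [Module ℂ W]

theorem isIrreducible_iff_submodule (ρ : Representation ℂ G V) :
    ρ.IsIrreducible ↔ Nontrivial V ∧
      ∀ p : Submodule ℂ V, (∀ g, ∀ v ∈ p, ρ g v ∈ p) → p = ⊥ ∨ p = ⊤ := by
  constructor
  · intro h
    refine ⟨?_, fun p hp => ?_⟩
    · by_contra hV
      rw [not_nontrivial_iff_subsingleton] at hV
      obtain ⟨p, q, hpq⟩ := h.exists_pair_ne
      exact hpq (Subrepresentation.toSubmodule_injective (Subsingleton.elim _ _))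
    · rcases h.eq_bot_or_eq_top ⟨p, fun g v hv => hp g v hv⟩ with h | h
      · exact Or.inl (congrArg Subrepresentation.toSubmodule h)
      · exact Or.inr (congrArg Subrepresentation.toSubmodule h)
  · rintro ⟨hV, h⟩
    refine { exists_pair_ne := ⟨⊥, ⊤, fun hbt => ?_⟩, eq_bot_or_eq_top := fun p => ?_ }
    · exact bot_ne_top (α := Submodule ℂ V) (congrArg Subrepresentation.toSubmodule hbt)
    · rcases h p.toSubmodule fun g v hv => p.apply_mem_toSubmodule g hv with h | h
      · exact Or.inl (Subrepresentation.toSubmodule_injective h)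
      · exact Or.inr (Subrepresentation.toSubmodule_injective h)

theorem Equiv.exists_linearEquiv {ρ : Representation ℂ G V} {σ : Representation ℂ G W}
    (e : ρ.Equiv σ) : ∃ E : V ≃ₗ[ℂ] W, ∀ g v, E (ρ g v) = σ g (E v) :=
  ⟨e.toLinearEquiv, fun g v => IntertwiningMap.isIntertwining ρ σ e.toIntertwiningMap g v⟩

theorem IsIrreducible.of_equiv {ρ : Representation ℂ G V} {σ : Representation ℂ G W}
    (h : ρ.IsIrreducible) (e : ρ.Equiv σ) : σ.IsIrreducible := by
  rw [isIrreducible_iff_submodule] at h ⊢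
  obtain ⟨hV, h⟩ := h
  obtain ⟨e, he⟩ := e.exists_linearEquiv
  refine ⟨e.symm.toEquiv.nontrivial, fun p hp => ?_⟩
  rcases h (p.comap e.toLinearMap) (fun g v hv => by
    simp only [Submodule.mem_comap, LinearEquiv.coe_coe] at hv ⊢
    rw [he]
    exact hp g _ hv) with h | h
  · left
    rw [eq_bot_iff]
    intro w hw
    have : e.symm w ∈ p.comap e.toLinearMap := by simpa using hw
    rw [h, Submodule.mem_bot] at this
    simpa using this
  · right
    rw [eq_top_iff]
    intro w _
    have : e.symm w ∈ p.comap e.toLinearMap := by rw [h]; trivial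
    simpa using this

/-- The representation on the space of coordinates with respect to a basis. -/
noncomputable def inCoordinates (ρ : Representation ℂ G V) (e : V ≃ₗ[ℂ] W) :
    Representation ℂ G W :=
  (LinearEquiv.conjRingEquiv e).toMonoidHom.comp ρ

theorem inCoordinates_apply (ρ : Representation ℂ G V) (e : V ≃ₗ[ℂ] W) (g : G) (w : W) :
    ρ.inCoordinates e g w = e (ρ g (e.symm w)) := by
  rfl

/-- A representation is equivalent to the one in coordinates. -/
noncomputable def equivInCoordinates (ρ : Representation ℂ G V) (e : V ≃ₗ[ℂ] W) :
    ρ.Equiv (ρ.inCoordinates e) :=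
  Equiv.mk e fun g => by
    ext v
    simp [inCoordinates_apply]

variable {m n : Type*} [Fintype m] [DecidableEq m] [Fintype n] [DecidableEq n]

/-- The matrices of a representation in coordinates. -/
noncomputable def mat (ρ : Representation ℂ G (n → ℂ)) : G →* Matrix n n ℂ :=
  (LinearMap.toMatrixAlgEquiv' (R := ℂ) (n := n)).toAlgHom.toMonoidHom.comp ρ

theorem mat_apply (ρ : Representation ℂ G (n → ℂ)) (g : G) :
    ρ.mat g = LinearMap.toMatrix' (ρ g) := rfl

/-- The representation given by matrices. -/
noncomputable def ofMat (φ : G →* Matrix n n ℂ) : Representation ℂ G (n → ℂ) :=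
  (Matrix.toLinAlgEquiv' (R := ℂ) (n := n)).toAlgHom.toMonoidHom.comp φ

theorem ofMat_apply (φ : G →* Matrix n n ℂ) (g : G) : ofMat φ g = Matrix.toLin' (φ g) := rfl

theorem exists_matrix_of_equiv {ρ : Representation ℂ G (m → ℂ)} {σ : Representation ℂ G (n → ℂ)}
    (e : ρ.Equiv σ) : ∃ (P : Matrix n m ℂ) (P' : Matrix m n ℂ), P * P' = 1 ∧ P' * P = 1 ∧
      ∀ g, σ.mat g = P * ρ.mat g * P' := by
  obtain ⟨e, he⟩ := e.exists_linearEquiv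
  refine ⟨LinearMap.toMatrix' e.toLinearMap, LinearMap.toMatrix' e.symm.toLinearMap,
    ?_, ?_, fun g => ?_⟩
  · rw [← LinearMap.toMatrix'_comp]
    simp
  · rw [← LinearMap.toMatrix'_comp]
    simp
  · rw [mat_apply, mat_apply, ← LinearMap.toMatrix'_comp, ← LinearMap.toMatrix'_comp]
    congr 1
    refine LinearMap.ext fun x => ?_
    simp [he]

/-- The intertwining map given by a matrix. -/
noncomputable def intertwiningOfMatrix {ρ : Representation ℂ G (m → ℂ)}
    {σ : Representation ℂ G (n → ℂ)} (Y : Matrix n m ℂ) (hY : ∀ g, Y * ρ.mat g = σ.mat g * Y) :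
    IntertwiningMap ρ σ :=
  ⟨Matrix.toLin' Y, fun g => by
    have := congrArg Matrix.toLin' (hY g)
    rwa [Matrix.toLin'_mul, Matrix.toLin'_mul, mat_apply, mat_apply, Matrix.toLin'_toMatrix',
      Matrix.toLin'_toMatrix'] at this⟩

theorem intertwiningOfMatrix_toLinearMap {ρ : Representation ℂ G (m → ℂ)}
    {σ : Representation ℂ G (n → ℂ)} (Y : Matrix n m ℂ) (hY : ∀ g, Y * ρ.mat g = σ.mat g * Y) :
    (intertwiningOfMatrix Y hY).toLinearMap = Matrix.toLin' Y := rfl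

/-- Schur's lemma for inequivalent irreducible representations. -/
theorem eq_zero_of_intertwines {ρ : Representation ℂ G (m → ℂ)} {σ : Representation ℂ G (n → ℂ)}
    (hρ : ρ.IsIrreducible) (hσ : σ.IsIrreducible) (hne : ¬ Nonempty (ρ.Equiv σ))
    (Y : Matrix n m ℂ) (hY : ∀ g, Y * ρ.mat g = σ.mat g * Y) : Y = 0 := by
  rcases IsIrreducible.bijective_or_eq_zero (intertwiningOfMatrix Y hY) with h | h
  · exact absurd ⟨(intertwiningOfMatrix Y hY).ofBijective h⟩ hne
  · have h' := congrArg IntertwiningMap.toLinearMap h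
    rw [intertwiningOfMatrix_toLinearMap] at h'
    exact (map_eq_zero_iff _ Matrix.toLin'.injective).1 h'

/-- Schur's lemma for one irreducible representation. -/
theorem eq_smul_one_of_commutes {ρ : Representation ℂ G (m → ℂ)} (hρ : ρ.IsIrreducible)
    (Y : Matrix m m ℂ) (hY : ∀ g, Y * ρ.mat g = ρ.mat g * Y) : ∃ c : ℂ, Y = c • 1 := by
  obtain ⟨c, hc⟩ := IsIrreducible.algebraMap_intertwiningMap_bijective_of_isAlgClosed.2
    (intertwiningOfMatrix Y hY)
  refine ⟨c, ?_⟩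
  have h := congrArg IntertwiningMap.toLinearMap hc
  rw [intertwiningOfMatrix_toLinearMap] at h
  apply Matrix.toLin'.injective
  rw [← h]
  ext1 i
  refine LinearMap.ext fun v => ?_
  simp

end Representation

/-! ### Matrix coefficients and complete sets of irreducible representations -/

namespace Representation

variable {G : Type*} [Group G] [Fintype G]

theorem sum_mat_mul_intertwines {m n : Type*} [Fintype m] [DecidableEq m] [Fintype n]
    [DecidableEq n] (ρ : Representation ℂ G (m → ℂ)) (σ : Representation ℂ G (n → ℂ))
    (X : Matrix n m ℂ) (h : G) :
    (∑ g, σ.mat g * X * ρ.mat g⁻¹) * ρ.mat h = σ.mat h * ∑ g, σ.mat g * X * ρ.mat g⁻¹ := by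
  rw [Matrix.sum_mul, Matrix.mul_sum]
  refine (Fintype.sum_equiv (Equiv.mulLeft h) _ _ fun g => ?_).symm
  simp only [Equiv.coe_mulLeft, mul_inv_rev, map_mul, Matrix.mul_assoc]
  rw [← map_mul ρ.mat h⁻¹ h, inv_mul_cancel, map_one, Matrix.mul_one]

theorem mul_single_mul_apply {m n : Type*} [Fintype m] [DecidableEq m] [Fintype n]
    [DecidableEq n] (A : Matrix n n ℂ) (B : Matrix m m ℂ) (a b : n) (c d : m) :
    (A * Matrix.single b c (1 : ℂ) * B) a d = A a b * B c d := by
  rw [Matrix.mul_apply, Finset.sum_eq_single c]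
  · rw [Matrix.mul_single_apply_same, mul_one]
  · intro k _ hk
    rw [Matrix.mul_single_apply_of_ne _ _ _ _ _ hk, zero_mul]
  · simp

variable {ι : Type*} [Fintype ι] [DecidableEq ι] {d : ι → ℕ}
  {ρ : ∀ i, Representation ℂ G (Fin (d i) → ℂ)}

/-- The matrix coefficients of inequivalent irreducible representations are linearly independent,
by the Schur orthogonality relations. -/
theorem linearIndependent_coefficients (hirr : ∀ i, (ρ i).IsIrreducible)
    (hne : ∀ i j, Nonempty ((ρ i).Equiv (ρ j)) → i = j) :
    LinearIndependent ℂ (fun (e : Σ i, Fin (d i) × Fin (d i)) (g : G) =>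
      (ρ e.1).mat g e.2.1 e.2.2) := by
  rw [Fintype.linearIndependent_iff]
  rintro f hf ⟨j, b, a⟩
  have hf' : ∀ g, ∑ e : Σ i, Fin (d i) × Fin (d i), f e * (ρ e.1).mat g e.2.1 e.2.2 = 0 := by
    intro g
    simpa [Finset.sum_apply] using congrFun hf g
  -- the average of a matrix unit over the group, for two different representations
  have horth : ∀ i, i ≠ j → ∀ p q (r s : Fin (d j)),
      ∑ g, (ρ i).mat g p q * (ρ j).mat g⁻¹ r s = 0 := by
    intro i hij p q r s
    have h := eq_zero_of_intertwines (hirr j) (hirr i) (fun h => hij (hne j i h).symm) _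
      (sum_mat_mul_intertwines (ρ j) (ρ i) (Matrix.single q r 1))
    have h' := congrFun (congrFun h p) s
    simpa only [Matrix.sum_apply, mul_single_mul_apply, Matrix.zero_apply] using h'
  have hself : ∀ p q r s, ∑ g, (ρ j).mat g p q * (ρ j).mat g⁻¹ r s =
      if p = s ∧ q = r then (Fintype.card G : ℂ) / d j else 0 := by
    intro p q r s
    obtain ⟨c, hc⟩ := eq_smul_one_of_commutes (hirr j) _
      (sum_mat_mul_intertwines (ρ j) (ρ j) (Matrix.single q r 1))
    have h' := congrFun (congrFun hc p) s
    simp only [Matrix.sum_apply, mul_single_mul_apply] at h'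
    have htr := congrArg Matrix.trace hc
    have htr' : ∀ g, Matrix.trace ((ρ j).mat g * Matrix.single q r 1 * (ρ j).mat g⁻¹) =
        if q = r then (1 : ℂ) else 0 := by
      intro g
      rw [Matrix.trace_mul_comm, ← Matrix.mul_assoc, ← map_mul, inv_mul_cancel, map_one,
        Matrix.one_mul]
      by_cases hqr : q = r
      · subst hqr
        simp
      · rw [Matrix.trace_single_eq_of_ne _ _ _ hqr, if_neg hqr]
    rw [Matrix.trace_sum, Finset.sum_congr rfl fun g _ => htr' g] at htr
    simp only [Finset.sum_const, Finset.card_univ, Matrix.trace_smul, Matrix.trace_one,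
      Fintype.card_fin, nsmul_eq_mul, smul_eq_mul] at htr
    have hd : (d j : ℂ) ≠ 0 := by
      have := p.pos
      exact_mod_cast this.ne'
    rw [h', Matrix.smul_apply, Matrix.one_apply, smul_eq_mul, ← mul_div_cancel_right₀ c hd, ← htr]
    by_cases hps : p = s <;> by_cases hqr : q = r <;> simp [hps, hqr]
  have hzero : ∑ e : Σ i, Fin (d i) × Fin (d i),
      f e * ∑ g, (ρ e.1).mat g e.2.1 e.2.2 * (ρ j).mat g⁻¹ a b = 0 := by
    simp only [Finset.mul_sum]
    rw [Finset.sum_comm]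
    refine Finset.sum_eq_zero fun g _ => ?_
    simp only [← mul_assoc]
    rw [← Finset.sum_mul, hf' g, zero_mul]
  rw [Finset.sum_eq_single ⟨j, b, a⟩ _ (by simp)] at hzero
  · rw [hself, if_pos ⟨rfl, rfl⟩] at hzero
    have hd : (d j : ℂ) ≠ 0 := by
      have := a.pos
      exact_mod_cast this.ne'
    have hG : (Fintype.card G : ℂ) ≠ 0 := by exact_mod_cast Fintype.card_ne_zero
    exact (mul_eq_zero.1 hzero).resolve_right (div_ne_zero hG hd)
  · rintro ⟨i, p, q⟩ - hne'
    by_cases hij : i = j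
    · subst hij
      have : ¬ (p = b ∧ q = a) := by
        rintro ⟨rfl, rfl⟩
        exact hne' rfl
      simp only [hself, if_neg this, mul_zero]
    · simp only [horth i hij, mul_zero]

theorem sum_sq_le_card (hirr : ∀ i, (ρ i).IsIrreducible)
    (hne : ∀ i j, Nonempty ((ρ i).Equiv (ρ j)) → i = j) :
    ∑ i, d i ^ 2 ≤ Fintype.card G := by
  have h := (linearIndependent_coefficients hirr hne).fintype_card_le_finrank
  simpa [Fintype.card_sigma, sq] using h

end Representation

namespace CompleteIrreps

variable {G : Type*} [Group G]

theorem dim_pos (R : CompleteIrreps G) (i : R.ι) : 0 < R.dim i := by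
  have := ((Representation.isIrreducible_iff_submodule _).1 (R.irreducible i)).1
  by_contra h
  have h0 : R.dim i = 0 := by omega
  have : Subsingleton (Fin (R.dim i) → ℂ) := by
    rw [h0]
    infer_instance
  exact not_subsingleton _ this

theorem finite_index [Finite G] (R : CompleteIrreps G) : Finite R.ι := by
  classical
  cases nonempty_fintype G
  by_contra h
  rw [not_finite_iff_infinite] at h
  obtain ⟨s, hs⟩ := Infinite.exists_subset_card_eq R.ι (Fintype.card G + 1)
  have h₁ := Representation.sum_sq_le_card (ρ := fun i : s => R.ρ i.1)
    (fun i => R.irreducible i) (fun i j hij => Subtype.ext (R.eq_of_equiv _ _ hij))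
  have h₂ : ∑ _i : s, 1 ≤ ∑ i : s, R.dim i.1 ^ 2 :=
    Finset.sum_le_sum fun i _ => Nat.one_le_pow _ _ (R.dim_pos i)
  simp only [Finset.sum_const, Finset.card_univ, Fintype.card_coe, hs, smul_eq_mul,
    mul_one] at h₂
  omega

noncomputable instance [Finite G] (R : CompleteIrreps G) : Fintype R.ι :=
  haveI := R.finite_index
  Fintype.ofFinite _

noncomputable instance (R : CompleteIrreps G) : DecidableEq R.ι := Classical.decEq _

theorem sum_dim_sq_le [Fintype G] (R : CompleteIrreps G) :
    ∑ i, R.dim i ^ 2 ≤ Fintype.card G :=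
  Representation.sum_sq_le_card R.irreducible R.eq_of_equiv

/-- The matrices of the members of a complete set of irreducible representations. -/
noncomputable abbrev mat (R : CompleteIrreps G) (i : R.ι) :
    G →* Matrix (Fin (R.dim i)) (Fin (R.dim i)) ℂ :=
  (R.ρ i).mat

theorem dft_apply [Fintype G] (R : CompleteIrreps G) (c : G → ℂ) (e : R.Entry) :
    R.dft c e = (∑ g, c g • R.mat e.1 g) e.2.1 e.2.2 := rfl

/-- The irreducible representations of `G` on coordinate spaces. -/
abbrev CoordinateIrrep (G : Type*) [Group G] : Type _ :=
  Σ n : ℕ, {σ : Representation ℂ G (Fin n → ℂ) // σ.IsIrreducible}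

/-- Equivalence of representations on coordinate spaces. -/
def coordinateIrrepSetoid (G : Type*) [Group G] : Setoid (CoordinateIrrep G) where
  r σ τ := Nonempty (σ.2.1.Equiv τ.2.1)
  iseqv :=
    { refl := fun _ => ⟨Representation.Equiv.refl _⟩
      symm := fun ⟨e⟩ => ⟨e.symm⟩
      trans := fun ⟨e⟩ ⟨e'⟩ => ⟨e.trans e'⟩ }

theorem finite_quotient_coordinateIrrep [Finite G] :
    Finite (Quotient (coordinateIrrepSetoid G)) := by
  classical
  cases nonempty_fintype G
  by_contra h
  rw [not_finite_iff_infinite] at h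
  obtain ⟨s, hs⟩ := Infinite.exists_subset_card_eq (Quotient (coordinateIrrepSetoid G))
    (Fintype.card G + 1)
  have h₁ := Representation.sum_sq_le_card (ρ := fun i : s => i.1.out.2.1)
    (fun i => i.1.out.2.2) (fun i j hij => Subtype.ext (Quotient.out_equiv_out.1 hij))
  have h₂ : ∑ _i : s, 1 ≤ ∑ i : s, i.1.out.1 ^ 2 := by
    refine Finset.sum_le_sum fun i _ => Nat.one_le_pow _ _ ?_
    have := ((Representation.isIrreducible_iff_submodule _).1 i.1.out.2.2).1
    by_contra h
    have h0 : i.1.out.1 = 0 := by omega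
    have : Subsingleton (Fin i.1.out.1 → ℂ) := by
      rw [h0]
      infer_instance
    exact not_subsingleton _ this
  simp only [Finset.sum_const, Finset.card_univ, Fintype.card_coe, hs, smul_eq_mul,
    mul_one] at h₂
  omega

theorem nonempty_completeIrreps [Finite G] : Nonempty (CompleteIrreps G) := by
  have := finite_quotient_coordinateIrrep (G := G)
  obtain ⟨n, ⟨e⟩⟩ := Finite.exists_equiv_fin (Quotient (coordinateIrrepSetoid G))
  refine ⟨{ ι := Fin n
            dim := fun i => (e.symm i).out.1
            ρ := fun i => (e.symm i).out.2.1
            irreducible := fun i => (e.symm i).out.2.2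
            eq_of_equiv := fun i j h => e.symm.injective (Quotient.out_equiv_out.1 h)
            complete := fun n σ hσ => ⟨e (Quotient.mk (coordinateIrrepSetoid G) ⟨n, σ, hσ⟩), ?_⟩ }⟩
  rw [e.symm_apply_apply]
  exact Quotient.mk_out (s := coordinateIrrepSetoid G) ⟨n, σ, hσ⟩

/-- Complete reducibility, by splitting off invariant complements. -/
theorem exists_decomposition [Finite G] (R : CompleteIrreps G) {V : Type*} [AddCommGroup V]
    [Module ℂ V] [FiniteDimensional ℂ V] (σ : Representation ℂ G V) :
    ∃ (A : Type) (_ : Fintype A) (f : A → R.ι) (e : V ≃ₗ[ℂ] ∀ a, Fin (R.dim (f a)) → ℂ),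
      ∀ g v a, e (σ g v) a = R.ρ (f a) g (e v a) := by
  obtain ⟨n, hn⟩ : ∃ n, Module.finrank ℂ V = n := ⟨_, rfl⟩
  induction n using Nat.strong_induction_on generalizing V with
  | _ n ih =>
  by_cases hirr : σ.IsIrreducible
  · let b : V ≃ₗ[ℂ] (Fin (Module.finrank ℂ V) → ℂ) := (Module.finBasis ℂ V).equivFun
    obtain ⟨i, ⟨E⟩⟩ := R.complete _ (σ.inCoordinates b)
      (Representation.IsIrreducible.of_equiv hirr (σ.equivInCoordinates b))
    obtain ⟨E, hE⟩ := ((σ.equivInCoordinates b).trans E.symm).exists_linearEquiv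
    refine ⟨Unit, inferInstance, fun _ => i,
      E.trans (LinearEquiv.funUnique Unit ℂ (Fin (R.dim i) → ℂ)).symm, fun g v a => ?_⟩
    exact hE g v
  by_cases hV : Subsingleton V
  · exact ⟨Empty, inferInstance, fun a => a.elim,
      { toFun := fun _ a => a.elim
        map_add' := fun _ _ => Subsingleton.elim _ _
        map_smul' := fun _ _ => Subsingleton.elim _ _
        invFun := fun _ => 0
        left_inv := fun _ => Subsingleton.elim _ _
        right_inv := fun _ => Subsingleton.elim _ _ }, fun _ _ a => a.elim⟩
  rw [not_subsingleton_iff_nontrivial] at hV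
  have hex : ∃ p : Submodule ℂ V, (∀ g, ∀ v ∈ p, σ g v ∈ p) ∧ p ≠ ⊥ ∧ p ≠ ⊤ := by
    by_contra! h
    refine hirr ((Representation.isIrreducible_iff_submodule σ).2 ⟨hV, fun p hp => ?_⟩)
    by_cases hb : p = ⊥
    · exact Or.inl hb
    · exact Or.inr (h p hp hb)
  obtain ⟨p, hp, hbot, htop⟩ := hex
  have : NeZero (Nat.card G : ℂ) := ⟨by exact_mod_cast Nat.card_pos.ne'⟩
  have hss : Representation.IsSemisimpleRepresentation σ := inferInstance
  obtain ⟨q, hq⟩ := hss.exists_isCompl ⟨p, fun g v hv => hp g v hv⟩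
  have hpq : IsCompl p q.toSubmodule := by
    constructor
    · rw [disjoint_iff]
      exact congrArg Subrepresentation.toSubmodule hq.inf_eq_bot
    · rw [codisjoint_iff]
      exact congrArg Subrepresentation.toSubmodule hq.sup_eq_top
  have hadd := Submodule.finrank_add_eq_of_isCompl hpq
  have hp0 : 0 < Module.finrank ℂ p := by
    rw [Module.finrank_pos_iff, Submodule.nontrivial_iff_ne_bot]
    exact hbot
  have hplt : Module.finrank ℂ p < Module.finrank ℂ V := Submodule.finrank_lt htop.lt_top.ne
  let σp : Representation ℂ G p :=
    Subrepresentation.toRepresentation (ρ := σ) ⟨p, fun g v hv => hp g v hv⟩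
  obtain ⟨A, hA, f, e, he⟩ := ih (Module.finrank ℂ p) (by omega) σp rfl
  obtain ⟨A', hA', f', e', he'⟩ := ih (Module.finrank ℂ q.toSubmodule) (by omega)
    q.toRepresentation rfl
  let E₀ : V ≃ₗ[ℂ] p × q.toSubmodule := (Submodule.prodEquivOfIsCompl _ _ hpq).symm
  have hE₀ : ∀ g v, E₀ (σ g v) = (σp g (E₀ v).1, q.toRepresentation g (E₀ v).2) := by
    intro g v
    obtain ⟨w, rfl⟩ := E₀.symm.surjective v
    rw [E₀.apply_symm_apply]
    apply E₀.symm.injective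
    rw [E₀.symm_apply_apply]
    simp only [E₀, LinearEquiv.symm_symm, Submodule.coe_prodEquivOfIsCompl', map_add]
    rfl
  refine ⟨A ⊕ A', inferInstance, Sum.elim f f',
    (E₀.trans (e.prodCongr e')).trans (LinearEquiv.sumPiEquivProdPi ℂ A A'
      (fun a => Fin (R.dim (Sum.elim f f' a)) → ℂ)).symm, ?_⟩
  rintro g v (a | a)
  · change e (E₀ (σ g v)).1 a = R.ρ (f a) g (e (E₀ v).1 a)
    rw [hE₀, he]
  · change e' (E₀ (σ g v)).2 a = R.ρ (f' a) g (e' (E₀ v).2 a)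
    rw [hE₀, he']

/-- A representation in coordinates is, after a change of basis, a block diagonal matrix of members
of the complete set. -/
theorem exists_blockDiagonal [Finite G] (R : CompleteIrreps G) {n : Type*} [Fintype n]
    [DecidableEq n] (φ : G →* Matrix n n ℂ) :
    ∃ (A : Type) (_ : Fintype A) (_ : DecidableEq A) (f : A → R.ι)
      (P : Matrix n (Σ a, Fin (R.dim (f a))) ℂ) (P' : Matrix (Σ a, Fin (R.dim (f a))) n ℂ),
      ∑ a, R.dim (f a) = Fintype.card n ∧
        ∀ g, φ g = P * Matrix.blockDiagonal' (fun a => R.mat (f a) g) * P' := by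
  classical
  obtain ⟨A, hA, f, e, he⟩ := R.exists_decomposition (Representation.ofMat φ)
  let E : (n → ℂ) ≃ₗ[ℂ] ((Σ a, Fin (R.dim (f a))) → ℂ) :=
    e.trans (LinearEquiv.piCurry ℂ (fun (a : A) (_ : Fin (R.dim (f a))) => ℂ)).symm
  refine ⟨A, hA, inferInstance, f, LinearMap.toMatrix' E.symm.toLinearMap,
    LinearMap.toMatrix' E.toLinearMap, ?_, fun g => ?_⟩
  · have := E.finrank_eq
    simp only [Module.finrank_fintype_fun_eq_card, Fintype.card_sigma, Fintype.card_fin] at this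
    exact this.symm
  · apply Matrix.toLin'.injective
    rw [Matrix.toLin'_mul, Matrix.toLin'_mul, Matrix.toLin'_toMatrix', Matrix.toLin'_toMatrix',
      ← Representation.ofMat_apply]
    refine LinearMap.ext fun v => E.injective ?_
    simp only [LinearMap.comp_apply, LinearEquiv.coe_coe, LinearEquiv.apply_symm_apply]
    funext ⟨a, k⟩
    have h₁ : E (Representation.ofMat φ g v) ⟨a, k⟩ = R.ρ (f a) g (e v a) k :=
      congrFun (he g v a) k
    have h₂ : ∀ a k, E v ⟨a, k⟩ = e v a k := fun a k => rfl
    rw [h₁, Matrix.toLin'_apply, Matrix.mulVec, dotProduct, Fintype.sum_sigma,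
      Finset.sum_eq_single a]
    · simp only [Matrix.blockDiagonal'_apply_eq, h₂, Representation.mat_apply]
      conv_lhs => rw [← Matrix.toLin'_toMatrix' (R.ρ (f a) g), Matrix.toLin'_apply]
      rfl
    · intro b _ hb
      refine Finset.sum_eq_zero fun l _ => ?_
      rw [Matrix.blockDiagonal'_apply_ne _ _ _ hb.symm, zero_mul]
    · simp

end CompleteIrreps

/-! ### Twists of representations by characters -/

namespace Representation

variable {G V W : Type*} [Group G] [AddCommGroup V] [Module ℂ V] [AddCommGroup W] [Module ℂ W]

/-- The product of a representation and a linear character. -/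
def twist (ρ : Representation ℂ G V) (χ : G →* ℂˣ) : Representation ℂ G V where
  toFun g := (χ g : ℂ) • ρ g
  map_one' := by simp
  map_mul' g h := by rw [map_mul, map_mul, Units.val_mul, smul_mul_smul_comm]

theorem twist_apply (ρ : Representation ℂ G V) (χ : G →* ℂˣ) (g : G) (v : V) :
    ρ.twist χ g v = (χ g : ℂ) • ρ g v := rfl

theorem twist_one (ρ : Representation ℂ G V) : ρ.twist 1 = ρ := by
  ext g v
  simp [twist_apply]

theorem twist_twist (ρ : Representation ℂ G V) (χ ψ : G →* ℂˣ) :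
    (ρ.twist χ).twist ψ = ρ.twist (χ * ψ) := by
  ext g v
  simp [twist_apply, smul_smul, mul_comm]

theorem mat_twist {n : Type*} [Fintype n] [DecidableEq n] (ρ : Representation ℂ G (n → ℂ))
    (χ : G →* ℂˣ) (g : G) : (ρ.twist χ).mat g = (χ g : ℂ) • ρ.mat g := by
  simp only [mat_apply]
  exact map_smul _ _ _

theorem IsIrreducible.twist {ρ : Representation ℂ G V} (h : ρ.IsIrreducible) (χ : G →* ℂˣ) :
    (ρ.twist χ).IsIrreducible := by
  rw [isIrreducible_iff_submodule] at h ⊢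
  refine ⟨h.1, fun p hp => h.2 p fun g v hv => ?_⟩
  have := p.smul_mem ((χ g : ℂ)⁻¹) (hp g v hv)
  rwa [twist_apply, smul_smul, inv_mul_cancel₀ (Units.ne_zero _), one_smul] at this

theorem nonempty_equiv_of_linearEquiv {ρ : Representation ℂ G V} {σ : Representation ℂ G W}
    (E : V ≃ₗ[ℂ] W) (hE : ∀ g v, E (ρ g v) = σ g (E v)) : Nonempty (ρ.Equiv σ) :=
  ⟨Equiv.mk E fun g => LinearMap.ext fun v => hE g v⟩

theorem nonempty_equiv_twist {ρ : Representation ℂ G V} {σ : Representation ℂ G W}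
    (h : Nonempty (ρ.Equiv σ)) (χ : G →* ℂˣ) : Nonempty ((ρ.twist χ).Equiv (σ.twist χ)) := by
  obtain ⟨E, hE⟩ := h.some.exists_linearEquiv
  exact nonempty_equiv_of_linearEquiv E fun g v => by simp [twist_apply, hE]

/-- An irreducible representation that is equivalent to its twist by a character of order `p` is
graded by the eigenspaces of an intertwining operator. -/
theorem exists_graded_basis {d p : ℕ} [NeZero p] {ρ : Representation ℂ G (Fin d → ℂ)}
    (hρ : ρ.IsIrreducible) {χ : G →* ℂˣ} (h : Nonempty (ρ.Equiv (ρ.twist χ))) {ζ : ℂ}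
    (hζ : IsPrimitiveRoot ζ p) (hχ : ∀ g, ∃ l : ℕ, (χ g : ℂ) = ζ ^ l)
    (hsurj : ∃ g, (χ g : ℂ) = ζ) :
    ∃ (m : ℕ) (P : Matrix (Fin d) (Fin p × Fin m) ℂ) (P' : Matrix (Fin p × Fin m) (Fin d) ℂ)
      (B : G →* Matrix (Fin p × Fin m) (Fin p × Fin m) ℂ),
      p * m = d ∧ (∀ g, ρ.mat g = P * B g * P') ∧
        ∀ g (j' j : Fin p) (a c : Fin m), (χ g : ℂ) * ζ ^ (j : ℕ) ≠ ζ ^ (j' : ℕ) →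
          B g (j', a) (j, c) = 0 := by
  obtain ⟨M, hM⟩ := h.some.exists_linearEquiv
  have hV : Nontrivial (Fin d → ℂ) := ((isIrreducible_iff_submodule ρ).1 hρ).1
  obtain ⟨μ, hμ⟩ := Module.End.exists_eigenvalue (M.toLinearMap : Module.End ℂ (Fin d → ℂ))
  have hμ0 : μ ≠ 0 := by
    rintro rfl
    obtain ⟨v, hv, hv0⟩ := hμ.exists_hasEigenvector
    rw [Module.End.mem_eigenspace_iff, zero_smul] at hv
    exact hv0 ((LinearEquiv.map_eq_zero_iff M).1 hv)
  have hζ0 : ζ ≠ 0 := hζ.ne_zero (NeZero.ne p)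
  let E : Fin p → Submodule ℂ (Fin d → ℂ) := fun j =>
    Module.End.eigenspace (M.toLinearMap : Module.End ℂ (Fin d → ℂ)) (ζ ^ (j : ℕ) * μ)
  have hmemE : ∀ j v, v ∈ E j ↔ M v = (ζ ^ (j : ℕ) * μ) • v := fun j v =>
    Module.End.mem_eigenspace_iff
  have hind : iSupIndep E := by
    refine (Module.End.eigenspaces_iSupIndep _).comp fun i j hij => ?_
    exact Fin.ext (hζ.pow_inj i.2 j.2 (mul_right_cancel₀ hμ0 hij))
  -- the group permutes the eigenspaces
  have hmap : ∀ g (j j' : Fin p), (χ g : ℂ) * ζ ^ (j : ℕ) = ζ ^ (j' : ℕ) → ∀ v ∈ E j,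
      ρ g v ∈ E j' := by
    intro g j j' hg v hv
    rw [hmemE] at hv ⊢
    rw [hM, twist_apply, hv, map_smul, smul_smul, ← hg, mul_assoc]
  have hex : ∀ g (j : Fin p), ∃ j' : Fin p, (χ g : ℂ) * ζ ^ (j : ℕ) = ζ ^ (j' : ℕ) := by
    intro g j
    obtain ⟨l, hl⟩ := hχ g
    refine ⟨⟨(l + j) % p, Nat.mod_lt _ (Nat.pos_of_ne_zero (NeZero.ne p))⟩, ?_⟩
    rw [hl, ← pow_add]
    exact pow_eq_pow_mod _ hζ.pow_eq_one
  have htop : iSup E = ⊤ := by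
    refine (((isIrreducible_iff_submodule ρ).1 hρ).2 (iSup E) fun g v hv => ?_).resolve_left ?_
    · have hle : iSup E ≤ (iSup E).comap (ρ g) := iSup_le fun j w hw => by
        obtain ⟨j', hj'⟩ := hex g j
        exact Submodule.mem_iSup_of_mem j' (hmap g j j' hj' w hw)
      exact hle hv
    · intro hbot
      obtain ⟨v, hv, hv0⟩ := hμ.exists_hasEigenvector
      have : v ∈ iSup E := Submodule.mem_iSup_of_mem 0 ((hmemE 0 v).2 (by
        have := Module.End.mem_eigenspace_iff.1 hv
        simpa using this))
      rw [hbot] at this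
      exact hv0 this
  have hint : DirectSum.IsInternal E :=
    (DirectSum.isInternal_submodule_iff_iSupIndep_and_iSup_eq_top E).2 ⟨hind, htop⟩
  have hfin : ∀ j j' : Fin p, Module.finrank ℂ (E j) ≤ Module.finrank ℂ (E j') := by
    intro j j'
    obtain ⟨g, hg⟩ := hsurj
    have hg' : (χ (g ^ ((j' : ℕ) + (p - j))) : ℂ) * ζ ^ (j : ℕ) = ζ ^ (j' : ℕ) := by
      rw [map_pow, Units.val_pow_eq_pow_val, hg, ← pow_add]
      have : (j' : ℕ) + (p - j) + j = j' + p := by omega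
      rw [this, pow_add, hζ.pow_eq_one, mul_one]
    have hinj : Function.Injective (ρ (g ^ ((j' : ℕ) + (p - j)))) :=
      (ρ.apply_bijective _).1
    exact LinearMap.finrank_le_finrank_of_injective
      (f := (ρ (g ^ ((j' : ℕ) + (p - j)))).restrict (hmap _ j j' hg'))
      fun v w hvw => Subtype.ext (hinj (congrArg Subtype.val hvw))
  have hm : ∀ j, Module.finrank ℂ (E j) = Module.finrank ℂ (E 0) := fun j =>
    le_antisymm (hfin _ _) (hfin _ _)
  let m := Module.finrank ℂ (E 0)
  let bE : ∀ j, Module.Basis (Fin m) ℂ (E j) := fun j => Module.finBasisOfFinrankEq ℂ (E j) (hm j)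
  let b := hint.collectedBasis bE
  let b' := b.reindex (Equiv.sigmaEquivProd (Fin p) (Fin m))
  refine ⟨m, (Pi.basisFun ℂ (Fin d)).toMatrix b', b'.toMatrix (Pi.basisFun ℂ (Fin d)),
    (LinearMap.toMatrixAlgEquiv b').toAlgHom.toMonoidHom.comp ρ, ?_, fun g => ?_, ?_⟩
  · have := Module.finrank_eq_card_basis b'
    simpa using this.symm
  · rw [mat_apply, ← LinearMap.toMatrix_eq_toMatrix']
    exact (basis_toMatrix_mul_linearMap_toMatrix_mul_basis_toMatrix _ _ _ _ _).symm
  · intro g j' j a c hne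
    obtain ⟨k, hk⟩ := hex g j
    have hkj : k ≠ j' := by
      rintro rfl
      exact hne hk
    have hmem : ρ g (b' (j, c)) ∈ E k := by
      refine hmap g j k hk _ ?_
      simp only [b', b, Module.Basis.reindex_apply, DirectSum.IsInternal.collectedBasis_coe]
      exact SetLike.coe_mem _
    change LinearMap.toMatrix b' b' (ρ g) (j', a) (j, c) = 0
    rw [LinearMap.toMatrix_apply, Module.Basis.repr_reindex_apply]
    exact hint.collectedBasis_repr_of_mem_ne bE hkj hmem

end Representation

/-! ### Normal subgroups of prime index -/

namespace Arith

variable {C τ : ℝ}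

theorem HasCircuit.nonneg {I O : Type*} {F : (I → ℂ) → O → ℂ} {n : ℝ} (h : HasCircuit F n) :
    0 ≤ n := by
  obtain ⟨Γ, -, h⟩ := h
  exact (Nat.cast_nonneg _).trans h

theorem natCast_rpow_le_sq_mul (hτ : 2 ≤ τ) {d n : ℕ} (h : d ^ 2 ≤ n) :
    (d : ℝ) ^ τ ≤ (d : ℝ) ^ 2 * (n : ℝ) ^ ((τ - 2) / 2) := by
  rcases Nat.eq_zero_or_pos d with rfl | hd
  · rw [Nat.cast_zero, Real.zero_rpow (by linarith)]
    positivity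
  · have hd' : (0 : ℝ) < d := by exact_mod_cast hd
    have h' : (d : ℝ) ^ 2 ≤ n := by exact_mod_cast h
    have h₁ : (d : ℝ) ^ τ = (d : ℝ) ^ 2 * ((d : ℝ) ^ 2) ^ ((τ - 2) / 2) := by
      rw [← Real.rpow_natCast, ← Real.rpow_mul hd'.le, ← Real.rpow_add hd']
      congr 1
      push_cast
      ring
    rw [h₁]
    exact mul_le_mul_of_nonneg_left
      (Real.rpow_le_rpow (by positivity) h' (by linarith)) (by positivity)

theorem natCast_mul_rpow (n : ℕ) (hτ : 2 ≤ τ) :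
    (n : ℝ) * (n : ℝ) ^ ((τ - 2) / 2) = (n : ℝ) ^ (τ / 2) := by
  rcases Nat.eq_zero_or_pos n with rfl | hn
  · rw [Nat.cast_zero, zero_mul, Real.zero_rpow (by linarith)]
  · have hn' : (0 : ℝ) < n := by exact_mod_cast hn
    rw [← Real.rpow_one_add' hn'.le (by linarith)]
    congr 1
    ring

theorem sum_dim_rpow_le {G : Type*} [Group G] [Fintype G] (R : CompleteIrreps G) (hτ : 2 ≤ τ) :
    ∑ i, (R.dim i : ℝ) ^ τ ≤ (Fintype.card G : ℝ) ^ (τ / 2) := by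
  have hs : (∑ i, (R.dim i : ℝ) ^ 2) ≤ Fintype.card G := by exact_mod_cast R.sum_dim_sq_le
  have hd : ∀ i, R.dim i ^ 2 ≤ Fintype.card G := fun i =>
    (Finset.single_le_sum (f := fun i => R.dim i ^ 2) (fun _ _ => Nat.zero_le _)
      (Finset.mem_univ i)).trans R.sum_dim_sq_le
  calc ∑ i, (R.dim i : ℝ) ^ τ
      ≤ ∑ i, (R.dim i : ℝ) ^ 2 * (Fintype.card G : ℝ) ^ ((τ - 2) / 2) :=
        Finset.sum_le_sum fun i _ => natCast_rpow_le_sq_mul hτ (hd i)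
    _ = (∑ i, (R.dim i : ℝ) ^ 2) * (Fintype.card G : ℝ) ^ ((τ - 2) / 2) := by
        rw [Finset.sum_mul]
    _ ≤ Fintype.card G * (Fintype.card G : ℝ) ^ ((τ - 2) / 2) :=
        mul_le_mul_of_nonneg_right hs (by positivity)
    _ = _ := natCast_mul_rpow _ hτ

/-- The image of an element of the group algebra under any matrix representation is read off from
its Fourier transform, up to a change of basis. -/
theorem exists_circuit_of_dft (hM : MulBound C τ) {H : Type*} [Group H] [Fintype H]
    (R : CompleteIrreps H) {n : Type*} [Fintype n] [DecidableEq n] (φ : H →* Matrix n n ℂ) :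
    ∃ L : (R.Entry → ℂ) → Matrix n n ℂ, HasMatCircuit L (2 * C * (Fintype.card n : ℝ) ^ τ) ∧
      ∀ c, L (R.dft c) = ∑ h, c h • φ h := by
  obtain ⟨A, _, _, f, P, P', hcard, hφ⟩ := R.exists_blockDiagonal φ
  have hcard' : Fintype.card (Σ a, Fin (R.dim (f a))) = Fintype.card n := by
    rw [← hcard, Fintype.card_sigma]
    simp
  refine ⟨fun y => P * Matrix.blockDiagonal' (fun a => Matrix.of fun p q => y ⟨f a, (p, q)⟩) * P',
    ?_, fun c => ?_⟩
  · refine (HasMatCircuit.const_mul_mul_const hM (a := 0) ?_ P P' _ hcard'.le le_rfl le_rfl).mono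
      (by simp)
    refine hasCircuit_wire _ ?_
    rintro ⟨⟨a, p⟩, ⟨b, q⟩⟩
    by_cases hab : a = b
    · subst hab
      exact Or.inl ⟨⟨f a, (p, q)⟩, fun y => by simp [Matrix.blockDiagonal'_apply_eq]⟩
    · exact Or.inr ⟨0, fun y => Matrix.blockDiagonal'_apply_ne _ _ _ hab⟩
  · have h : Matrix.blockDiagonal'
        (fun a => Matrix.of fun p q => R.dft c ⟨f a, (p, q)⟩) =
        ∑ h, c h • Matrix.blockDiagonal' (fun a => R.mat (f a) h) := by
      ext ⟨a, p⟩ ⟨b, q⟩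
      rw [Matrix.sum_apply]
      by_cases hab : a = b
      · subst hab
        simp [Matrix.blockDiagonal'_apply_eq, CompleteIrreps.dft_apply, Matrix.sum_apply]
      · simp [Matrix.blockDiagonal'_apply_ne _ _ _ hab]
    simp only [h, Matrix.mul_sum, Matrix.sum_mul, Matrix.mul_smul, Matrix.smul_mul, hφ]

variable {G : Type*} [Group G] [Fintype G]

theorem sum_eq_sum_powers {p : ℕ} {N : Subgroup G} [Fintype N] {x : G}
    (hbij : Function.Bijective fun y : Fin p × N => x ^ (y.1 : ℕ) * (y.2 : G))
    {M : Type*} [AddCommMonoid M] (f : G → M) :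
    ∑ g, f g = ∑ k : Fin p, ∑ n : N, f (x ^ (k : ℕ) * n) := by
  rw [← Fintype.sum_prod_type']
  exact (Fintype.sum_bijective _ hbij _ _ fun _ => rfl).symm

theorem sum_smul_mat_eq {p : ℕ} {N : Subgroup G} [Fintype N] {x : G}
    (hbij : Function.Bijective fun y : Fin p × N => x ^ (y.1 : ℕ) * (y.2 : G))
    {n : Type*} [Fintype n] [DecidableEq n] (φ : G →* Matrix n n ℂ) (c : G → ℂ) :
    ∑ g, c g • φ g = ∑ k : Fin p, φ (x ^ (k : ℕ)) *
      ∑ h : N, c (x ^ (k : ℕ) * h) • φ.comp N.subtype h := by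
  rw [sum_eq_sum_powers hbij]
  refine Finset.sum_congr rfl fun k _ => ?_
  rw [Matrix.mul_sum]
  refine Finset.sum_congr rfl fun h _ => ?_
  rw [Matrix.mul_smul, map_mul]
  rfl

/-- The transform at a representation that is equivalent to its twist: with respect to the grading
by `p` blocks of size `d / p`, the subgroup is block diagonal, and a power of `x` shifts the
blocks. -/
theorem exists_circuit_of_equiv_twist (hM : MulBound C τ) (hτ : 2 ≤ τ) {p d : ℕ} [NeZero p]
    {N : Subgroup G} [Fintype N] (RN : CompleteIrreps N) {x : G}
    (hbij : Function.Bijective fun y : Fin p × N => x ^ (y.1 : ℕ) * (y.2 : G))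
    {χ : G →* ℂˣ} (hχN : ∀ n ∈ N, χ n = 1) {ζ : ℂ} (hζ : IsPrimitiveRoot ζ p)
    (hx : (χ x : ℂ) = ζ) {ρ : Representation ℂ G (Fin d → ℂ)} (hρ : ρ.IsIrreducible)
    (h : Nonempty (ρ.Equiv (ρ.twist χ))) :
    ∃ L : (Fin p × RN.Entry → ℂ) → Matrix (Fin d) (Fin d) ℂ,
      HasMatCircuit L (5 * C * (d : ℝ) ^ τ) ∧
        ∀ c : G → ℂ, L (fun y => RN.dft (fun n => c (x ^ (y.1 : ℕ) * n)) y.2) =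
          ∑ g, c g • ρ.mat g := by
  classical
  have hχx : ∀ (k : ℕ) (n : N), (χ (x ^ k * n) : ℂ) = ζ ^ k := by
    intro k n
    rw [map_mul, hχN n n.2, mul_one, map_pow, Units.val_pow_eq_pow_val, hx]
  obtain ⟨m, P, P', B, hpm, hP, hB⟩ := Representation.exists_graded_basis hρ h hζ
    (fun g => by
      obtain ⟨⟨k, n⟩, rfl⟩ := hbij.2 g
      exact ⟨k, hχx k n⟩) ⟨x, hx⟩
  have hζ0 : ζ ≠ 0 := hζ.ne_zero (NeZero.ne p)
  have hBN : ∀ (n : N) (j' j : Fin p) (a c : Fin m), j' ≠ j → B n (j', a) (j, c) = 0 := by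
    intro n j' j a c hne
    refine hB _ _ _ _ _ fun h => hne ?_
    rw [hχN n n.2, Units.val_one, one_mul] at h
    exact (Fin.ext (hζ.pow_inj j.2 j'.2 h)).symm
  have hBx : ∀ (k j' j : Fin p) (a c : Fin m), k ≠ j' - j → B (x ^ (k : ℕ)) (j', a) (j, c) = 0 := by
    intro k j' j a c hne
    refine hB _ _ _ _ _ fun h => hne (eq_sub_of_add_eq ?_)
    have := hχx k 1
    rw [Subgroup.coe_one, mul_one] at this
    rw [this, ← pow_add, pow_eq_pow_mod _ hζ.pow_eq_one, ← Fin.val_add] at h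
    exact Fin.ext (hζ.pow_inj (k + j).2 j'.2 h)
  -- the diagonal blocks are representations of `N`
  let φ : Fin p → N →* Matrix (Fin m) (Fin m) ℂ := fun j =>
    { toFun := fun n => Matrix.of fun a c => B n (j, a) (j, c)
      map_one' := by
        ext a c
        simp [Matrix.one_apply]
      map_mul' := fun n n' => by
        ext a c
        simp only [Subgroup.coe_mul, map_mul, Matrix.of_apply, Matrix.mul_apply]
        rw [Fintype.sum_prod_type, Finset.sum_eq_single j]
        · intro k _ hk
          exact Finset.sum_eq_zero fun b _ => by rw [hBN n j k a b hk.symm, zero_mul]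
        · simp }
  choose L hL hL' using fun j => exists_circuit_of_dft hM RN (φ j)
  let X : Fin p → Fin p → Matrix (Fin m) (Fin m) ℂ := fun j' j =>
    Matrix.of fun a c => B (x ^ ((j' - j : Fin p) : ℕ)) (j', a) (j, c)
  let K : (Fin p × RN.Entry → ℂ) → Matrix (Fin p × Fin m) (Fin p × Fin m) ℂ := fun y =>
    Matrix.of fun r s => (X r.1 s.1 * L s.1 fun e => y (r.1 - s.1, e)) r.2 s.2
  have hcard : Fintype.card (Fin p × Fin m) = d := by simp [hpm]
  have hm0 : 0 ≤ C * (m : ℝ) ^ τ := mul_nonneg hM.nonneg (Real.rpow_nonneg (Nat.cast_nonneg _) _)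
  have hK : HasMatCircuit K (3 * C * (d : ℝ) ^ τ) := by
    have h₁ : ∀ o : Fin p × Fin p, HasCircuit
        (fun (y : Fin p × RN.Entry → ℂ) (q : Fin m × Fin m) =>
          (X o.1 o.2 * L o.2 fun e => y (o.1 - o.2, e)) q.1 q.2)
        (3 * C * (m : ℝ) ^ τ) := by
      intro o
      have h₂ : HasMatCircuit (fun y : Fin p × RN.Entry → ℂ => L o.2 fun e => y (o.1 - o.2, e))
          (2 * C * (m : ℝ) ^ τ) := by
        have h₃ := hL o.2
        rw [Fintype.card_fin] at h₃
        exact HasCircuit.precomp h₃ fun e => (o.1 - o.2, e)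
      have h₃ := (hasMatCircuit_const (X o.1 o.2)).mul hM h₂ m (by simp) (by simp) (by simp)
      exact HasCircuit.mono h₃ (le_of_eq (by ring))
    refine HasCircuit.mono (hasCircuit_of_fibers h₁ (fun o => (o.1.1, o.2.1))
      (fun o => (o.1.2, o.2.2))
      fun y o => rfl) ?_
    simp only [Finset.sum_const, Finset.card_univ, Fintype.card_prod, Fintype.card_fin,
      nsmul_eq_mul]
    have hp1 : (1 : ℝ) ≤ p := by exact_mod_cast Nat.one_le_iff_ne_zero.2 (NeZero.ne p)
    have h₄ : (p : ℝ) ^ 2 ≤ (p : ℝ) ^ τ := by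
      rw [← Real.rpow_natCast]
      exact Real.rpow_le_rpow_of_exponent_le hp1 (by exact_mod_cast hτ)
    have h₅ : (d : ℝ) ^ τ = (p : ℝ) ^ τ * (m : ℝ) ^ τ := by
      rw [← hpm, Nat.cast_mul, Real.mul_rpow (by positivity) (by positivity)]
    rw [h₅]
    push_cast
    nlinarith [mul_le_mul_of_nonneg_right h₄ hm0]
  refine ⟨fun y => P * K y * P', ?_, fun c => ?_⟩
  · refine (hK.const_mul_mul_const hM P P' d hcard.le (by simp) (by simp)).mono (le_of_eq ?_)
    ring
  · have hKc : K (fun y => RN.dft (fun n => c (x ^ (y.1 : ℕ) * n)) y.2) = ∑ g, c g • B g := by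
      rw [sum_smul_mat_eq hbij B c]
      ext ⟨j', a⟩ ⟨j, b⟩
      simp only [K, Matrix.of_apply, hL' j, Matrix.sum_apply]
      rw [Finset.sum_eq_single (j' - j)]
      · rw [Matrix.mul_apply, Matrix.mul_apply, Fintype.sum_prod_type, Finset.sum_eq_single j]
        · refine Finset.sum_congr rfl fun e _ => ?_
          simp only [X, Matrix.of_apply, Matrix.sum_apply, Matrix.smul_apply]
          rfl
        · intro k _ hk
          refine Finset.sum_eq_zero fun e _ => ?_
          have : (∑ h : N, c (x ^ ((j' - j : Fin p) : ℕ) * h) • (B.comp N.subtype) h)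
              (k, e) (j, b) = 0 := by
            rw [Matrix.sum_apply]
            refine Finset.sum_eq_zero fun n _ => ?_
            rw [Matrix.smul_apply, MonoidHom.comp_apply, Subgroup.coe_subtype,
              hBN n k j e b hk, smul_zero]
          rw [this, mul_zero]
        · simp
      · intro k _ hk
        rw [Matrix.mul_apply, Fintype.sum_prod_type]
        refine Finset.sum_eq_zero fun k' _ => Finset.sum_eq_zero fun e _ => ?_
        by_cases hk' : k' = j
        · subst hk'
          rw [hBx k j' k' a e hk, zero_mul]
        · have : (∑ h : N, c (x ^ (k : ℕ) * h) • (B.comp N.subtype) h) (k', e) (j, b) = 0 := by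
            rw [Matrix.sum_apply]
            refine Finset.sum_eq_zero fun n _ => ?_
            rw [Matrix.smul_apply, MonoidHom.comp_apply, Subgroup.coe_subtype,
              hBN n k' j e b hk', smul_zero]
          rw [this, mul_zero]
      · simp
    simp only [hKc, Matrix.mul_sum, Matrix.sum_mul, Matrix.mul_smul, Matrix.smul_mul, hP]

/-- The transforms at all twists of a representation, by one cyclic Fourier transform for each
matrix entry. -/
theorem exists_circuit_twists (hM : MulBound C τ) {p d : ℕ}
    {N : Subgroup G} [Fintype N] (RN : CompleteIrreps N) {x : G}
    (hbij : Function.Bijective fun y : Fin p × N => x ^ (y.1 : ℕ) * (y.2 : G))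
    {χ : G →* ℂˣ} (hχN : ∀ n ∈ N, χ n = 1) {ζ : ℂ}
    (hx : (χ x : ℂ) = ζ) (ρ : Representation ℂ G (Fin d → ℂ)) {T : ℝ}
    (hT : HasCircuit (powerDFT p ζ) T) :
    ∃ L : (Fin p × RN.Entry → ℂ) → Fin p → Matrix (Fin d) (Fin d) ℂ,
      HasCircuit (fun y (o : Fin p × (Fin d × Fin d)) => L y o.1 o.2.1 o.2.2)
        (3 * C * (p * (d : ℝ) ^ τ) + d ^ 2 * T) ∧
        ∀ (c : G → ℂ) j, L (fun y => RN.dft (fun n => c (x ^ (y.1 : ℕ) * n)) y.2) j =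
          ∑ g, c g • (χ g : ℂ) ^ (j : ℕ) • ρ.mat g := by
  classical
  obtain ⟨L₀, hL₀, hL₀'⟩ := exists_circuit_of_dft hM RN (ρ.mat.comp N.subtype)
  let Y : Fin p → (Fin p × RN.Entry → ℂ) → Matrix (Fin d) (Fin d) ℂ := fun k y =>
    ρ.mat (x ^ (k : ℕ)) * L₀ fun e => y (k, e)
  have hY : ∀ k, HasMatCircuit (Y k) (3 * C * (d : ℝ) ^ τ) := by
    intro k
    rw [Fintype.card_fin] at hL₀
    have h₁ : HasMatCircuit (fun y : Fin p × RN.Entry → ℂ => L₀ fun e => y (k, e))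
        (2 * C * (d : ℝ) ^ τ) := HasCircuit.precomp hL₀ fun e => (k, e)
    refine ((hasMatCircuit_const (ρ.mat (x ^ (k : ℕ)))).mul hM h₁ d ?_ ?_ ?_).mono (le_of_eq ?_)
    · simp
    · simp
    · simp
    · ring
  have hYall := hasCircuit_sigma hY
  refine ⟨fun y j => Matrix.of fun a b => powerDFT p ζ (fun k => Y k y a b) j, ?_, fun c j => ?_⟩
  · have hF : ∀ ab : Fin d × Fin d, HasCircuit
        (fun (y : (Σ _ : Fin p, Fin d × Fin d) → ℂ) => powerDFT p ζ fun k => y ⟨k, ab⟩) T :=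
      fun ab => hT.precomp fun k => (⟨k, ab⟩ : Σ _ : Fin p, Fin d × Fin d)
    have hFall := hasCircuit_of_fibers hF
      (F := fun y (o : Fin p × (Fin d × Fin d)) => powerDFT p ζ (fun k => y ⟨k, o.2⟩) o.1)
      (fun o => o.2) (fun o => o.1) fun y o => rfl
    refine ((hFall.comp hYall).congr fun y o => rfl).mono (le_of_eq ?_)
    simp
    ring
  · ext a b
    have hsum : (∑ g, c g • (χ g : ℂ) ^ (j : ℕ) • ρ.mat g) a b =
        ∑ k : Fin p, ∑ n : N, (c (x ^ (k : ℕ) * n) • (χ (x ^ (k : ℕ) * n) : ℂ) ^ (j : ℕ) •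
          ρ.mat (x ^ (k : ℕ) * n)) a b := by
      rw [Matrix.sum_apply]
      exact sum_eq_sum_powers hbij fun g => (c g • (χ g : ℂ) ^ (j : ℕ) • ρ.mat g) a b
    rw [hsum]
    simp only [Matrix.of_apply, powerDFT]
    refine Finset.sum_congr rfl fun k _ => ?_
    simp only [Y, hL₀']
    rw [Matrix.mul_sum, Matrix.sum_apply, Finset.mul_sum]
    refine Finset.sum_congr rfl fun n _ => ?_
    rw [map_mul χ, hχN n n.2, mul_one, map_pow χ, Units.val_pow_eq_pow_val, hx, Matrix.mul_smul,
      MonoidHom.comp_apply, Subgroup.coe_subtype, ← map_mul, Matrix.smul_apply, Matrix.smul_apply,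
      Matrix.smul_apply, ← pow_mul, mul_comm (j : ℕ)]
    simp only [smul_eq_mul]
    ring

end Arith

/-! ### The Fourier transform of a solvable group -/

namespace CompleteIrreps

variable {G : Type*} [Group G]

/-- The member `j` is equivalent to the twist of the member `i` by the character `ψ`. -/
def IsTwist (R : CompleteIrreps G) (ψ : G →* ℂˣ) (i j : R.ι) : Prop :=
  Nonempty ((R.ρ j).Equiv ((R.ρ i).twist ψ))

variable (R : CompleteIrreps G) {ψ ψ' : G →* ℂˣ} {i j k : R.ι}

theorem exists_isTwist (ψ : G →* ℂˣ) (i : R.ι) : ∃ j, R.IsTwist ψ i j :=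
  R.complete _ _ ((R.irreducible i).twist ψ)

variable {R}

theorem IsTwist.congr (h : R.IsTwist ψ i j) (hψ : ψ = ψ') : R.IsTwist ψ' i j :=
  hψ ▸ h

theorem IsTwist.trans (h : R.IsTwist ψ i j) (h' : R.IsTwist ψ' j k) : R.IsTwist (ψ * ψ') i k := by
  have h₁ := Representation.nonempty_equiv_twist h ψ'
  rw [Representation.twist_twist] at h₁
  exact ⟨h'.some.trans h₁.some⟩

theorem IsTwist.symm (h : R.IsTwist ψ i j) : R.IsTwist ψ⁻¹ j i := by
  have h₁ := Representation.nonempty_equiv_twist h ψ⁻¹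
  rw [Representation.twist_twist, show ψ * ψ⁻¹ = 1 from mul_inv_cancel ψ,
    Representation.twist_one] at h₁
  exact ⟨h₁.some.symm⟩

theorem IsTwist.dim_eq (h : R.IsTwist ψ i j) : R.dim j = R.dim i := by
  obtain ⟨E, -⟩ := h.some.exists_linearEquiv
  simpa using E.finrank_eq

theorem IsTwist.exists_matrix (h : R.IsTwist ψ i j) :
    ∃ (P : Matrix (Fin (R.dim j)) (Fin (R.dim i)) ℂ)
      (P' : Matrix (Fin (R.dim i)) (Fin (R.dim j)) ℂ),
      ∀ g, R.mat j g = P * ((ψ g : ℂ) • R.mat i g) * P' := by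
  obtain ⟨P, P', -, -, hP⟩ := Representation.exists_matrix_of_equiv h.some.symm
  exact ⟨P, P', fun g => by rw [← Representation.mat_twist]; exact hP g⟩

theorem isTwist_one_refl (i : R.ι) : R.IsTwist 1 i i := by
  rw [IsTwist, Representation.twist_one]
  exact ⟨Representation.Equiv.refl _⟩

/-- The members that are twists of each other by powers of a character `χ` of finite order. -/
def twistSetoid (R : CompleteIrreps G) (χ : G →* ℂˣ) : Setoid R.ι where
  r i j := ∃ k : ℤ, R.IsTwist (χ ^ k) i j
  iseqv :=
    { refl := fun i => ⟨0, (isTwist_one_refl i).congr (zpow_zero χ).symm⟩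
      symm := fun ⟨k, h⟩ => ⟨-k, h.symm.congr (zpow_neg χ k).symm⟩
      trans := fun ⟨k, h⟩ ⟨l, h'⟩ => ⟨k + l, (h.trans h').congr (zpow_add χ k l).symm⟩ }

/-- The member `i` is equivalent to one of its nontrivial twists by the powers of `χ`. -/
def IsTwistFixed (R : CompleteIrreps G) (χ : G →* ℂˣ) (p : ℕ) (i : R.ι) : Prop :=
  ∃ k : ℕ, 0 < k ∧ k < p ∧ R.IsTwist (χ ^ k) i i

theorem IsTwistFixed.of_isTwist {χ : G →* ℂˣ} {p : ℕ} (hi : R.IsTwistFixed χ p i)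
    (h : R.IsTwist ψ i j) : R.IsTwistFixed χ p j := by
  obtain ⟨k, hk, hkp, hki⟩ := hi
  refine ⟨k, hk, hkp, ((h.symm.trans hki).trans h).congr ?_⟩
  ext g
  simp [mul_comm]

end CompleteIrreps

namespace Arith

variable {C τ : ℝ} {G : Type*} [Group G] [Fintype G]

/-- The `p` twists of each representative of a class of twists are different. -/
theorem sum_twist_representatives_le (R : CompleteIrreps G) {χ : G →* ℂˣ} {p : ℕ}
    (Q : Set R.ι) [Fintype Q] (hQ : ∀ q ∈ Q, ¬ R.IsTwistFixed χ p q)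
    (hQ' : ∀ q ∈ Q, ∀ q' ∈ Q, (R.twistSetoid χ).r q q' → q = q')
    (f : ℕ → ℝ) (hf : ∀ d, 0 ≤ f d) :
    ∑ q : Q, (p : ℝ) * f (R.dim q.1) ≤ ∑ i, f (R.dim i) := by
  classical
  choose t ht using fun (y : Q × Fin p) => R.exists_isTwist (χ ^ (y.2 : ℕ)) y.1.1
  have hinj : Function.Injective t := by
    -- equal twists of the same representative would make it fixed
    have hlt : ∀ (q : Q) (k l : Fin p), k < l → t (q, k) ≠ t (q, l) := by
      intro q k l hkl h
      have h₁ := ht (q, l)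
      rw [← h] at h₁
      have h₂ := h₁.trans (ht (q, k)).symm
      refine hQ q.1 q.2 ⟨l - k, by have : (k : ℕ) < l := hkl; omega, by omega, ?_⟩
      exact h₂.congr (pow_sub χ (le_of_lt hkl)).symm
    rintro ⟨q, k⟩ ⟨q', l⟩ h
    have hq : q = q' := by
      refine Subtype.ext (hQ' _ q.2 _ q'.2 ⟨(k : ℕ) + -(l : ℕ), ?_⟩)
      have h₁ := ht (q, k)
      rw [h] at h₁
      refine (h₁.trans (ht (q', l)).symm).congr ?_
      refine ((zpow_add χ k (-(l : ℤ))).trans ?_).symm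
      exact congrArg₂ _ (zpow_natCast χ k)
        ((zpow_neg χ l).trans (congrArg _ (zpow_natCast χ l)))
    subst hq
    rcases lt_trichotomy k l with hkl | rfl | hkl
    · exact absurd h (hlt q k l hkl)
    · rfl
    · exact absurd h.symm (hlt q l k hkl)
  calc ∑ q : Q, (p : ℝ) * f (R.dim q.1) = ∑ y : Q × Fin p, f (R.dim (t y)) := by
        rw [Fintype.sum_prod_type]
        refine Finset.sum_congr rfl fun q _ => ?_
        rw [Finset.sum_congr rfl fun k _ => by rw [(ht (q, k)).dim_eq]]
        simp
    _ = ∑ i ∈ Finset.univ.map ⟨t, hinj⟩, f (R.dim i) := by rw [Finset.sum_map]; rfl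
    _ ≤ ∑ i, f (R.dim i) :=
        Finset.sum_le_sum_of_subset_of_nonneg (Finset.subset_univ _) fun i _ _ => hf _

/-- The elements of a group, as products of powers of an element outside a normal subgroup of prime
index and elements of the subgroup. -/
theorem bijective_pow_mul {N : Subgroup G} [N.Normal] [Fintype N] {p : ℕ} (hp : p.Prime)
    (hN : N.index = p) {x : G} (hx : x ∉ N) :
    Function.Bijective fun y : Fin p × N => x ^ (y.1 : ℕ) * (y.2 : G) := by
  rw [Fintype.bijective_iff_injective_and_card]
  have hxN : (QuotientGroup.mk x : G ⧸ N) ≠ 1 := fun h => hx ((QuotientGroup.eq_one_iff x).1 h)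
  have hord : orderOf (QuotientGroup.mk x : G ⧸ N) = p := by
    have hdvd : orderOf (QuotientGroup.mk x : G ⧸ N) ∣ p := by
      rw [← hN, Subgroup.index]
      exact orderOf_dvd_natCard _
    exact (hp.eq_one_or_self_of_dvd _ hdvd).resolve_left fun h => hxN (orderOf_eq_one_iff.1 h)
  constructor
  · rintro ⟨k, n⟩ ⟨l, n'⟩ h
    simp only at h
    have h₁ := congrArg (QuotientGroup.mk : G → G ⧸ N) h
    simp only [QuotientGroup.mk_mul, QuotientGroup.mk_pow,
      (QuotientGroup.eq_one_iff (N := N) (n : G)).2 n.2,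
      (QuotientGroup.eq_one_iff (N := N) (n' : G)).2 n'.2, mul_one] at h₁
    have hkl : (k : ℕ) = l := pow_injOn_Iio_orderOf (by rw [hord]; exact k.2)
      (by rw [hord]; exact l.2) h₁
    rw [hkl] at h
    exact Prod.ext (Fin.ext hkl) (Subtype.ext (mul_left_cancel h))
  · rw [Fintype.card_prod, Fintype.card_fin, ← hN, ← Nat.card_eq_fintype_card,
      ← Nat.card_eq_fintype_card, N.index_mul_card]

/-- A faithful character of the quotient by a normal subgroup of prime index. -/
theorem exists_character {N : Subgroup G} [N.Normal] {p : ℕ} (hp : p.Prime)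
    (hN : N.index = p) {x : G} (hx : x ∉ N) :
    ∃ χ : G →* ℂˣ, (∀ n ∈ N, χ n = 1) ∧ IsPrimitiveRoot (χ x : ℂ) p := by
  have hcard : Nat.card (G ⧸ N) = p := hN
  have : Fact p.Prime := ⟨hp⟩
  have hcyc : IsCyclic (G ⧸ N) := isCyclic_of_prime_card hcard
  let _ : CommGroup (G ⧸ N) := IsCyclic.commGroup
  have hxN : (QuotientGroup.mk x : G ⧸ N) ≠ 1 := fun h => hx ((QuotientGroup.eq_one_iff x).1 h)
  obtain ⟨φ, hφ⟩ := CommGroup.exists_apply_ne_one_of_hasEnoughRootsOfUnity (G ⧸ N) ℂ hxN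
  let φ' : G ⧸ N →* ℂˣ := φ
  refine ⟨φ'.comp (QuotientGroup.mk' N), fun n hn => ?_, ?_⟩
  · rw [MonoidHom.comp_apply, QuotientGroup.mk'_apply, (QuotientGroup.eq_one_iff n).2 hn, map_one]
  · have h1 : (φ' (QuotientGroup.mk x) : ℂ) ^ p = 1 := by
      rw [← Units.val_pow_eq_pow_val, ← map_pow, ← hcard, pow_card_eq_one', map_one, Units.val_one]
    have h2 : (φ' (QuotientGroup.mk x) : ℂ) ≠ 1 := fun h => hφ (Units.ext h)
    have := orderOf_eq_prime h1 h2
    rw [MonoidHom.comp_apply, QuotientGroup.mk'_apply]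
    exact this ▸ IsPrimitiveRoot.orderOf _

/-- The Fourier transform of a group from those of a normal subgroup `N` of prime index `p`,
applied to the restrictions to the cosets of `N`. Of each class of `p` different twists, one
member is evaluated on every coset and a cyclic Fourier transform yields the class; the members
that are equivalent to their twists are treated one by one. -/
theorem hasCircuit_dft_of_prime_index (hM : MulBound C τ) (hτ : 2 ≤ τ) {N : Subgroup G}
    [N.Normal] [Fintype N] {p : ℕ} (hp : p.Prime) (hN : N.index = p) {T : ℝ}
    (hT : ∀ ζ : ℂ, ζ ≠ 0 → HasCircuit (powerDFT p ζ) T) {b : ℝ}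
    (hb : ∀ RN : CompleteIrreps N, HasCircuit RN.dft b) (R : CompleteIrreps G) :
    HasCircuit R.dft (p * b + 8 * C * (Fintype.card G : ℝ) ^ (τ / 2) +
      (Fintype.card G : ℝ) / p * T) := by
  classical
  have : NeZero p := ⟨hp.ne_zero⟩
  have hT0 : 0 ≤ T := (hT 1 one_ne_zero).nonneg
  have hC := hM.nonneg
  obtain ⟨x, hx⟩ : ∃ x, x ∉ N := by
    by_contra! h
    have : N = ⊤ := (Subgroup.eq_top_iff' N).2 h
    rw [this, Subgroup.index_top] at hN
    exact hp.one_lt.ne hN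
  have hbij := bijective_pow_mul hp hN hx
  obtain ⟨χ, hχN, hζ⟩ := exists_character hp hN hx
  have hχp : χ ^ p = 1 := by
    ext g
    obtain ⟨⟨k, n⟩, rfl⟩ := hbij.2 g
    have h1 : χ x ^ p = 1 := Units.ext (by simpa using hζ.pow_eq_one)
    simp only [MonoidHom.pow_apply, map_mul, map_pow, hχN n n.2, one_pow, mul_one,
      MonoidHom.one_apply]
    rw [h1, one_pow]
  obtain ⟨RN⟩ := CompleteIrreps.nonempty_completeIrreps (G := N)
  -- the transforms of the restrictions to the cosets
  let s₁ : (G → ℂ) → Fin p × RN.Entry → ℂ := fun c y =>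
    RN.dft (fun n => c (x ^ (y.1 : ℕ) * n)) y.2
  have hs₁ : HasCircuit s₁ (p * b) := by
    refine (hasCircuit_of_fibers (F := s₁)
      (fun k : Fin p => (hb RN).precomp fun n : N => x ^ (k : ℕ) * n)
      (fun y => y.1) (fun y => y.2) fun c y => rfl).mono (le_of_eq ?_)
    simp
  -- one representative of each free class of twists
  let r : R.ι → R.ι := fun i => (Quotient.mk (R.twistSetoid χ) i).out
  have hr : ∀ i, (R.twistSetoid χ).r (r i) i := fun i =>
    Quotient.mk_out (s := R.twistSetoid χ) i
  let Q : Set R.ι := {q | ¬ R.IsTwistFixed χ p q ∧ r q = q}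
  have hQ' : ∀ q ∈ Q, ∀ q' ∈ Q, (R.twistSetoid χ).r q q' → q = q' := by
    intro q hq q' hq' h
    rw [← hq.2, ← hq'.2]
    exact congrArg Quotient.out (Quotient.sound (s := R.twistSetoid χ) h)
  choose L₂ hL₂ hL₂' using fun q : Q => exists_circuit_twists hM RN hbij hχN rfl (R.ρ q.1)
    (hT (χ x) (Units.ne_zero _))
  let J := Σ q : Q, Fin p × (Fin (R.dim q.1) × Fin (R.dim q.1))
  let s₂ : (Fin p × RN.Entry → ℂ) → J → ℂ := fun y o => L₂ o.1 y o.2.1 o.2.2.1 o.2.2.2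
  have hs₂ : HasCircuit s₂
      (∑ q : Q, (3 * C * (p * (R.dim q.1 : ℝ) ^ τ) + (R.dim q.1 : ℝ) ^ 2 * T)) :=
    hasCircuit_sigma hL₂
  have key : ∀ i, ∃ L : ((Fin p × RN.Entry) ⊕ J → ℂ) → Matrix (Fin (R.dim i)) (Fin (R.dim i)) ℂ,
      HasMatCircuit L (5 * C * (R.dim i : ℝ) ^ τ) ∧
        ∀ c, L (Sum.elim (s₁ c) (s₂ (s₁ c))) = ∑ g, c g • R.mat i g := by
    intro i
    have hpow : 0 ≤ C * (R.dim i : ℝ) ^ τ := by positivity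
    by_cases hi : R.IsTwistFixed χ p i
    · obtain ⟨k, hk, hkp, hki⟩ := hi
      have hζk : IsPrimitiveRoot ((χ x : ℂ) ^ k) p :=
        hζ.pow_of_coprime k ((Nat.coprime_of_lt_prime hk.ne' hkp hp).symm)
      obtain ⟨L, hL, hL'⟩ := exists_circuit_of_equiv_twist hM hτ RN hbij (χ := χ ^ k)
        (fun n hn => by rw [MonoidHom.pow_apply, hχN n hn, one_pow]) hζk (by simp)
        (R.irreducible i) hki
      exact ⟨fun y => L fun o => y (.inl o), HasCircuit.precomp hL Sum.inl, fun c => hL' c⟩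
    · obtain ⟨k, hk⟩ := hr i
      have hrQ : r i ∈ Q := by
        refine ⟨fun h => hi (h.of_isTwist hk), ?_⟩
        have : Quotient.mk (R.twistSetoid χ) (r i) = Quotient.mk (R.twistSetoid χ) i :=
          Quotient.sound (s := R.twistSetoid χ) (hr i)
        exact congrArg Quotient.out this
      -- the exponent may be taken between `0` and `p - 1`
      obtain ⟨l, hl⟩ : ∃ l : Fin p, χ ^ k = χ ^ (l : ℕ) := by
        have hp0 : (p : ℤ) ≠ 0 := by exact_mod_cast hp.ne_zero
        have h₀ := Int.emod_nonneg k hp0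
        have h₁ := Int.emod_lt_of_pos k (b := (p : ℤ)) (by exact_mod_cast hp.pos)
        refine ⟨⟨(k % p).toNat, by omega⟩, ?_⟩
        have e : χ ^ k = χ ^ (k % p) * χ ^ (p * (k / p)) := by
          conv_lhs => rw [← Int.emod_add_mul_ediv k p]
          exact zpow_add χ _ _
        have e₁ : χ ^ ((p : ℤ) * (k / p)) = 1 := by
          refine (zpow_mul χ _ _).trans ?_
          rw [show χ ^ (p : ℤ) = 1 from (zpow_natCast χ p).trans hχp]
          exact one_zpow (α := G →* ℂˣ) _
        have e₂ : χ ^ (k % p) = χ ^ (k % p).toNat := by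
          conv_lhs => rw [← Int.toNat_of_nonneg h₀]
          exact zpow_natCast χ _
        rw [e, e₁, e₂]
        exact mul_one (χ ^ (k % p).toNat)
      rw [hl] at hk
      obtain ⟨P, P', hP⟩ := hk.exists_matrix
      have hd : Fintype.card (Fin (R.dim (r i))) ≤ R.dim i := by
        rw [Fintype.card_fin, hk.dim_eq]
      refine ⟨fun y => P * (Matrix.of fun a b => y (.inr ⟨⟨r i, hrQ⟩, (l, (a, b))⟩)) * P',
        ?_, fun c => ?_⟩
      · refine (HasMatCircuit.const_mul_mul_const hM (a := 0) ?_ P P' (R.dim i) hd (by simp)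
          (by simp)).mono (by linarith)
        exact hasCircuit_reindex fun o : Fin (R.dim (r i)) × Fin (R.dim (r i)) =>
          (Sum.inr ⟨⟨r i, hrQ⟩, (l, (o.1, o.2))⟩ : (Fin p × RN.Entry) ⊕ J)
      · have h₁ : (Matrix.of fun a b => Sum.elim (s₁ c) (s₂ (s₁ c))
            (.inr ⟨⟨r i, hrQ⟩, (l, (a, b))⟩)) = L₂ ⟨r i, hrQ⟩ (s₁ c) l := rfl
        simp only [h₁]
        rw [hL₂' ⟨r i, hrQ⟩ c l]
        simp only [Matrix.mul_sum, Matrix.sum_mul]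
        refine Finset.sum_congr rfl fun g _ => ?_
        rw [Matrix.mul_smul, Matrix.smul_mul, hP g]
        simp
  choose L₃ hL₃ hL₃' using key
  have hfin := hasCircuit_of_fibers (F := fun (y : (Fin p × RN.Entry) ⊕ J → ℂ) (e : R.Entry) =>
    L₃ e.1 y e.2.1 e.2.2) hL₃ (fun e => e.1) (fun e => e.2) fun y e => rfl
  refine ((hfin.comp (hs₂.keep.comp hs₁)).congr fun c e => ?_).mono ?_
  · simp only [hL₃', CompleteIrreps.dft_apply]
  · have hS := sum_dim_rpow_le R hτ
    have hsq : (∑ i, (R.dim i : ℝ) ^ 2) ≤ Fintype.card G := by exact_mod_cast R.sum_dim_sq_le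
    have h₁ := sum_twist_representatives_le R Q (fun q hq => hq.1) hQ' (fun d => (d : ℝ) ^ τ)
      fun d => by positivity
    have h₂ := sum_twist_representatives_le R Q (fun q hq => hq.1) hQ' (fun d => (d : ℝ) ^ 2)
      fun d => by positivity
    rw [Finset.sum_add_distrib, ← Finset.mul_sum, ← Finset.sum_mul, ← Finset.mul_sum Finset.univ
      (fun i => (R.dim i : ℝ) ^ τ)]
    rw [← Finset.mul_sum] at h₂
    have hp0 : (0 : ℝ) < p := by exact_mod_cast hp.pos
    have h₃ : (∑ q : Q, (R.dim q.1 : ℝ) ^ 2) ≤ (Fintype.card G : ℝ) / p := by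
      rw [le_div_iff₀ hp0]
      linarith
    have h₄ := mul_le_mul_of_nonneg_right h₃ hT0
    have h₅ := mul_le_mul_of_nonneg_left (h₁.trans hS) (show 0 ≤ 3 * C by positivity)
    have h₆ := mul_le_mul_of_nonneg_left hS (show 0 ≤ 5 * C by positivity)
    linarith

end Arith

namespace Arith

variable {C τ : ℝ}

theorem hasCircuit_dft_naive {G : Type*} [Group G] [Fintype G] (R : CompleteIrreps G) :
    HasCircuit R.dft (2 * (Fintype.card G) ^ 2) := by
  have hcard : Fintype.card R.Entry ≤ Fintype.card G := by
    refine le_trans (le_of_eq ?_) R.sum_dim_sq_le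
    simp [CompleteIrreps.Entry, Fintype.card_sigma, sq]
  refine ((hasCircuit_linear fun (e : R.Entry) (g : G) => R.mat e.1 g e.2.1 e.2.2).congr
    fun c e => ?_).mono ?_
  · rw [CompleteIrreps.dft_apply, Matrix.sum_apply]
    refine Finset.sum_congr rfl fun g _ => ?_
    rw [Matrix.smul_apply, smul_eq_mul, mul_comm]
  · have : (Fintype.card R.Entry : ℝ) ≤ Fintype.card G := by exact_mod_cast hcard
    have h0 : (0 : ℝ) ≤ Fintype.card G := Nat.cast_nonneg _
    nlinarith

theorem exists_normal_prime_index {G : Type*} [Group G] [Finite G] [Group.IsSolvable G]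
    [Nontrivial G] :
    ∃ N : Subgroup G, N.Normal ∧ N.index.Prime := by
  obtain ⟨N, hN, hle⟩ := (eq_top_or_exists_le_coatom (commutator G)).resolve_left
    (Group.IsSolvable.commutator_lt_top_of_nontrivial G).ne
  have hnormal : N.Normal := Subgroup.Normal.of_commutator_le G hle
  refine ⟨N, hnormal, ?_⟩
  have hne : N.index ≠ 1 := fun h => hN.1 (Subgroup.index_eq_one.1 h)
  obtain ⟨p, hp, hpd⟩ := Nat.exists_prime_and_dvd hne
  have : Fact p.Prime := ⟨hp⟩
  obtain ⟨y, hy⟩ := exists_prime_orderOf_dvd_card' (G := G ⧸ N) p hpd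
  have hlt : N < (Subgroup.zpowers y).comap (QuotientGroup.mk' N) := by
    refine lt_of_le_of_ne (fun n hn => ?_) fun h => ?_
    · rw [Subgroup.mem_comap, QuotientGroup.mk'_apply, (QuotientGroup.eq_one_iff n).2 hn]
      exact one_mem _
    · obtain ⟨g, rfl⟩ := QuotientGroup.mk'_surjective N y
      have hg : g ∈ N := by
        rw [h, Subgroup.mem_comap]
        exact Subgroup.mem_zpowers _
      rw [QuotientGroup.mk'_apply, (QuotientGroup.eq_one_iff g).2 hg, orderOf_one] at hy
      exact hp.one_lt.ne hy
  have htop : Subgroup.zpowers y = ⊤ := by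
    rw [Subgroup.eq_top_iff']
    intro z
    obtain ⟨g, rfl⟩ := QuotientGroup.mk'_surjective N z
    have : g ∈ (Subgroup.zpowers y).comap (QuotientGroup.mk' N) := by
      rw [hN.2 _ hlt]
      trivial
    exact this
  have hcard : N.index = p := by
    rw [← hy, ← Nat.card_zpowers, htop, Subgroup.index, Subgroup.card_top]
  rwa [hcard]

/-- One step of the recursion along a normal series with factors of prime order `p`: the
transforms of the `p` cosets of a subgroup of order `n`, and the work to combine them. -/
theorem recursion_step {a D : ℝ} (ha : 1 ≤ a) (hD : 0 ≤ D) {p n : ℕ} (hp : 2 ≤ p) (hn : 1 ≤ n)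
    {E T : ℝ} (hE : E ≤ D * ((p * n : ℕ) : ℝ) ^ a) (hT : n * T ≤ D * ((p * n : ℕ) : ℝ) ^ a) :
    p * (2 * D * (n : ℝ) ^ a * (1 + Real.logb 2 n)) + E + n * T ≤
      2 * D * ((p * n : ℕ) : ℝ) ^ a * (1 + Real.logb 2 ((p * n : ℕ) : ℝ)) := by
  have hp' : (2 : ℝ) ≤ p := by exact_mod_cast hp
  have hn' : (1 : ℝ) ≤ n := by exact_mod_cast hn
  have h₁ : (p : ℝ) * (n : ℝ) ^ a ≤ ((p * n : ℕ) : ℝ) ^ a := by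
    push_cast
    rw [Real.mul_rpow (by positivity) (by positivity)]
    gcongr
    exact Real.self_le_rpow_of_one_le (by linarith) ha
  have h₂ : Real.logb 2 ((p * n : ℕ) : ℝ) = Real.logb 2 p + Real.logb 2 n := by
    push_cast
    exact Real.logb_mul (by positivity) (by positivity)
  have h₃ : 1 ≤ Real.logb 2 p := by
    rw [Real.le_logb_iff_rpow_le (by norm_num) (by positivity)]
    simpa using hp'
  have h₄ : 0 ≤ Real.logb 2 n := Real.logb_nonneg (by norm_num) hn'
  rw [h₂]
  have h₅ : 2 * D * ((p : ℝ) * (n : ℝ) ^ a) * (1 + Real.logb 2 n) ≤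
      2 * D * ((p * n : ℕ) : ℝ) ^ a * (1 + Real.logb 2 n) := by
    gcongr
  have h₆ : 0 ≤ 2 * D * ((p * n : ℕ) : ℝ) ^ a := by positivity
  nlinarith

/-- The Fourier transform of a solvable group, by recursion along a composition series. -/
theorem exists_hasCircuit_dft_of_isSolvable (hM : MulBound C τ) (hτ : 2 < τ) :
    ∃ D : ℝ, 0 ≤ D ∧ ∀ (G : Type*) [Group G] [Fintype G] [Group.IsSolvable G]
      (R : CompleteIrreps G),
      HasCircuit R.dft
        (D * (Fintype.card G : ℝ) ^ (τ / 2) * (1 + Real.logb 2 (Fintype.card G))) := by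
  obtain ⟨C₁, hC₁, hT⟩ := exists_hasCircuit_powerDFT (show 0 < τ / 2 - 1 by linarith)
  have hC := hM.nonneg
  refine ⟨2 * (8 * C + C₁ + 1), by positivity, ?_⟩
  intro G _ _ _ R
  obtain ⟨n, hn⟩ : ∃ n, Fintype.card G = n := ⟨_, rfl⟩
  induction n using Nat.strong_induction_on generalizing G with
  | _ n ih =>
  classical
  rcases subsingleton_or_nontrivial G with hG | hG
  · have h1 : Fintype.card G = 1 := by
      have := Fintype.card_le_one_iff_subsingleton.2 hG
      have := Fintype.card_pos (α := G)
      omega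
    refine (hasCircuit_dft_naive R).mono ?_
    rw [h1]
    simp
    linarith
  · obtain ⟨N, hN, hp⟩ := exists_normal_prime_index (G := G)
    have hmul : Fintype.card G = N.index * Fintype.card N := by
      rw [← Nat.card_eq_fintype_card, ← Nat.card_eq_fintype_card, N.index_mul_card]
    have hNpos : 0 < Fintype.card N := Fintype.card_pos
    have hlt : Fintype.card N < n := by
      rw [← hn, hmul]
      exact lt_mul_of_one_lt_left hNpos hp.one_lt
    have hb := fun RN : CompleteIrreps N => ih _ hlt N RN rfl
    refine (hasCircuit_dft_of_prime_index hM hτ.le hp rfl (fun ζ hζ => hT N.index ζ hζ) hb R).mono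
      ?_
    have hp0 : (0 : ℝ) < N.index := by exact_mod_cast hp.pos
    have hdiv : (Fintype.card G : ℝ) / N.index = Fintype.card N := by
      rw [hmul, Nat.cast_mul, mul_div_cancel_left₀ _ hp0.ne']
    rw [hdiv, hmul]
    have hnn : (0 : ℝ) ≤ ((N.index * Fintype.card N : ℕ) : ℝ) ^ (τ / 2) := by positivity
    refine recursion_step (by linarith) (by positivity) hp.two_le hNpos ?_ ?_
    · gcongr
      linarith
    · have h₁ : (Fintype.card N : ℝ) ≤ (Fintype.card N : ℝ) ^ (τ / 2) :=
        Real.self_le_rpow_of_one_le (by exact_mod_cast hNpos) (by linarith)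
      have h₂ : ((N.index * Fintype.card N : ℕ) : ℝ) ^ (τ / 2) =
          (N.index : ℝ) ^ (τ / 2) * (Fintype.card N : ℝ) ^ (τ / 2) := by
        push_cast
        exact Real.mul_rpow (by positivity) (by positivity)
      have h₃ : 1 + (τ / 2 - 1) = τ / 2 := by ring
      rw [h₃]
      calc (Fintype.card N : ℝ) * (C₁ * (N.index : ℝ) ^ (τ / 2))
          ≤ (Fintype.card N : ℝ) ^ (τ / 2) * (C₁ * (N.index : ℝ) ^ (τ / 2)) := by gcongr
        _ = C₁ * ((N.index * Fintype.card N : ℕ) : ℝ) ^ (τ / 2) := by rw [h₂]; ring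
        _ ≤ _ := by
            gcongr
            linarith

/-- The logarithm in the bound for solvable groups, absorbed by the exponent. -/
theorem exists_hasCircuit_dft_of_isSolvable' (hM : MulBound C τ) (hτ : 2 < τ) {a : ℝ}
    (ha : τ / 2 < a) :
    ∃ D : ℝ, 0 ≤ D ∧ ∀ (G : Type*) [Group G] [Fintype G] [Group.IsSolvable G]
      (R : CompleteIrreps G),
      HasCircuit R.dft (D * (Fintype.card G : ℝ) ^ a) := by
  obtain ⟨D, hD, h⟩ := exists_hasCircuit_dft_of_isSolvable hM hτ
  have hδ : 0 < a - τ / 2 := by linarith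
  refine ⟨D * (1 + 2 / (a - τ / 2)), by positivity, ?_⟩
  intro G _ _ _ R
  refine (h G R).mono ?_
  have hG : (1 : ℝ) ≤ Fintype.card G := by exact_mod_cast Fintype.card_pos (α := G)
  have hG0 : (0 : ℝ) < Fintype.card G := by linarith
  have h₁ : Real.log (Fintype.card G) ≤
      (Fintype.card G : ℝ) ^ (a - τ / 2) / (a - τ / 2) := Real.log_le_rpow_div hG0.le hδ
  have h2 : (1 / 2 : ℝ) ≤ Real.log 2 := by linarith [Real.log_two_gt_d9]
  have h₂ : Real.logb 2 (Fintype.card G) ≤ 2 * Real.log (Fintype.card G) := by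
    rw [Real.logb, div_le_iff₀ (by linarith)]
    nlinarith [Real.log_nonneg hG]
  have h₃ : (1 : ℝ) ≤ (Fintype.card G : ℝ) ^ (a - τ / 2) := Real.one_le_rpow hG hδ.le
  have h₄ : 1 + Real.logb 2 (Fintype.card G) ≤
      (1 + 2 / (a - τ / 2)) * (Fintype.card G : ℝ) ^ (a - τ / 2) := by
    have : 2 * ((Fintype.card G : ℝ) ^ (a - τ / 2) / (a - τ / 2)) =
      2 / (a - τ / 2) * (Fintype.card G : ℝ) ^ (a - τ / 2) := by ring
    nlinarith
  calc D * (Fintype.card G : ℝ) ^ (τ / 2) * (1 + Real.logb 2 (Fintype.card G))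
      ≤ D * (Fintype.card G : ℝ) ^ (τ / 2) *
        ((1 + 2 / (a - τ / 2)) * (Fintype.card G : ℝ) ^ (a - τ / 2)) := by gcongr
    _ = D * (1 + 2 / (a - τ / 2)) *
        ((Fintype.card G : ℝ) ^ (τ / 2) * (Fintype.card G : ℝ) ^ (a - τ / 2)) := by ring
    _ = _ := by
        rw [← Real.rpow_add hG0]
        congr 2
        ring

end Arith

/-! ### Products of two subgroups -/

namespace Arith

variable {C τ : ℝ}

/-- The Fourier transform over a product of two groups, first in one variable, then in the other. -/
theorem hasCircuit_dft_dft {H K : Type*} [Group H] [Fintype H] [Group K] [Fintype K]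
    (RH : CompleteIrreps H) (RK : CompleteIrreps K) {bH bK : ℝ} (hH : HasCircuit RH.dft bH)
    (hK : HasCircuit RK.dft bK) :
    HasCircuit (fun (β : H × K → ℂ) (e : RH.Entry × RK.Entry) =>
      ∑ y : H × K, β y * (RH.mat e.1.1 y.1 e.1.2.1 e.1.2.2 * RK.mat e.2.1 y.2 e.2.2.1 e.2.2.2))
      (Fintype.card H * bK + Fintype.card K * bH) := by
  have h₁ := hasCircuit_of_fibers
    (F := fun (β : H × K → ℂ) (o : H × RK.Entry) => RK.dft (fun k => β (o.1, k)) o.2)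
    (fun h : H => hK.precomp fun k => (h, k)) (fun o => o.1) (fun o => o.2) fun y o => rfl
  have h₂ := hasCircuit_of_fibers
    (F := fun (z : H × RK.Entry → ℂ) (e : RH.Entry × RK.Entry) =>
      RH.dft (fun h => z (h, e.2)) e.1)
    (fun e : RK.Entry => hH.precomp fun h => (h, e)) (fun e => e.2) (fun e => e.1) fun y o => rfl
  have hcard : (Fintype.card RK.Entry : ℝ) ≤ Fintype.card K := by
    have : Fintype.card RK.Entry ≤ Fintype.card K := by
      refine le_trans (le_of_eq ?_) RK.sum_dim_sq_le
      simp [CompleteIrreps.Entry, Fintype.card_sigma, sq]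
    exact_mod_cast this
  refine ((h₂.comp h₁).congr fun β e => ?_).mono ?_
  · simp only [CompleteIrreps.dft_apply, Matrix.sum_apply, Matrix.smul_apply, smul_eq_mul]
    rw [Fintype.sum_prod_type]
    refine Finset.sum_congr rfl fun h _ => ?_
    rw [Finset.sum_mul]
    refine Finset.sum_congr rfl fun k _ => ?_
    ring
  · simp only [Finset.sum_const, Finset.card_univ, nsmul_eq_mul]
    have := mul_le_mul_of_nonneg_right hcard hH.nonneg
    linarith

/-- The cost of one rectangular product, in terms of the number of its entries. -/
theorem wide_product_cost_le (hM : MulBound C τ) (hτ : 2 ≤ τ) {D N g : ℕ} (hD : 0 < D)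
    (hg : D ^ 2 ≤ g) :
    ((N : ℝ) / D + 1) * (C * (D : ℝ) ^ τ) ≤
      C * (g : ℝ) ^ ((τ - 2) / 2) * (N * D + (D : ℝ) ^ 2) := by
  have h := natCast_rpow_le_sq_mul hτ hg
  have hD' : (0 : ℝ) < D := by exact_mod_cast hD
  have hC := hM.nonneg
  calc ((N : ℝ) / D + 1) * (C * (D : ℝ) ^ τ)
      ≤ ((N : ℝ) / D + 1) * (C * ((D : ℝ) ^ 2 * (g : ℝ) ^ ((τ - 2) / 2))) := by gcongr
    _ = _ := by
        field_simp

/-- The sum of `β (h, k) • (ρ h * ρ x * ρ k)`, for all irreducible `ρ`. In bases adapted to `H` on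
the left and to `K` on the right, the blocks for irreducible representations `σ` of `H` and `θ` of
`K` are the columns of the product of one square matrix of size `dim σ * dim θ`, which depends on
`β` only, and the matrix whose columns are the corresponding blocks of the various `ρ x`. -/
theorem hasCircuit_two_subgroups (hM : MulBound C τ) (hτ : 2 ≤ τ) {G : Type*} [Group G] [Fintype G]
    (R : CompleteIrreps G) {H K : Subgroup G} [Fintype H] [Fintype K]
    (hHK : Fintype.card H * Fintype.card K ≤ Fintype.card G) (x : G) {bH bK : ℝ}
    (hH : ∀ RH : CompleteIrreps H, HasCircuit RH.dft bH)
    (hK : ∀ RK : CompleteIrreps K, HasCircuit RK.dft bK) :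
    HasCircuit (fun (β : H × K → ℂ) (e : R.Entry) =>
      (∑ y : H × K, β y • R.mat e.1 (y.1 * x * y.2)) e.2.1 e.2.2)
      (Fintype.card H * bK + Fintype.card K * bH +
        4 * C * (Fintype.card G : ℝ) ^ (τ / 2)) := by
  classical
  have hC := hM.nonneg
  obtain ⟨RH⟩ := CompleteIrreps.nonempty_completeIrreps (G := H)
  obtain ⟨RK⟩ := CompleteIrreps.nonempty_completeIrreps (G := K)
  choose A _ _ f P P' hPcard hP using fun i => RH.exists_blockDiagonal ((R.mat i).comp H.subtype)
  choose B _ _ g Q Q' hQcard hQ using fun i => RK.exists_blockDiagonal ((R.mat i).comp K.subtype)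
  let M : ∀ i, Matrix (Σ a, Fin (RH.dim (f i a))) (Σ b, Fin (RK.dim (g i b))) ℂ := fun i =>
    P' i * R.mat i x * Q i
  -- `J s` lists the blocks of type `s`, which are the columns of `X s`
  let Col := Σ i, A i × B i
  let J : RH.ι × RK.ι → Type := fun s => {c : Col // (f c.1 c.2.1, g c.1 c.2.2) = s}
  let n : RH.ι × RK.ι → Type := fun s => Fin (RH.dim s.1) × Fin (RK.dim s.2)
  have hf : ∀ {s : RH.ι × RK.ι} (c : J s), RH.dim s.1 = RH.dim (f c.1.1 c.1.2.1) := fun c =>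
    congrArg (fun s => RH.dim s.1) c.2.symm
  have hg : ∀ {s : RH.ι × RK.ι} (c : J s), RK.dim s.2 = RK.dim (g c.1.1 c.1.2.2) := fun c =>
    congrArg (fun s => RK.dim s.2) c.2.symm
  let X : ∀ s : RH.ι × RK.ι, Matrix (n s) (J s) ℂ := fun s => Matrix.of fun q c =>
    M c.1.1 ⟨c.1.2.1, Fin.cast (hf c) q.1⟩ ⟨c.1.2.2, Fin.cast (hg c) q.2⟩
  let F : ∀ s : RH.ι × RK.ι, (RH.Entry × RK.Entry → ℂ) → Matrix (n s) (n s) ℂ := fun s z =>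
    Matrix.of fun q q' => z (⟨s.1, (q.1, q'.1)⟩, ⟨s.2, (q'.2, q.2)⟩)
  have hD : ∀ s : RH.ι × RK.ι, 0 < RH.dim s.1 * RK.dim s.2 := fun s =>
    Nat.mul_pos (RH.dim_pos _) (RK.dim_pos _)
  have hcardn : ∀ s : RH.ι × RK.ι, Fintype.card (n s) = RH.dim s.1 * RK.dim s.2 := fun s => by
    simp [n]
  have hFX : ∀ s : RH.ι × RK.ι, HasCircuit (fun (z : RH.Entry × RK.Entry → ℂ) (o : n s × J s) =>
      (F s z * X s) o.1 o.2) (((Fintype.card (J s) : ℝ) / (RH.dim s.1 * RK.dim s.2 : ℕ) + 1) *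
        (C * ((RH.dim s.1 * RK.dim s.2 : ℕ) : ℝ) ^ τ)) := by
    intro s
    have : Nonempty (n s) := Fintype.card_pos_iff.1 (by rw [hcardn]; exact hD s)
    have hF : HasMatCircuit (F s) 0 := hasCircuit_reindex (I := RH.Entry × RK.Entry)
      fun o : n s × n s =>
        ((⟨s.1, (o.1.1, o.2.1)⟩, ⟨s.2, (o.2.2, o.1.2)⟩) : RH.Entry × RK.Entry)
    have h := hF.mul_wide hM (X s)
    rw [hcardn, zero_add] at h
    exact h
  -- the transform over `H × K` provides the entries of all the matrices `F s`
  have hz := hasCircuit_dft_dft RH RK (hH RH) (hK RK)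
  let W : ∀ i, (RH.Entry × RK.Entry → ℂ) →
      Matrix (Σ a, Fin (RH.dim (f i a))) (Σ b, Fin (RK.dim (g i b))) ℂ := fun i z =>
    Matrix.of fun p q => (F (f i p.1, g i q.1) z * X (f i p.1, g i q.1)) (p.2, q.2)
      ⟨⟨i, (p.1, q.1)⟩, rfl⟩
  let O := Σ i, (Σ a, Fin (RH.dim (f i a))) × (Σ b, Fin (RK.dim (g i b)))
  have hW := hasCircuit_of_fibers
    (F := fun (z : RH.Entry × RK.Entry → ℂ) (o : O) => W o.1 z o.2.1 o.2.2) hFX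
    (fun o => (f o.1 o.2.1.1, g o.1 o.2.2.1))
    (fun o => ((o.2.1.2, o.2.2.2), ⟨⟨o.1, (o.2.1.1, o.2.2.1)⟩, rfl⟩)) fun z o => rfl
  have hcA : ∀ i, Fintype.card (Σ a, Fin (RH.dim (f i a))) = R.dim i := fun i => by
    rw [Fintype.card_sigma]
    simpa using hPcard i
  have hcB : ∀ i, Fintype.card (Σ b, Fin (RK.dim (g i b))) = R.dim i := fun i => by
    rw [Fintype.card_sigma]
    simpa using hQcard i
  have hconj : ∀ i, HasCircuit (fun (w : O → ℂ) (q : Fin (R.dim i) × Fin (R.dim i)) =>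
      (P i * (Matrix.of fun p q => w ⟨i, (p, q)⟩) * Q' i) q.1 q.2)
      (2 * C * (R.dim i : ℝ) ^ τ) := by
    intro i
    have h₁ : HasMatCircuit (fun w : O → ℂ => Matrix.of fun p q => w ⟨i, (p, q)⟩) 0 :=
      hasCircuit_reindex fun o : (Σ a, Fin (RH.dim (f i a))) × (Σ b, Fin (RK.dim (g i b))) =>
        (⟨i, (o.1, o.2)⟩ : O)
    have h₂ := ((hasMatCircuit_const (P i)).mul hM h₁ (R.dim i) (by simp) (hcA i).le
      (hcB i).le).mul hM (hasMatCircuit_const (Q' i)) (R.dim i) (by simp) (hcB i).le (by simp)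
    exact HasCircuit.mono h₂ (le_of_eq (by ring))
  have hfin := hasCircuit_of_fibers
    (F := fun (w : O → ℂ) (e : R.Entry) =>
      (P e.1 * (Matrix.of fun p q => w ⟨e.1, (p, q)⟩) * Q' e.1) e.2.1 e.2.2) hconj
    (fun e => e.1) (fun e => e.2) fun w e => rfl
  refine ((hfin.comp (hW.comp hz)).congr fun β e => ?_).mono ?_
  · obtain ⟨i, r, s⟩ := e
    have hblock : (W i fun e : RH.Entry × RK.Entry => ∑ y : H × K, β y *
        (RH.mat e.1.1 y.1 e.1.2.1 e.1.2.2 * RK.mat e.2.1 y.2 e.2.2.1 e.2.2.2)) =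
        ∑ y : H × K, β y • (Matrix.blockDiagonal' (fun a => RH.mat (f i a) y.1) * M i *
          Matrix.blockDiagonal' (fun b => RK.mat (g i b) y.2)) := by
      ext ⟨a, p⟩ ⟨b, q⟩
      have hentry : ∀ y : H × K, (Matrix.blockDiagonal' (fun a => RH.mat (f i a) y.1) * M i *
          Matrix.blockDiagonal' (fun b => RK.mat (g i b) y.2)) ⟨a, p⟩ ⟨b, q⟩ =
          ∑ p', ∑ q', RH.mat (f i a) y.1 p p' * M i ⟨a, p'⟩ ⟨b, q'⟩ * RK.mat (g i b) y.2 q' q := by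
        intro y
        rw [Matrix.mul_apply, Fintype.sum_sigma, Finset.sum_eq_single b]
        · rw [Finset.sum_comm]
          refine Finset.sum_congr rfl fun q' _ => ?_
          rw [Matrix.blockDiagonal'_apply_eq, Matrix.mul_apply, Fintype.sum_sigma,
            Finset.sum_eq_single a]
          · simp only [Matrix.blockDiagonal'_apply_eq]
            rw [Finset.sum_mul]
          · intro a' _ ha'
            refine Finset.sum_eq_zero fun p' _ => ?_
            rw [Matrix.blockDiagonal'_apply_ne _ _ _ ha'.symm, zero_mul]
          · simp
        · intro b' _ hb'
          refine Finset.sum_eq_zero fun q' _ => ?_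
          rw [Matrix.blockDiagonal'_apply_ne _ _ _ hb', mul_zero]
        · simp
      rw [Matrix.sum_apply]
      simp only [Matrix.smul_apply, hentry, smul_eq_mul]
      simp only [W, F, X, Matrix.of_apply, Matrix.mul_apply]
      rw [Fintype.sum_prod_type]
      simp only [Finset.mul_sum, Finset.sum_mul]
      conv_rhs => rw [Finset.sum_comm]
      refine Finset.sum_congr rfl fun p' _ => ?_
      conv_rhs => rw [Finset.sum_comm]
      refine Finset.sum_congr rfl fun q' _ => Finset.sum_congr rfl fun y _ => ?_
      simp only [Fin.cast_eq_self]
      ring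
    have hmat : ∀ y : H × K, R.mat i (y.1 * x * y.2) =
        P i * (Matrix.blockDiagonal' (fun a => RH.mat (f i a) y.1) * M i *
          Matrix.blockDiagonal' (fun b => RK.mat (g i b) y.2)) * Q' i := by
      intro y
      have h₁ := hP i y.1
      have h₂ := hQ i y.2
      simp only [MonoidHom.comp_apply, Subgroup.coe_subtype] at h₁ h₂
      rw [map_mul, map_mul, h₁, h₂]
      simp only [M, Matrix.mul_assoc]
    have h₃ : P i * (∑ y : H × K, β y • (Matrix.blockDiagonal' (fun a => RH.mat (f i a) y.1) * M i *
          Matrix.blockDiagonal' (fun b => RK.mat (g i b) y.2))) * Q' i =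
        ∑ y : H × K, β y • R.mat i (y.1 * x * y.2) := by
      simp only [Matrix.mul_sum, Matrix.sum_mul, Matrix.mul_smul, Matrix.smul_mul, hmat]
    exact congrFun (congrFun ((congrArg (fun Z => P i * Z * Q' i) hblock).trans h₃) r) s
  · have hsum : ∑ s : RH.ι × RK.ι, (Fintype.card (J s) : ℝ) * (RH.dim s.1 * RK.dim s.2 : ℕ) ≤
        Fintype.card G := by
      have h₁ : ∑ s : RH.ι × RK.ι, Fintype.card (J s) * (RH.dim s.1 * RK.dim s.2) =
          ∑ i, R.dim i ^ 2 := by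
        have h₂ : ∀ s : RH.ι × RK.ι, Fintype.card (J s) * (RH.dim s.1 * RK.dim s.2) =
            ∑ c : J s, RH.dim (f c.1.1 c.1.2.1) * RK.dim (g c.1.1 c.1.2.2) := by
          intro s
          rw [Finset.sum_congr rfl fun c _ => by rw [← hf c, ← hg c]]
          simp
        rw [Finset.sum_congr rfl fun s _ => h₂ s]
        rw [← Fintype.sum_sigma']
        refine ((Equiv.sigmaFiberEquiv fun c : Col => (f c.1 c.2.1, g c.1 c.2.2)).sum_comp
          fun c : Col => RH.dim (f c.1 c.2.1) * RK.dim (g c.1 c.2.2)).trans ?_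
        rw [Fintype.sum_sigma]
        refine Finset.sum_congr rfl fun i _ => ?_
        rw [Fintype.sum_prod_type]
        refine (Finset.sum_mul_sum Finset.univ Finset.univ (fun a => RH.dim (f i a))
          fun b => RK.dim (g i b)).symm.trans ?_
        rw [hPcard, hQcard, Fintype.card_fin, sq]
      have h₃ := h₁.trans_le R.sum_dim_sq_le
      exact_mod_cast h₃
    have hsq : ∑ s : RH.ι × RK.ι, ((RH.dim s.1 * RK.dim s.2 : ℕ) : ℝ) ^ 2 ≤ Fintype.card G := by
      have h₁ : ∑ s : RH.ι × RK.ι, (RH.dim s.1 * RK.dim s.2) ^ 2 =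
          (∑ i, RH.dim i ^ 2) * ∑ i, RK.dim i ^ 2 := by
        rw [Finset.sum_mul_sum, ← Fintype.sum_prod_type']
        exact Finset.sum_congr rfl fun s _ => mul_pow _ _ _
      have h₂ := (h₁.trans_le (Nat.mul_le_mul RH.sum_dim_sq_le RK.sum_dim_sq_le)).trans hHK
      exact_mod_cast h₂
    have hDG : ∀ s : RH.ι × RK.ι, (RH.dim s.1 * RK.dim s.2) ^ 2 ≤ Fintype.card G := by
      intro s
      have := (Finset.single_le_sum
        (f := fun s : RH.ι × RK.ι => ((RH.dim s.1 * RK.dim s.2 : ℕ) : ℝ) ^ 2)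
        (fun _ _ => by positivity) (Finset.mem_univ s)).trans hsq
      exact_mod_cast this
    have hX : 0 ≤ C * (Fintype.card G : ℝ) ^ ((τ - 2) / 2) := by positivity
    have hprod : ∑ s : RH.ι × RK.ι, ((Fintype.card (J s) : ℝ) / (RH.dim s.1 * RK.dim s.2 : ℕ) + 1) *
        (C * ((RH.dim s.1 * RK.dim s.2 : ℕ) : ℝ) ^ τ) ≤
        2 * C * (Fintype.card G : ℝ) ^ (τ / 2) := by
      refine (Finset.sum_le_sum fun s _ =>
        wide_product_cost_le hM hτ (N := Fintype.card (J s)) (hD s) (hDG s)).trans ?_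
      rw [← Finset.mul_sum, Finset.sum_add_distrib, ← natCast_mul_rpow _ hτ]
      have := mul_le_mul_of_nonneg_left (add_le_add hsum hsq) hX
      linarith
    have hS := mul_le_mul_of_nonneg_left (sum_dim_rpow_le R hτ) (show 0 ≤ 2 * C by positivity)
    rw [← Finset.mul_sum]
    linarith

end Arith

/-! ### Groups with a `(B, N)`-pair -/

namespace BNPair

attribute [instance] BNPair.normal

variable {G : Type*} [Group G] (P : BNPair G)

/-- The double coset `B w B` of an element `w` of the Weyl group, as the set of the products `b *
n * b'` for the representatives `n` of `w`. -/
def cell (w : P.W) : Set G :=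
  {g | ∃ b ∈ P.B, ∃ n : P.N, (n : P.W) = w ∧ ∃ b' ∈ P.B, g = b * n * b'}

variable {P}

theorem coe_eq_iff {m n : P.N} : (m : P.W) = n ↔ (m : G)⁻¹ * n ∈ P.B := by
  rw [QuotientGroup.eq, Subgroup.mem_subgroupOf, Subgroup.mem_inf]
  exact and_iff_left (m⁻¹ * n).2

theorem coe_mem_cell (n : P.N) : (n : G) ∈ P.cell n :=
  ⟨1, one_mem _, n, rfl, 1, one_mem _, by simp⟩

theorem mem_cell_coe {n : P.N} {g : G} :
    g ∈ P.cell n ↔ g ∈ DoubleCoset.doubleCoset (n : G) P.B P.B := by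
  rw [DoubleCoset.mem_doubleCoset]
  constructor
  · rintro ⟨b, hb, m, hm, b', hb', rfl⟩
    refine ⟨b, hb, (n : G)⁻¹ * m * b', MulMemClass.mul_mem (coe_eq_iff.1 hm.symm) hb', by group⟩
  · rintro ⟨b, hb, b', hb', rfl⟩
    exact ⟨b, hb, n, rfl, b', hb', rfl⟩

theorem mul_mem_cell_left {w : P.W} {b g : G} (hb : b ∈ P.B) (hg : g ∈ P.cell w) :
    b * g ∈ P.cell w := by
  obtain ⟨b₁, hb₁, n, hn, b₂, hb₂, rfl⟩ := hg
  exact ⟨b * b₁, MulMemClass.mul_mem hb hb₁, n, hn, b₂, hb₂, by group⟩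

theorem mul_mem_cell_right {w : P.W} {b g : G} (hg : g ∈ P.cell w) (hb : b ∈ P.B) :
    g * b ∈ P.cell w := by
  obtain ⟨b₁, hb₁, n, hn, b₂, hb₂, rfl⟩ := hg
  exact ⟨b₁, hb₁, n, hn, b₂ * b, MulMemClass.mul_mem hb₂ hb, by group⟩

theorem inv_mem_cell {w : P.W} {g : G} (hg : g ∈ P.cell w) : g⁻¹ ∈ P.cell w⁻¹ := by
  obtain ⟨b₁, hb₁, n, rfl, b₂, hb₂, rfl⟩ := hg
  exact ⟨b₂⁻¹, inv_mem hb₂, n⁻¹, by simp, b₁⁻¹, inv_mem hb₁, by simp [mul_assoc]⟩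

theorem mem_cell_one {g : G} : g ∈ P.cell 1 ↔ g ∈ P.B := by
  have h : g ∈ P.cell ((1 : P.N) : P.W) ↔ g ∈ P.B := by
    rw [mem_cell_coe, DoubleCoset.mem_doubleCoset]
    constructor
    · rintro ⟨b, hb, b', hb', rfl⟩
      simpa using MulMemClass.mul_mem hb hb'
    · exact fun hg => ⟨g, hg, 1, one_mem _, by simp⟩
  simpa using h

theorem exists_mul_of_mem_cell {v w : P.W} {g : G} (hg : g ∈ P.cell (v * w)) :
    ∃ x ∈ P.cell v, ∃ y ∈ P.cell w, x * y = g := by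
  induction v using QuotientGroup.induction_on with | H m =>
  induction w using QuotientGroup.induction_on with | H n =>
  rw [← QuotientGroup.mk_mul, mem_cell_coe, DoubleCoset.mem_doubleCoset] at hg
  obtain ⟨b, hb, b', hb', rfl⟩ := hg
  exact ⟨b * m, mul_mem_cell_left hb (coe_mem_cell m), n * b',
    mul_mem_cell_right (coe_mem_cell n) hb', by simp [mul_assoc]⟩

theorem mul_mem_cell {s w : P.W} (hs : s ∈ P.S) {g h : G} (hg : g ∈ P.cell s)
    (hh : h ∈ P.cell w) : g * h ∈ P.cell (s * w) ∨ g * h ∈ P.cell w := by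
  obtain ⟨b₁, hb₁, m, rfl, b₂, hb₂, rfl⟩ := hg
  obtain ⟨b₃, hb₃, n, rfl, b₄, hb₄, rfl⟩ := hh
  have h₁ := P.mul_mem m n hs (b₂ * b₃) (MulMemClass.mul_mem hb₂ hb₃)
  rw [Set.mem_union, ← mem_cell_coe, ← Subgroup.coe_mul, ← mem_cell_coe] at h₁
  have h₂ : b₁ * m * b₂ * (b₃ * n * b₄) = b₁ * (m * (b₂ * b₃) * n) * b₄ := by group
  rw [h₂]
  exact h₁.imp (fun h => mul_mem_cell_right (mul_mem_cell_left hb₁ h) hb₄)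
    fun h => mul_mem_cell_right (mul_mem_cell_left hb₁ h) hb₄

theorem inv_eq_self {s : P.W} (hs : s ∈ P.S) : s⁻¹ = s :=
  inv_eq_of_mul_eq_one_left (P.mul_self s hs)

theorem inv_mem_cell_self {s : P.W} (hs : s ∈ P.S) {g : G} (hg : g ∈ P.cell s) :
    g⁻¹ ∈ P.cell s := by
  simpa only [inv_eq_self hs] using inv_mem_cell hg

theorem mul_mem_cell' {s w : P.W} (hs : s ∈ P.S) {g h : G} (hg : g ∈ P.cell w)
    (hh : h ∈ P.cell s) : g * h ∈ P.cell (w * s) ∨ g * h ∈ P.cell w := by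
  have h₁ := mul_mem_cell hs (inv_mem_cell_self hs hh) (inv_mem_cell hg)
  refine h₁.imp (fun h₂ => ?_) fun h₂ => ?_
  · simpa [inv_eq_self hs] using inv_mem_cell h₂
  · simpa using inv_mem_cell h₂

/-- As `s` does not normalize `B`, the set `BsBsB` is not contained in `B`. -/
theorem exists_mul_mem_cell {s : P.W} (hs : s ∈ P.S) :
    ∃ x ∈ P.cell s, ∃ y ∈ P.cell s, x * y ∈ P.cell s := by
  induction s using QuotientGroup.induction_on with | H m =>
  obtain ⟨b, hb, h⟩ := P.conj_notMem m hs
  have h₁ : (m : G) * b ∈ P.cell m := mul_mem_cell_right (coe_mem_cell m) hb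
  have h₂ : (m : G)⁻¹ ∈ P.cell m := inv_mem_cell_self hs (coe_mem_cell m)
  refine ⟨_, h₁, _, h₂, (mul_mem_cell hs h₁ h₂).resolve_left fun h₃ => h ?_⟩
  rwa [P.mul_self _ hs, mem_cell_one] at h₃

theorem ne_one {s : P.W} (hs : s ∈ P.S) : s ≠ 1 := by
  rintro rfl
  obtain ⟨b, hb, h⟩ := P.conj_notMem 1 (by simpa using hs)
  exact h (by simpa using hb)

variable (P) in
/-- A word in the distinguished generators of the Weyl group. -/
def IsWord (l : List P.W) : Prop := ∀ t ∈ l, t ∈ P.S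

variable (P) in
/-- A word that is as short as possible among the words with the same product. -/
def IsReduced (l : List P.W) : Prop :=
  P.IsWord l ∧ ∀ l', P.IsWord l' → l'.prod = l.prod → l.length ≤ l'.length

theorem isWord_cons {s : P.W} {l : List P.W} : P.IsWord (s :: l) ↔ s ∈ P.S ∧ P.IsWord l :=
  List.forall_mem_cons

theorem isWord_append {l l' : List P.W} : P.IsWord (l ++ l') ↔ P.IsWord l ∧ P.IsWord l' :=
  List.forall_mem_append

theorem exists_isWord (w : P.W) : ∃ l, P.IsWord l ∧ l.prod = w := by
  have hw : w ∈ Subgroup.closure P.S := by rw [P.closure_S]; trivial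
  induction hw using Subgroup.closure_induction with
  | mem s hs => exact ⟨[s], by simpa [IsWord] using hs, by simp⟩
  | one => exact ⟨[], by simp [IsWord], rfl⟩
  | mul v w _ _ hv hw =>
    obtain ⟨l, hl, rfl⟩ := hv
    obtain ⟨l', hl', rfl⟩ := hw
    exact ⟨l ++ l', isWord_append.2 ⟨hl, hl'⟩, List.prod_append⟩
  | inv w _ hw =>
    obtain ⟨l, hl, rfl⟩ := hw
    refine ⟨l.reverse, fun t ht => hl t (List.mem_reverse.1 ht), ?_⟩
    rw [List.prod_inv_reverse, List.map_congr_left (f := fun t => t⁻¹) (g := id)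
      fun t ht => inv_eq_self (hl t ht), List.map_id]

theorem exists_isReduced (w : P.W) : ∃ l, P.IsReduced l ∧ l.prod = w := by
  obtain ⟨l, hl, hmin⟩ := (exists_isWord w).elim fun l hl =>
    exists_minimalFor_of_wellFoundedLT (fun l => P.IsWord l ∧ l.prod = w) List.length ⟨l, hl⟩
  refine ⟨l, ⟨hl.1, fun l' hl' h => ?_⟩, hl.2⟩
  by_contra! hlt
  exact absurd (hmin ⟨hl', h.trans hl.2⟩ hlt.le) hlt.not_ge

theorem IsReduced.tail {s : P.W} {l : List P.W} (h : P.IsReduced (s :: l)) : P.IsReduced l := by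
  refine ⟨(isWord_cons.1 h.1).2, fun l' hl' hp => ?_⟩
  simpa using h.2 (s :: l') (isWord_cons.2 ⟨(isWord_cons.1 h.1).1, hl'⟩) (by simp [hp])

/-- By induction on the word: `BslB = BwB` implies that `BlB` is one of `BwB` and `BswB`, and `l`
is too short to be a word for `w`. -/
theorem eq_of_mem_cell_of_length_le {l : List P.W} (hl : P.IsWord l) {w : P.W} {g : G}
    (hg : g ∈ P.cell l.prod) (hw : g ∈ P.cell w)
    (hmin : ∀ l', P.IsWord l' → l'.prod = w → l.length ≤ l'.length) : l.prod = w := by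
  induction l generalizing w g with
  | nil =>
    obtain ⟨b, hb, n, rfl, b', hb', rfl⟩ := hw
    rw [List.prod_nil, mem_cell_one] at hg
    have h : (n : G) ∈ P.B := by
      simpa [mul_assoc] using
        MulMemClass.mul_mem (MulMemClass.mul_mem (inv_mem hb) hg) (inv_mem hb')
    rw [List.prod_nil, ← QuotientGroup.mk_one, coe_eq_iff]
    simpa using h
  | cons s l ih =>
    obtain ⟨hs, hl⟩ := isWord_cons.1 hl
    rw [List.prod_cons] at hg
    obtain ⟨x, hx, y, hy, rfl⟩ := exists_mul_of_mem_cell hg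
    have h := mul_mem_cell hs (inv_mem_cell_self hs hx) hw
    rw [inv_mul_cancel_left] at h
    rcases h with h | h
    · rw [List.prod_cons, ih hl hy h fun l' hl' hp => ?_, ← mul_assoc, P.mul_self s hs, one_mul]
      simpa using hmin (s :: l') (isWord_cons.2 ⟨hs, hl'⟩)
        (by rw [List.prod_cons, hp, ← mul_assoc, P.mul_self s hs, one_mul])
    · have hmin' : ∀ l', P.IsWord l' → l'.prod = w → l.length ≤ l'.length := fun l' hl' hp =>
        (Nat.le_succ _).trans (hmin l' hl' hp)
      simpa using hmin l hl (ih hl hy h hmin')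

/-- The uniqueness in the Bruhat decomposition. -/
theorem eq_of_mem_cell {v w : P.W} {g : G} (hv : g ∈ P.cell v) (hw : g ∈ P.cell w) : v = w := by
  obtain ⟨l, hl, rfl⟩ := exists_isReduced v
  obtain ⟨l', hl', rfl⟩ := exists_isReduced w
  rcases le_total l.length l'.length with h | h
  · exact eq_of_mem_cell_of_length_le hl.1 hv hw fun l'' h'' hp => h.trans (hl'.2 l'' h'' hp)
  · exact (eq_of_mem_cell_of_length_le hl'.1 hw hv fun l'' h'' hp => h.trans (hl.2 l'' h'' hp)).symm

/-- The existence in the Bruhat decomposition. -/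
theorem exists_mem_cell (g : G) : ∃ w, g ∈ P.cell w := by
  have hs : ∀ l : List P.W, P.IsWord l → ∀ n : P.N, (n : P.W) = l.prod → ∀ x : G,
      (∃ w, x ∈ P.cell w) → ∃ w, n * x ∈ P.cell w := by
    intro l
    induction l with
    | nil =>
      rintro - n hn x ⟨w, hx⟩
      rw [List.prod_nil] at hn
      exact ⟨w, mul_mem_cell_left (mem_cell_one.1 (hn ▸ coe_mem_cell n)) hx⟩
    | cons s l ih =>
      intro hsl n hn x hx
      obtain ⟨hs, hl⟩ := isWord_cons.1 hsl
      obtain ⟨m, rfl⟩ := QuotientGroup.mk_surjective s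
      obtain ⟨w, hw⟩ := ih hl (m⁻¹ * n) (by simp [hn]) x hx
      have h := mul_mem_cell hs (coe_mem_cell m) hw
      rw [Subgroup.coe_mul, Subgroup.coe_inv, mul_assoc, mul_inv_cancel_left] at h
      exact h.elim (fun h => ⟨_, h⟩) fun h => ⟨_, h⟩
  have hN : ∀ n ∈ P.N, ∀ x : G, (∃ w, x ∈ P.cell w) → ∃ w, n * x ∈ P.cell w := by
    intro n hn
    obtain ⟨l, hl, hp⟩ := exists_isWord ((⟨n, hn⟩ : P.N) : P.W)
    exact hs l hl ⟨n, hn⟩ hp.symm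
  have hB : ∀ b ∈ P.B, ∀ x : G, (∃ w, x ∈ P.cell w) → ∃ w, b * x ∈ P.cell w :=
    fun b hb x ⟨w, hw⟩ => ⟨w, mul_mem_cell_left hb hw⟩
  have hg : g ∈ Subgroup.closure ((P.B : Set G) ∪ P.N) := by
    rw [← Subgroup.sup_eq_closure, P.sup_eq_top]
    trivial
  have key : ∀ x : G, (∃ w, g * x ∈ P.cell w) ↔ ∃ w, x ∈ P.cell w := by
    induction hg using Subgroup.closure_induction with
    | mem y hy =>
      rcases hy with hy | hy
      · exact fun x => ⟨fun h => by simpa using hB _ (inv_mem hy) _ h, hB y hy x⟩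
      · exact fun x => ⟨fun h => by simpa using hN _ (inv_mem hy) _ h, hN y hy x⟩
    | one => simp
    | mul y z _ _ hy hz => exact fun x => by rw [mul_assoc, hy, hz]
    | inv y _ hy => exact fun x => by rw [← hy, mul_inv_cancel_left]
  simpa using (key 1).2 ⟨1, mem_cell_one.2 (one_mem _)⟩

variable (P) in
/-- `BsBwB` contains `BwB`; for `s ∈ S` this means that `sw` is shorter than `w`. -/
def IsDescent (s w : P.W) : Prop := ∃ x ∈ P.cell s, ∃ y ∈ P.cell w, x * y ∈ P.cell w

theorem mul_mem_cell_of_not_isDescent {s w : P.W} (hs : s ∈ P.S) (h : ¬ P.IsDescent s w) {x y : G}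
    (hx : x ∈ P.cell s) (hy : y ∈ P.cell w) : x * y ∈ P.cell (s * w) :=
  (mul_mem_cell hs hx hy).resolve_right fun h' => h ⟨x, hx, y, hy, h'⟩

/-- The exchange property: if `s` is a descent of a word, a letter `t` of the word can be removed
and `s` put in front of it instead. -/
theorem IsDescent.exists_exchange {s : P.W} (hs : s ∈ P.S) {l : List P.W} (hl : P.IsWord l)
    (h : P.IsDescent s l.prod) :
    ∃ l₁ t l₂, l = l₁ ++ t :: l₂ ∧ s * l₁.prod = l₁.prod * t := by
  induction l using List.reverseRecOn with
  | nil =>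
    obtain ⟨x, hx, y, hy, hxy⟩ := h
    rw [List.prod_nil, mem_cell_one] at hy hxy
    have : x ∈ P.cell 1 := mem_cell_one.2 (by simpa using MulMemClass.mul_mem hxy (inv_mem hy))
    exact absurd (eq_of_mem_cell hx this) (ne_one hs)
  | append_singleton l t ih =>
    obtain ⟨hl, ht⟩ := isWord_append.1 hl
    replace ht : t ∈ P.S := ht t (by simp)
    by_cases hd : P.IsDescent s l.prod
    · obtain ⟨l₁, t', l₂, rfl, h'⟩ := ih hl hd
      exact ⟨l₁, t', l₂ ++ [t], by simp, h'⟩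
    · obtain ⟨x, hx, y, hy, hxy⟩ := h
      rw [List.prod_append, List.prod_singleton] at hy hxy
      obtain ⟨y₁, hy₁, y₂, hy₂, rfl⟩ := exists_mul_of_mem_cell hy
      rw [← mul_assoc] at hxy
      rcases mul_mem_cell' ht (mul_mem_cell_of_not_isDescent hs hd hx hy₁) hy₂ with h | h
      · have := eq_of_mem_cell h hxy
        rw [mul_assoc, mul_eq_right] at this
        exact absurd this (ne_one hs)
      · exact ⟨l, t, [], rfl, eq_of_mem_cell h hxy⟩

/-- If `sl` is reduced, then `sBl ⊆ BslB`. -/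
theorem IsReduced.not_isDescent {s : P.W} {l : List P.W} (h : P.IsReduced (s :: l)) :
    ¬ P.IsDescent s l.prod := by
  intro hd
  obtain ⟨hs, hl⟩ := isWord_cons.1 h.1
  obtain ⟨l₁, t, l₂, rfl, he⟩ := hd.exists_exchange hs hl
  obtain ⟨h₁, h₂⟩ := isWord_append.1 hl
  have ht := (isWord_cons.1 h₂).1
  have := h.2 (l₁ ++ l₂) (isWord_append.2 ⟨h₁, (isWord_cons.1 h₂).2⟩) (by
    simp only [List.prod_append, List.prod_cons]
    rw [← mul_assoc s, he, mul_assoc, ← mul_assoc t, P.mul_self t ht, one_mul])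
  simp at this

/-- An element of `W` of which every `s ∈ S` is a descent is the end of the longest words: every
reduced word can be continued to a reduced word for it. -/
theorem exists_append_isReduced {w₀ : P.W} (h₀ : ∀ s ∈ P.S, P.IsDescent s w₀) {v : List P.W}
    (hv : P.IsReduced v) : ∃ x, P.IsReduced (v ++ x) ∧ (v ++ x).prod = w₀ := by
  induction v with
  | nil => simpa using exists_isReduced w₀
  | cons s v ih =>
    obtain ⟨x, hx, hp⟩ := ih hv.tail
    obtain ⟨hs, hv'⟩ := isWord_cons.1 hv.1
    obtain ⟨l₁, t, l₂, he, h⟩ := IsDescent.exists_exchange hs hx.1 (hp ▸ h₀ s hs)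
    have hw := he ▸ hx.1
    have ht := (isWord_cons.1 (isWord_append.1 hw).2).1
    have hl₂ := (isWord_cons.1 (isWord_append.1 hw).2).2
    have hxS := (isWord_append.1 hx.1).2
    have hcase : (∃ c, v = l₁ ++ t :: c) ∨ ∃ a, l₁ = v ++ a ∧ x = a ++ t :: l₂ := by
      rcases List.append_eq_append_iff.1 he with ⟨a, h₁, h₂⟩ | ⟨a, h₁, h₂⟩
      · exact Or.inr ⟨a, h₁, h₂⟩
      · cases a with
        | nil => exact Or.inr ⟨[], by simpa using h₁.symm, by simpa using h₂.symm⟩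
        | cons t' c =>
          rw [List.cons_append, List.cons.injEq] at h₂
          exact Or.inl ⟨c, by rw [h₂.1, h₁]⟩
    rcases hcase with ⟨c, rfl⟩ | ⟨a, rfl, rfl⟩
    · obtain ⟨h₁, h₂⟩ := isWord_append.1 hv'
      have := hv.2 (l₁ ++ c) (isWord_append.2 ⟨h₁, (isWord_cons.1 h₂).2⟩) (by
        simp only [List.prod_append, List.prod_cons]
        rw [← mul_assoc s, h, mul_assoc, ← mul_assoc t, P.mul_self t ht, one_mul])
      simp at this
    · have hprod : ((s :: v) ++ (a ++ l₂)).prod = w₀ := by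
        rw [← hp]
        simp only [List.prod_append, List.prod_cons, List.cons_append] at h ⊢
        calc _ = s * (v.prod * a.prod) * l₂.prod := by simp only [mul_assoc]
          _ = _ := by rw [h]; simp only [mul_assoc]
      refine ⟨a ++ l₂, ⟨isWord_append.2 ⟨hv.1, isWord_append.2
        ⟨(isWord_append.1 hxS).1, hl₂⟩⟩, fun l' hl' hpl => ?_⟩, hprod⟩
      have := hx.2 l' hl' (hpl.trans (hprod.trans hp.symm))
      simp at this ⊢
      omega

/-- If `sw` is longer than `w`, then `B ∩ swB(sw)⁻¹` is contained in `sBs⁻¹`. -/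
theorem conj_mem_of_not_isDescent {m n : P.N} (hs : (m : P.W) ∈ P.S)
    (hd : ¬ P.IsDescent (m : P.W) n) {d : G} (hB : d ∈ P.B)
    (h : ((m : G) * n)⁻¹ * d * (m * n) ∈ P.B) : (m : G)⁻¹ * d * m ∈ P.B := by
  have h₁ : (m : G)⁻¹ ∈ P.cell m := inv_mem_cell_self hs (coe_mem_cell m)
  have h₂ := mul_mem_cell hs (mul_mem_cell_right h₁ hB) (coe_mem_cell m)
  rw [P.mul_self _ hs, mem_cell_one] at h₂
  refine h₂.resolve_right fun h₃ => ?_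
  have h₄ := mul_mem_cell_of_not_isDescent hs hd h₃ (coe_mem_cell n)
  have h₅ : (m : G)⁻¹ * d * m * n = n * (((m : G) * n)⁻¹ * d * (m * n)) := by group
  have h₆ := eq_of_mem_cell h₄ (h₅ ▸ mul_mem_cell_right (coe_mem_cell n) h)
  rw [mul_eq_right] at h₆
  exact ne_one hs h₆

/-- If `vx` is a reduced product, then `B ∩ vxB(vx)⁻¹` is contained in `vBv⁻¹`. -/
theorem IsReduced.conj_mem {v x : List P.W} (hr : P.IsReduced (v ++ x)) {m n : P.N}
    (hm : (m : P.W) = v.prod) (hn : (n : P.W) = x.prod) {d : G} (hB : d ∈ P.B)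
    (h : ((m : G) * n)⁻¹ * d * (m * n) ∈ P.B) : (m : G)⁻¹ * d * m ∈ P.B := by
  induction v generalizing m d with
  | nil =>
    have : (m : G) ∈ P.B := mem_cell_one.1 (by simpa [hm] using coe_mem_cell m)
    exact MulMemClass.mul_mem (MulMemClass.mul_mem (inv_mem this) hB) this
  | cons s v ih =>
    obtain ⟨k, rfl⟩ := QuotientGroup.mk_surjective s
    have hs := (isWord_cons.1 hr.1).1
    have hm' : ((k⁻¹ * m : P.N) : P.W) = v.prod := by simp [hm]
    have hd := hr.not_isDescent
    rw [List.append_eq, List.prod_append, ← hm', ← hn, ← QuotientGroup.mk_mul] at hd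
    have h₁ := conj_mem_of_not_isDescent hs hd hB (by
      simpa [mul_assoc] using h)
    have h₂ := ih hr.tail hm' h₁ (by simpa [mul_assoc] using h)
    simpa [mul_assoc] using h₂

/-- A `w` with `BwB` as large as possible has every `s ∈ S` as a descent: otherwise `BsBwB = BswB`
contains `xBwB` for each `x` in `BsB`, hence is equal to it. As there are `x`, `y` in `BsB` with
`xy` in `BsB`, it follows that `xyBwB = BwB`. -/
theorem exists_forall_isDescent [Finite G] : ∃ w₀ : P.W, ∀ s ∈ P.S, P.IsDescent s w₀ := by
  obtain ⟨w, hw⟩ := Finite.exists_max fun w : P.W => (P.cell w).ncard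
  refine ⟨w, fun s hs => ?_⟩
  by_contra hd
  have hmem : ∀ {x y}, x ∈ P.cell s → y ∈ P.cell w → x * y ∈ P.cell (s * w) :=
    mul_mem_cell_of_not_isDescent hs hd
  have himage : ∀ x ∈ P.cell s, (x * ·) '' P.cell w = P.cell (s * w) := by
    intro x hx
    refine Set.eq_of_subset_of_ncard_le ?_ ?_ (Set.toFinite _)
    · rintro _ ⟨y, hy, rfl⟩
      exact hmem hx hy
    · rw [Set.ncard_image_of_injective _ (mul_right_injective x)]
      exact hw _
  obtain ⟨x, hx, y, hy, hxy⟩ := exists_mul_mem_cell hs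
  obtain ⟨z, hz⟩ : ∃ z, z ∈ P.cell w := by
    obtain ⟨n, rfl⟩ := QuotientGroup.mk_surjective w
    exact ⟨_, coe_mem_cell n⟩
  -- `y * z` lies in `BswB = x⁻¹BwB`
  have h₁ := hmem hy hz
  rw [← himage _ (inv_mem_cell_self hs hx)] at h₁
  obtain ⟨z', hz', h₂⟩ := h₁
  have h₃ : x * y * z = z' := by
    rw [mul_assoc, ← h₂, mul_inv_cancel_left]
  exact hd ⟨x * y, hxy, z, hz, h₃ ▸ hz'⟩

end BNPair

namespace SplitBNPair

variable {G : Type*} [Group G] (P : SplitBNPair G)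

/-- The big cell: for the longest element `n` of the Weyl group, `B ∩ nBn⁻¹ = T`, hence
`(u, b) ↦ u * n * b` is injective on `U × B`. -/
theorem card_U_mul_card_B_le [Finite G] : Nat.card P.U * Nat.card P.B ≤ Nat.card G := by
  obtain ⟨w₀, hw₀⟩ := BNPair.exists_forall_isDescent (P := P.toBNPair)
  obtain ⟨n, rfl⟩ := QuotientGroup.mk_surjective w₀
  have key : ∀ d ∈ P.B, (n : G)⁻¹ * d * n ∈ P.B → d ∈ P.B ⊓ P.N := by
    intro d hB hd
    refine P.saturated d fun m hm => ?_
    obtain ⟨v, hv, hvp⟩ := BNPair.exists_isReduced (P := P.toBNPair) ((⟨m, hm⟩⁻¹ : P.N) : P.W)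
    obtain ⟨x, hx, hxp⟩ := BNPair.exists_append_isReduced hw₀ hv
    rw [List.prod_append, hvp] at hxp
    have := hx.conj_mem (n := ⟨m, hm⟩ * n) hvp.symm (by
        rw [QuotientGroup.mk_mul, ← hxp, QuotientGroup.mk_inv, mul_inv_cancel_left]) hB
      (by simpa using hd)
    simpa using this
  rw [← Nat.card_prod]
  refine Nat.card_le_card_of_injective (fun y : P.U × P.B => (y.1 : G) * n * y.2) ?_
  rintro ⟨u, b⟩ ⟨u', b'⟩ h
  dsimp only at h
  have h₁ : (n : G)⁻¹ * ((u' : G)⁻¹ * u) * n = b' * (b : G)⁻¹ := by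
    rw [eq_mul_inv_iff_mul_eq, ← mul_right_inj ((u' : G) * n)]
    rw [← h]
    group
  have h₂ : (u' : G)⁻¹ * u ∈ P.U := MulMemClass.mul_mem (inv_mem u'.2) u.2
  have h₃ := key _ (P.U_le h₂) (h₁ ▸ MulMemClass.mul_mem b'.2 (inv_mem b.2))
  have h₄ : (u' : G)⁻¹ * u ∈ P.U ⊓ (P.B ⊓ P.N) := ⟨h₂, h₃⟩
  rw [P.inf_eq_bot, Subgroup.mem_bot, inv_mul_eq_one] at h₄
  have h₅ : u = u' := Subtype.ext h₄.symm
  subst h₅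
  exact Prod.ext rfl (Subtype.ext (mul_left_cancel h))

theorem exists_mul_eq {b : G} (hb : b ∈ P.B) : ∃ u ∈ P.U, ∃ t ∈ P.B ⊓ P.N, u * t = b := by
  have hT : P.B ⊓ P.N ≤ Subgroup.normalizer P.U :=
    inf_le_left.trans ((Subgroup.normal_subgroupOf_iff_le_normalizer P.U_le).1 P.U_normal)
  rw [← P.sup_eq, ← SetLike.mem_coe, Subgroup.coe_mul_of_right_le_normalizer_left _ _ hT] at hb
  exact Set.mem_mul.1 hb

/-- `G = ⋃ U n B`, over representatives `n` of the elements of the Weyl group. -/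
theorem exists_eq_mul (g : G) :
    ∃ (w : P.W) (u : P.U) (b : P.B), g = u * (w.out : G) * b := by
  obtain ⟨w, hg⟩ := BNPair.exists_mem_cell (P := P.toBNPair) g
  rw [← w.out_eq] at hg
  obtain ⟨b, hb, b', hb', rfl⟩ :=
    (DoubleCoset.mem_doubleCoset).1 (BNPair.mem_cell_coe.1 hg)
  obtain ⟨u, hu, t, ht, rfl⟩ := P.exists_mul_eq hb
  have h := P.normal.conj_mem ⟨t, ht.2⟩ (Subgroup.mem_subgroupOf.2 ht) w.out⁻¹
  rw [Subgroup.mem_subgroupOf] at h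
  exact ⟨w, ⟨u, hu⟩, ⟨_, MulMemClass.mul_mem h.1 hb'⟩, by simp [mul_assoc]⟩

theorem isSolvable_U [Finite G] : Group.IsSolvable P.U := by
  have := Fact.mk P.prime
  have := P.isPGroup.isNilpotent
  infer_instance

theorem isSolvable_B [Finite G] : Group.IsSolvable P.B := by
  have := P.isSolvable_U
  have hU := P.U_normal
  have : Group.IsSolvable (P.U.subgroupOf P.B) :=
    Group.isSolvable_of_isSolvable_injective
      (f := (Subgroup.subgroupOfEquivOfLe P.U_le).toMonoidHom)
      (Subgroup.subgroupOfEquivOfLe P.U_le).injective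
  have hrep : ∀ q : P.B ⧸ P.U.subgroupOf P.B, ∃ t : P.B, (t : G) ∈ P.B ⊓ P.N ∧
      (t : P.B ⧸ _) = q := by
    intro q
    obtain ⟨b, rfl⟩ := QuotientGroup.mk_surjective q
    obtain ⟨u, hu, t, ht, h⟩ := P.exists_mul_eq b.2
    refine ⟨⟨t, ht.1⟩, ht, ?_⟩
    have hb : b = ⟨u, P.U_le hu⟩ * ⟨t, ht.1⟩ := Subtype.ext h.symm
    have hu' : ((⟨u, P.U_le hu⟩ : P.B) : P.B ⧸ P.U.subgroupOf P.B) = 1 :=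
      (QuotientGroup.eq_one_iff _).2 (Subgroup.mem_subgroupOf.2 hu)
    rw [hb, QuotientGroup.mk_mul, hu', one_mul]
  have : Group.IsSolvable (P.B ⧸ P.U.subgroupOf P.B) := by
    refine Group.isSolvable_of_comm fun q r => ?_
    obtain ⟨t, ht, rfl⟩ := hrep q
    obtain ⟨t', ht', rfl⟩ := hrep r
    rw [← QuotientGroup.mk_mul, ← QuotientGroup.mk_mul]
    exact congrArg _ (Subtype.ext (P.comm t ht t' ht'))
  exact Group.isSolvable_of_ker_le_range (P.U.subgroupOf P.B).subtype
    (QuotientGroup.mk' (P.U.subgroupOf P.B)) (by simp)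

end SplitBNPair

/-! ### The Fourier transform by double cosets -/

namespace Arith

variable {C τ : ℝ}

/-- The Fourier transform over a union of sets `H * x w * K`: the function is distributed over the
sets `H × K`, at no cost, and the transforms of its parts are added. -/
theorem hasCircuit_dft_of_forall_eq_mul (hM : MulBound C τ) (hτ : 2 ≤ τ) {G : Type*} [Group G]
    [Fintype G] (R : CompleteIrreps G) {H K : Subgroup G} [Fintype H] [Fintype K]
    (hHK : Fintype.card H * Fintype.card K ≤ Fintype.card G) {ι : Type*} [Fintype ι] (x : ι → G)
    (hx : ∀ g, ∃ (w : ι) (h : H) (k : K), g = h * x w * k) {bH bK : ℝ}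
    (hH : ∀ RH : CompleteIrreps H, HasCircuit RH.dft bH)
    (hK : ∀ RK : CompleteIrreps K, HasCircuit RK.dft bK) :
    HasCircuit R.dft (Fintype.card ι * (Fintype.card H * bK + Fintype.card K * bH +
      4 * C * (Fintype.card G : ℝ) ^ (τ / 2) + Fintype.card G)) := by
  choose w h k hg using hx
  let φ : G → ι × H × K := fun g => (w g, h g, k g)
  let ψ : ι × H × K → G := fun z => z.2.1 * x z.1 * z.2.2
  have hψ : ∀ g, ψ (φ g) = g := fun g => (hg g).symm
  have hφ : Function.Injective φ := (show Function.LeftInverse ψ φ from hψ).injective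
  have hβ : ∀ v, HasCircuit (fun (c : G → ℂ) (y : H × K) => Function.extend φ c 0 (v, y)) 0 := by
    intro v
    refine hasCircuit_wire _ fun y => ?_
    by_cases hy : ∃ g, φ g = (v, y)
    · obtain ⟨g, hgy⟩ := hy
      exact Or.inl ⟨g, fun c => by rw [← hgy, hφ.extend_apply]⟩
    · exact Or.inr ⟨0, fun c => by rw [Function.extend_apply' _ _ _ hy, Pi.zero_apply]⟩
  have hsum := hasCircuit_sum fun v =>
    (hasCircuit_two_subgroups hM hτ R hHK (x v) hH hK).comp (hβ v)
  refine (hsum.congr fun c e => ?_).mono ?_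
  · have h₁ : ∑ z : ι × H × K, Function.extend φ c 0 z • R.mat e.1 (ψ z) =
        ∑ g, c g • R.mat e.1 g :=
      (Fintype.sum_of_injective φ hφ _ _
        (fun z hz => by
          rw [Function.extend_apply' _ _ _ (by simpa using hz), Pi.zero_apply, zero_smul])
        fun g => by rw [hφ.extend_apply, hψ]).symm
    rw [CompleteIrreps.dft_apply, ← h₁, Fintype.sum_prod_type, Matrix.sum_apply]
  · have h₁ : Fintype.card R.Entry ≤ Fintype.card G := by
      refine le_trans (le_of_eq ?_) R.sum_dim_sq_le
      simp [CompleteIrreps.Entry, Fintype.card_sigma, sq]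
    have h₂ : (Fintype.card ι : ℝ) * Fintype.card R.Entry ≤
        Fintype.card ι * Fintype.card G := by
      gcongr
    simp only [zero_add, Finset.sum_const, Finset.card_univ, nsmul_eq_mul]
    linarith

end Arith

open Arith in
theorem theorem5p2 (ε : ℝ) (hε : 0 < ε) :
    ∃ C : ℝ, ∀ (G : Type*) [Group G] [Fintype G] (P : SplitBNPair G) (R : CompleteIrreps G),
      ∃ Γ : Arith.Circuit ℂ G R.Entry, Γ.Computes R.dft ∧
        (Γ.size : ℝ) ≤
          C * (Fintype.card G : ℝ) ^ (matMulExponent / 2 + ε) * (Nat.card P.W : ℝ) := by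
  classical
  have hω := two_le_matMulExponent
  have hτ : 2 < matMulExponent + ε := by linarith
  obtain ⟨C, hM⟩ := exists_mulBound (show matMulExponent < matMulExponent + ε by linarith)
  obtain ⟨D, hD, hsolv⟩ := exists_hasCircuit_dft_of_isSolvable' hM hτ
    (show (matMulExponent + ε) / 2 < matMulExponent / 2 + ε by linarith)
  set a := matMulExponent / 2 + ε with ha
  have ha₁ : 1 ≤ a := by linarith
  refine ⟨2 * D + 4 * C + 1, fun G _ _ P R => ?_⟩
  have : Fintype P.W := Fintype.ofFinite _
  have hU := P.isSolvable_U
  have hB := P.isSolvable_B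
  have hcard : Fintype.card P.U * Fintype.card P.B ≤ Fintype.card G := by
    simpa only [Nat.card_eq_fintype_card] using P.card_U_mul_card_B_le
  refine (hasCircuit_dft_of_forall_eq_mul hM hτ.le R hcard (fun w : P.W => (w.out : G))
    P.exists_eq_mul (hsolv P.U) (hsolv P.B)).mono ?_
  have hG : (1 : ℝ) ≤ Fintype.card G := by exact_mod_cast Fintype.card_pos (α := G)
  have hprod : ((Fintype.card P.U : ℝ) * Fintype.card P.B) ^ a ≤ (Fintype.card G : ℝ) ^ a :=
    Real.rpow_le_rpow (by positivity) (by exact_mod_cast hcard) (by linarith)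
  rw [Real.mul_rpow (by positivity) (by positivity)] at hprod
  have hle : ∀ n : ℕ, 0 < n → (n : ℝ) ≤ (n : ℝ) ^ a := fun n hn =>
    Real.self_le_rpow_of_one_le (by exact_mod_cast hn) ha₁
  have h₁ : (Fintype.card P.U : ℝ) * (D * (Fintype.card P.B : ℝ) ^ a) ≤
      D * (Fintype.card G : ℝ) ^ a :=
    calc _ ≤ (Fintype.card P.U : ℝ) ^ a * (D * (Fintype.card P.B : ℝ) ^ a) := by
          gcongr
          exact hle _ Fintype.card_pos
      _ = D * ((Fintype.card P.U : ℝ) ^ a * (Fintype.card P.B : ℝ) ^ a) := by ring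
      _ ≤ _ := by gcongr
  have h₂ : (Fintype.card P.B : ℝ) * (D * (Fintype.card P.U : ℝ) ^ a) ≤
      D * (Fintype.card G : ℝ) ^ a :=
    calc _ ≤ (Fintype.card P.B : ℝ) ^ a * (D * (Fintype.card P.U : ℝ) ^ a) := by
          gcongr
          exact hle _ Fintype.card_pos
      _ = D * ((Fintype.card P.U : ℝ) ^ a * (Fintype.card P.B : ℝ) ^ a) := by ring
      _ ≤ _ := by gcongr
  have h₃ : (Fintype.card G : ℝ) ^ ((matMulExponent + ε) / 2) ≤ (Fintype.card G : ℝ) ^ a :=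
    Real.rpow_le_rpow_of_exponent_le hG (by linarith)
  have h₄ := mul_le_mul_of_nonneg_left h₃ (show 0 ≤ 4 * C by linarith [hM.nonneg])
  have h₅ := hle _ (Fintype.card_pos (α := G))
  rw [Nat.card_eq_fintype_card, mul_comm]
  gcongr
  linarith
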